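/- Let $\mathbb F$ be an algebraically closed field of any characteristic $p\ge 0$, let $G$ be a finite group, let $V_1,\dots,V_r$ be a complete set of pairwise non-isomorphic finite-dimensional simple $\mathbb FG$-modules, and let $n\ge 0$. **Algebras.** For $m\ge 0$ let $S_m$ act on $G^m$ by ${}^wg=(g_{w^{-1}(1)},\dots,g_{w^{-1}(m)})$, let $s_i=(i\ i{+}1)$, and put $t_{ij}=\sum_{h\in G}h^{(i)}(h^{-1})^{(j)}$, where $h^{(i)}\in G^m$ has $h$ in position $i$ and $1$ elsewhere. The wreath Hecke algebra $\mathcal H_m(G)$ is the associative unital $\mathbb F$-algebra generated by $G^m$ (with its group multiplication), $s_1,\dots,s_{m-1}$ and $x_1,\dots,x_m$ subject to $$x_ix_j=x_jx_i,\quad x_ig=gx_i,\quad s_i^2=1,\quad s_is_j=s_js_i\ (|i-j|>1),\quad s_is_{i+1}s_i=s_{i+1}s_is_{i+1},$$ $$s_ix_i=x_{i+1}s_i-t_{i,i+1},\quad s_ix_j=x_js_i\ (j\ne i,i+1),\quad s_ig={}^{s_i}g\,s_i .$$ The degenerate affine Hecke algebra $\mathcal H_m$ is generated by $s_1,\dots,s_{m-1},y_1,\dots,y_m$,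 where the $y_i$ commute, the $s_i$ satisfy the Coxeter relations above, $s_iy_i=y_{i+1}s_i-1$, and $s_iy_j=y_js_i$ for $j\neq i,i+1$. The algebra ${}^0\mathcal H_m=\mathbb F[y_1,\dots,y_m]\rtimes\mathbb FS_m$ has the same presentation with $s_iy_i=y_{i+1}s_i$ in place of $s_iy_i=y_{i+1}s_i-1$. There is a unique scalar $c_k\in\mathbb F$ such that $t_{12}$ acts on $V_k\otimes V_k$ as $c_k$ times the flip of the two tensor factors. Put ${}^{c_k}\mathcal H_m=\mathcal H_m$ if $c_k\ne0$ and ${}^{c_k}\mathcal H_m={}^0\mathcal H_m$ if $c_k=0$. Let $\mathcal C_n^r$ be the set of $\widehat n=(n_1,\dots,n_r)\in\mathbb Z_{\ge0}^r$ with $n_1+\dots+n_r=n$, and $$A_{\widehat n,r}={}^{c_1}\mathcal H_{n_1}\otimes\cdots\otimes{}^{c_r}\mathcal H_{n_r},\qquad A_{n,r}=\bigoplus_{\widehat n\in\mathcal C_n^r}A_{\widehat n,r}.$$ **Modules.** Let $A_{n,r}\text{-mod}$ be the category of finite-dimensional left $A_{n,r}$-modules, and $\mathcal H_n(G)\text{-mod}^s$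 the full subcategory of those finite-dimensional left $\mathcal H_n(G)$-modules that are semisimple as $\mathbb FG^n$-modules. For $\widehat n\in\mathcal C_n^r$ let $V(\widehat n)=V_1^{\otimes n_1}\otimes\cdots\otimes V_r^{\otimes n_r}$, a module over $G^n$; let $S_{\widehat n}=S_{n_1}\times\cdots\times S_{n_r}\subseteq S_n$ be the Young subgroup; and let $\mathcal H_{\widehat n}(G)\cong\mathcal H_{n_1}(G)\otimes\cdots\otimes\mathcal H_{n_r}(G)$ be the subalgebra of $\mathcal H_n(G)$ generated by $G^n$, $x_1,\dots,x_n$ and $S_{\widehat n}$. For $1\le i\le n$ let $l_i$ be the index of the block of $\widehat n$ that contains $i$, and put $\gamma_i=c_{l_i}$ if $c_{l_i}\neq0$ and $\gamma_i=1$ if $c_{l_i}=0$. Number the generators $y_1,\dots,y_n$ of $A_{\widehat n,r}$ consecutively through the blocks. For $M\in\mathcal H_n(G)\text{-mod}^s$ let $I_{\widehat n}M$ be the sum of all simple $\mathbb FG^n$-submodules of $M$ isomorphic to $V(\widehat n)$. Then $\operatorname{Hom}_{\mathbb FG^n}(V(\widehat n),I_{\widehat n}M)$ is an $A_{\widehat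 n,r}$-module by $$(\pi\phi)(v_1\otimes\cdots\otimes v_n)=\pi\,\phi(v_{\pi(1)}\otimes\cdots\otimes v_{\pi(n)}),\qquad (y_i\phi)(v)=\gamma_i^{-1}x_i\phi(v)\qquad(\pi\in S_{\widehat n},\ 1\le i\le n).$$ For an $A_{\widehat n,r}$-module $N$, the space $V(\widehat n)\otimes N$ is an $\mathcal H_{\widehat n}(G)$-module by $$g(v\otimes z)=gv\otimes z,\quad \pi(v_1\otimes\cdots\otimes v_n\otimes z)=v_{\pi^{-1}(1)}\otimes\cdots\otimes v_{\pi^{-1}(n)}\otimes\pi z,\quad x_i(v\otimes z)=\gamma_i\,v\otimes y_iz .$$ **Theorem.** The functor $$\mathcal F:\mathcal H_n(G)\text{-mod}^s\to A_{n,r}\text{-mod},\qquad \mathcal F(M)=\bigoplus_{\widehat n\in\mathcal C_n^r}\operatorname{Hom}_{\mathbb FG^n}(V(\widehat n),I_{\widehat n}M),$$ is an equivalence of categories. For every $U=\bigoplus_{\widehat n}U_{\widehat n}$ in $A_{n,r}\text{-mod}$, where $U_{\widehat n}=e_{\widehat n}U$ and $e_{\widehat n}$ is the identity element of $A_{\widehat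 n,r}$, the module $$\mathcal G(U)=\bigoplus_{\widehat n\in\mathcal C_n^r}\operatorname{ind}_{\mathcal H_{\widehat n}(G)}^{\mathcal H_n(G)}\bigl(V(\widehat n)\otimes U_{\widehat n}\bigr)$$ lies in $\mathcal H_n(G)\text{-mod}^s$, and the functor $\mathcal G:A_{n,r}\text{-mod}\to\mathcal H_n(G)\text{-mod}^s$ is a quasi-inverse of $\mathcal F$: there are natural isomorphisms $\mathcal G\mathcal F\cong\mathrm{id}$ and $\mathcal F\mathcal G\cong\mathrm{id}$. -/

import Mathlib

/-! Notation. `F` is the ground field, `G` a finite group, and the group `G^n` is `Fin n → G`.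
The factors of `G^n` and the variables `x_1, …, x_n` are numbered from `0` to `n - 1`, and the simple
reflection `s_i = (i, i+1)` is `s i j h`, where `h` says that `j` is the successor of `i`. -/

universe u

open scoped TensorProduct
open CategoryTheory

noncomputable section

namespace WreathMorita

/-! ### The degenerate affine Hecke algebra -/

/-- The generators `s_1, …, s_{n-1}`, `y_1, …, y_n`. -/
inductive DegGen (n : ℕ) : Type
  | s (i j : Fin n) (h : i.val + 1 = j.val) : DegGen n
  | y (i : Fin n) : DegGen n

section

variable (F : Type u) [Field F] (a : F) (n : ℕ)

/-- The generator `s_i` in the free algebra. -/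
abbrev degS (i j : Fin n) (h : i.val + 1 = j.val) : FreeAlgebra F (DegGen n) :=
  FreeAlgebra.ι F (DegGen.s i j h)

/-- The generator `y_i` in the free algebra. -/
abbrev degY (i : Fin n) : FreeAlgebra F (DegGen n) := FreeAlgebra.ι F (DegGen.y i)

/-- The defining relations of the degenerate affine Hecke algebra with parameter `a`; the parameter
enters in `s_i y_i = y_{i+1} s_i - a`. -/
inductive DegRel : FreeAlgebra F (DegGen n) → FreeAlgebra F (DegGen n) → Prop
  | yy (i j : Fin n) : DegRel (degY F n i * degY F n j) (degY F n j * degY F n i)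
  | ss (i j : Fin n) (h : i.val + 1 = j.val) : DegRel (degS F n i j h * degS F n i j h) 1
  | comm (i j k l : Fin n) (h : i.val + 1 = j.val) (h' : k.val + 1 = l.val) (hjk : j < k) :
      DegRel (degS F n i j h * degS F n k l h') (degS F n k l h' * degS F n i j h)
  | braid (i j k : Fin n) (h : i.val + 1 = j.val) (h' : j.val + 1 = k.val) :
      DegRel (degS F n i j h * degS F n j k h' * degS F n i j h)
        (degS F n j k h' * degS F n i j h * degS F n j k h')
  | sy (i j : Fin n) (h : i.val + 1 = j.val) :
      DegRel (degS F n i j h * degY F n i)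
        (degY F n j * degS F n i j h - algebraMap F _ a)
  | sy' (i j k : Fin n) (h : i.val + 1 = j.val) (hi : k ≠ i) (hj : k ≠ j) :
      DegRel (degS F n i j h * degY F n k) (degY F n k * degS F n i j h)

/-- The degenerate affine Hecke algebra on `n` strands with parameter `a`: for `a = 1` it is `H_n`,
for `a = 0` it is `⁰H_n = F[y_1, …, y_n] ⋊ F S_n`. -/
def DegHecke : Type u := RingQuot (DegRel F a n)

instance : Ring (DegHecke F a n) := inferInstanceAs (Ring (RingQuot (DegRel F a n)))

instance : Algebra F (DegHecke F a n) := inferInstanceAs (Algebra F (RingQuot (DegRel F a n)))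

end

/-- The image of a generator in the degenerate affine Hecke algebra. -/
def DegHecke.gen {F : Type u} [Field F] {a : F} {n : ℕ} (z : DegGen n) : DegHecke F a n :=
  RingQuot.mkAlgHom F (DegRel F a n) (FreeAlgebra.ι F z)

/-- The generator `s_i`. -/
abbrev DegHecke.s {F : Type u} [Field F] {a : F} {n : ℕ} (i j : Fin n) (h : i.val + 1 = j.val) :
    DegHecke F a n := DegHecke.gen (DegGen.s i j h)

/-- The generator `y_i`. -/
abbrev DegHecke.y {F : Type u} [Field F] {a : F} {n : ℕ} (i : Fin n) :
    DegHecke F a n := DegHecke.gen (DegGen.y i)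

/-- Elements of an algebra that satisfy the defining relations of `DegHecke F a n`. -/
structure DegHecke.Relations {F : Type u} [Field F] (a : F) {n : ℕ} {B : Type u} [Ring B]
    [Algebra F B] (s : ∀ i j : Fin n, i.val + 1 = j.val → B) (y : Fin n → B) : Prop where
  yy : ∀ i j, y i * y j = y j * y i
  ss : ∀ i j h, s i j h * s i j h = 1
  comm : ∀ i j k l h h', j < k → s i j h * s k l h' = s k l h' * s i j h
  braid : ∀ i j k h h', s i j h * s j k h' * s i j h = s j k h' * s i j h * s j k h'
  sy : ∀ i j h, s i j h * y i = y j * s i j h - algebraMap F B a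
  sy' : ∀ i j k h, k ≠ i → k ≠ j → s i j h * y k = y k * s i j h

section

variable {F : Type u} [Field F] {a : F} {n : ℕ} {B : Type u} [Ring B] [Algebra F B]

/-- The algebra homomorphism given by elements that satisfy the relations. -/
def DegHecke.lift (s : ∀ i j : Fin n, i.val + 1 = j.val → B) (y : Fin n → B)
    (H : DegHecke.Relations a s y) : DegHecke F a n →ₐ[F] B :=
  RingQuot.liftAlgHom F ⟨FreeAlgebra.lift F
    (fun z : DegGen n => match z with
      | .s i j h => s i j h
      | .y i => y i), by
    intro p q hpq
    cases hpq with
    | yy i j => simpa using H.yy i j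
    | ss i j h => simpa using H.ss i j h
    | comm i j k l h h' hjk => simpa using H.comm i j k l h h' hjk
    | braid i j k h h' => simpa using H.braid i j k h h'
    | sy i j h => simpa using H.sy i j h
    | sy' i j k h hi hj => simpa using H.sy' i j k h hi hj⟩

theorem DegHecke.lift_s (s : ∀ i j : Fin n, i.val + 1 = j.val → B) (y : Fin n → B)
    (H : DegHecke.Relations a s y) (i j h) : DegHecke.lift s y H (DegHecke.s i j h) = s i j h := by
  unfold DegHecke.lift
  change RingQuot.liftAlgHom F _ (RingQuot.mkAlgHom F (DegRel F a n) _) = _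
  rw [RingQuot.liftAlgHom_mkAlgHom_apply]
  simp

theorem DegHecke.lift_y (s : ∀ i j : Fin n, i.val + 1 = j.val → B) (y : Fin n → B)
    (H : DegHecke.Relations a s y) (i) : DegHecke.lift s y H (DegHecke.y i) = y i := by
  unfold DegHecke.lift
  change RingQuot.liftAlgHom F _ (RingQuot.mkAlgHom F (DegRel F a n) _) = _
  rw [RingQuot.liftAlgHom_mkAlgHom_apply]
  simp

theorem DegHecke.relations :
    DegHecke.Relations (B := DegHecke F a n) a DegHecke.s DegHecke.y where
  yy i j := by simpa using! RingQuot.mkAlgHom_rel F (DegRel.yy (F := F) (a := a) i j)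
  ss i j h := by simpa using! RingQuot.mkAlgHom_rel F (DegRel.ss (F := F) (a := a) i j h)
  comm i j k l h h' hjk := by
    simpa using! RingQuot.mkAlgHom_rel F (DegRel.comm (F := F) (a := a) i j k l h h' hjk)
  braid i j k h h' := by
    simpa using! RingQuot.mkAlgHom_rel F (DegRel.braid (F := F) (a := a) i j k h h')
  sy i j h := by
    have := RingQuot.mkAlgHom_rel F (DegRel.sy (F := F) (a := a) i j h)
    rw [map_sub, map_mul, map_mul, AlgHom.commutes] at this
    exact this
  sy' i j k h hi hj := by
    simpa using! RingQuot.mkAlgHom_rel F (DegRel.sy' (F := F) (a := a) i j k h hi hj)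

theorem DegHecke.induct (S : Subalgebra F (DegHecke F a n)) (hs : ∀ i j h, DegHecke.s i j h ∈ S)
    (hy : ∀ i, DegHecke.y i ∈ S) (z : DegHecke F a n) : z ∈ S := by
  obtain ⟨w, rfl⟩ := RingQuot.mkAlgHom_surjective F (DegRel F a n) z
  have : w ∈ Algebra.adjoin F (Set.range (FreeAlgebra.ι F (X := DegGen n))) := by
    rw [FreeAlgebra.adjoin_range_ι]; trivial
  have key : Algebra.adjoin F (Set.range (FreeAlgebra.ι F (X := DegGen n))) ≤
      S.comap (RingQuot.mkAlgHom F (DegRel F a n)) := by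
    rw [Algebra.adjoin_le_iff]
    rintro _ ⟨g, rfl⟩
    cases g with
    | s i j h => exact hs i j h
    | y i => exact hy i
  exact key this

end

/-! ### The wreath Hecke algebra -/

/-- The generators: the elements of `G^n`, `s_1, …, s_{n-1}`, and `x_1, …, x_n`. -/
inductive WrGen (G : Type u) (n : ℕ) : Type u
  | g (g : Fin n → G) : WrGen G n
  | s (i j : Fin n) (h : i.val + 1 = j.val) : WrGen G n
  | x (i : Fin n) : WrGen G n

section

variable (F : Type u) [Field F] (G : Type u) [Group G] [Fintype G] (n : ℕ)

/-- An element of `G^n` in the free algebra. -/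
abbrev wrG (g : Fin n → G) : FreeAlgebra F (WrGen G n) := FreeAlgebra.ι F (WrGen.g g)

/-- The generator `s_i` in the free algebra. -/
abbrev wrS (i j : Fin n) (h : i.val + 1 = j.val) : FreeAlgebra F (WrGen G n) :=
  FreeAlgebra.ι F (WrGen.s i j h)

/-- The generator `x_i` in the free algebra. -/
abbrev wrX (i : Fin n) : FreeAlgebra F (WrGen G n) := FreeAlgebra.ι F (WrGen.x i)

/-- The element `h^{(i)} (h⁻¹)^{(j)}` of `G^n`. -/
def antiDiag {G : Type u} [Group G] {n : ℕ} (i j : Fin n) (h : G) : Fin n → G :=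
  Pi.mulSingle i h * Pi.mulSingle j h⁻¹

/-- The defining relations of the wreath Hecke algebra: the multiplication table of `G^n`, and
`x_i x_j = x_j x_i`, `x_i g = g x_i`, `s_i² = 1`, `s_i s_j = s_j s_i` for `|i - j| > 1`,
`s_i s_{i+1} s_i = s_{i+1} s_i s_{i+1}`, `s_i x_i = x_{i+1} s_i - t_{i,i+1}` with
`t_{ij} = ∑_h h^{(i)} (h⁻¹)^{(j)}`, `s_i x_k = x_k s_i` for `k ≠ i, i+1`,
`s_i g = (s_i·g) s_i`. -/
inductive WrRel : FreeAlgebra F (WrGen G n) → FreeAlgebra F (WrGen G n) → Prop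
  | one : WrRel (wrG F G n 1) 1
  | mul (g g' : Fin n → G) : WrRel (wrG F G n (g * g')) (wrG F G n g * wrG F G n g')
  | xx (i j : Fin n) : WrRel (wrX F G n i * wrX F G n j) (wrX F G n j * wrX F G n i)
  | xg (i : Fin n) (g : Fin n → G) : WrRel (wrX F G n i * wrG F G n g) (wrG F G n g * wrX F G n i)
  | ss (i j : Fin n) (h : i.val + 1 = j.val) : WrRel (wrS F G n i j h * wrS F G n i j h) 1
  | comm (i j k l : Fin n) (h : i.val + 1 = j.val) (h' : k.val + 1 = l.val) (hjk : j < k) :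
      WrRel (wrS F G n i j h * wrS F G n k l h') (wrS F G n k l h' * wrS F G n i j h)
  | braid (i j k : Fin n) (h : i.val + 1 = j.val) (h' : j.val + 1 = k.val) :
      WrRel (wrS F G n i j h * wrS F G n j k h' * wrS F G n i j h)
        (wrS F G n j k h' * wrS F G n i j h * wrS F G n j k h')
  | sx (i j : Fin n) (h : i.val + 1 = j.val) :
      WrRel (wrS F G n i j h * wrX F G n i)
        (wrX F G n j * wrS F G n i j h - ∑ c : G, wrG F G n (antiDiag i j c))
  | sx' (i j k : Fin n) (h : i.val + 1 = j.val) (hi : k ≠ i) (hj : k ≠ j) :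
      WrRel (wrS F G n i j h * wrX F G n k) (wrX F G n k * wrS F G n i j h)
  | sg (i j : Fin n) (h : i.val + 1 = j.val) (g : Fin n → G) :
      WrRel (wrS F G n i j h * wrG F G n g)
        (wrG F G n (fun k => g (Equiv.swap i j k)) * wrS F G n i j h)

/-- The wreath Hecke algebra `H_n(G)` over `F`. -/
def WrHecke : Type u := RingQuot (WrRel F G n)

instance : Ring (WrHecke F G n) := inferInstanceAs (Ring (RingQuot (WrRel F G n)))

instance : Algebra F (WrHecke F G n) := inferInstanceAs (Algebra F (RingQuot (WrRel F G n)))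

end

section

variable {F : Type u} [Field F] {G : Type u} [Group G] [Fintype G] {n : ℕ}

/-- The image of a generator in the wreath Hecke algebra. -/
def WrHecke.gen (z : WrGen G n) : WrHecke F G n :=
  RingQuot.mkAlgHom F (WrRel F G n) (FreeAlgebra.ι F z)

/-- The canonical homomorphism from `G^n` to the wreath Hecke algebra. -/
def WrHecke.g : (Fin n → G) →* WrHecke F G n where
  toFun g := WrHecke.gen (WrGen.g g)
  map_one' := by simpa using! RingQuot.mkAlgHom_rel F (WrRel.one (F := F) (G := G) (n := n))
  map_mul' g g' := by simpa using! RingQuot.mkAlgHom_rel F (WrRel.mul (F := F) g g')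

/-- The generator `s_i`. -/
abbrev WrHecke.s (i j : Fin n) (h : i.val + 1 = j.val) : WrHecke F G n :=
  WrHecke.gen (WrGen.s i j h)

/-- The generator `x_i`. -/
abbrev WrHecke.x (i : Fin n) : WrHecke F G n := WrHecke.gen (WrGen.x i)

variable {B : Type u} [Ring B] [Algebra F B]

/-- Elements of an algebra that satisfy the defining relations of `WrHecke F G n`. -/
structure WrHecke.Relations (g : (Fin n → G) →* B)
    (s : ∀ i j : Fin n, i.val + 1 = j.val → B) (x : Fin n → B) : Prop where
  xx : ∀ i j, x i * x j = x j * x i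
  xg : ∀ i c, x i * g c = g c * x i
  ss : ∀ i j h, s i j h * s i j h = 1
  comm : ∀ i j k l h h', j < k → s i j h * s k l h' = s k l h' * s i j h
  braid : ∀ i j k h h', s i j h * s j k h' * s i j h = s j k h' * s i j h * s j k h'
  sx : ∀ i j h, s i j h * x i = x j * s i j h - ∑ c : G, g (antiDiag i j c)
  sx' : ∀ i j k h, k ≠ i → k ≠ j → s i j h * x k = x k * s i j h
  sg : ∀ i j h c, s i j h * g c = g (fun k => c (Equiv.swap i j k)) * s i j h

/-- The algebra homomorphism given by elements that satisfy the relations. -/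
def WrHecke.lift (g : (Fin n → G) →* B) (s : ∀ i j : Fin n, i.val + 1 = j.val → B) (x : Fin n → B)
    (H : WrHecke.Relations g s x) : WrHecke F G n →ₐ[F] B :=
  RingQuot.liftAlgHom F ⟨FreeAlgebra.lift F
    (fun z : WrGen G n => match z with
      | .g c => g c
      | .s i j h => s i j h
      | .x i => x i), by
    intro p q hpq
    cases hpq with
    | one => simp
    | mul c c' => simp
    | xx i j => simpa using H.xx i j
    | xg i c => simpa using H.xg i c
    | ss i j h => simpa using H.ss i j h
    | comm i j k l h h' hjk => simpa using H.comm i j k l h h' hjk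
    | braid i j k h h' => simpa using H.braid i j k h h'
    | sx i j h => simpa using H.sx i j h
    | sx' i j k h hi hj => simpa using H.sx' i j k h hi hj
    | sg i j h c => simpa using H.sg i j h c⟩

theorem WrHecke.lift_g (g : (Fin n → G) →* B) (s : ∀ i j : Fin n, i.val + 1 = j.val → B)
    (x : Fin n → B) (H : WrHecke.Relations g s x) (c) :
    (WrHecke.lift (F := F) g s x H) (WrHecke.g c) = g c := by
  unfold WrHecke.lift
  change RingQuot.liftAlgHom F _ (RingQuot.mkAlgHom F (WrRel F G n) _) = _
  rw [RingQuot.liftAlgHom_mkAlgHom_apply]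
  simp

theorem WrHecke.lift_s (g : (Fin n → G) →* B) (s : ∀ i j : Fin n, i.val + 1 = j.val → B)
    (x : Fin n → B) (H : WrHecke.Relations g s x) (i j h) :
    (WrHecke.lift (F := F) g s x H) (WrHecke.s i j h) = s i j h := by
  unfold WrHecke.lift
  change RingQuot.liftAlgHom F _ (RingQuot.mkAlgHom F (WrRel F G n) _) = _
  rw [RingQuot.liftAlgHom_mkAlgHom_apply]
  simp

theorem WrHecke.lift_x (g : (Fin n → G) →* B) (s : ∀ i j : Fin n, i.val + 1 = j.val → B)
    (x : Fin n → B) (H : WrHecke.Relations g s x) (i) :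
    (WrHecke.lift (F := F) g s x H) (WrHecke.x i) = x i := by
  unfold WrHecke.lift
  change RingQuot.liftAlgHom F _ (RingQuot.mkAlgHom F (WrRel F G n) _) = _
  rw [RingQuot.liftAlgHom_mkAlgHom_apply]
  simp

theorem WrHecke.relations :
    WrHecke.Relations (B := WrHecke F G n) WrHecke.g WrHecke.s WrHecke.x where
  xx i j := by simpa using! RingQuot.mkAlgHom_rel F (WrRel.xx (F := F) (G := G) i j)
  xg i c := by simpa using! RingQuot.mkAlgHom_rel F (WrRel.xg (F := F) (G := G) i c)
  ss i j h := by simpa using! RingQuot.mkAlgHom_rel F (WrRel.ss (F := F) (G := G) i j h)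
  comm i j k l h h' hjk := by
    simpa using! RingQuot.mkAlgHom_rel F (WrRel.comm (F := F) (G := G) i j k l h h' hjk)
  braid i j k h h' := by
    simpa using! RingQuot.mkAlgHom_rel F (WrRel.braid (F := F) (G := G) i j k h h')
  sx i j h := by
    have := RingQuot.mkAlgHom_rel F (WrRel.sx (F := F) (G := G) i j h)
    rw [map_sub, map_mul, map_mul, map_sum] at this
    exact this
  sx' i j k h hi hj := by
    simpa using! RingQuot.mkAlgHom_rel F (WrRel.sx' (F := F) (G := G) i j k h hi hj)
  sg i j h c := by simpa using! RingQuot.mkAlgHom_rel F (WrRel.sg (F := F) (G := G) i j h c)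

theorem WrHecke.induct (S : Subalgebra F (WrHecke F G n)) (hg : ∀ c, WrHecke.g c ∈ S)
    (hs : ∀ i j h, WrHecke.s i j h ∈ S) (hx : ∀ i, WrHecke.x i ∈ S) (z : WrHecke F G n) :
    z ∈ S := by
  obtain ⟨w, rfl⟩ := RingQuot.mkAlgHom_surjective F (WrRel F G n) z
  have : w ∈ Algebra.adjoin F (Set.range (FreeAlgebra.ι F (X := WrGen G n))) := by
    rw [FreeAlgebra.adjoin_range_ι]; trivial
  have key : Algebra.adjoin F (Set.range (FreeAlgebra.ι F (X := WrGen G n))) ≤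
      S.comap (RingQuot.mkAlgHom F (WrRel F G n)) := by
    rw [Algebra.adjoin_le_iff]
    rintro _ ⟨c, rfl⟩
    cases c with
    | g c => exact hg c
    | s i j h => exact hs i j h
    | x i => exact hx i
  exact key this

end

/-! ### Tensor products of algebras -/

section

variable {F : Type u} [Field F] {r : ℕ} {A : Fin r → Type u} [∀ k, Ring (A k)]
  [∀ k, Algebra F (A k)] {B : Type u} [Ring B] [Algebra F B]

theorem tensor_induct (S : Subalgebra F (⨂[F] k, A k))
    (h : ∀ k a, PiTensorProduct.singleAlgHom (R := F) (A := A) k a ∈ S) (z : ⨂[F] k, A k) :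
    z ∈ S := by
  have key : ∀ x : Π k, A k, PiTensorProduct.tprod F x ∈ S := by
    intro x
    have : x ∈ S.toSubmonoid.comap (PiTensorProduct.tprodMonoidHom F (A := A)) :=
      Submonoid.pi_mem_of_mulSingle_mem x (fun i => h i (x i))
    exact this
  induction z using PiTensorProduct.induction_on with
  | smul_tprod c x => exact S.smul_mem (key x) c
  | add x y hx hy => exact S.add_mem hx hy

/-- For pairwise commuting homomorphisms `f_k : A_k → B`, the map
`(a_1, …, a_r) ↦ f_1(a_1) ⋯ f_r(a_r)`. -/
def prodHom (f : ∀ k, A k →ₐ[F] B)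
    (hf : Pairwise fun k l => ∀ (a : A k) (b : A l), Commute (f k a) (f l b)) :
    (Π k, A k) →* B :=
  MonoidHom.noncommPiCoprod (fun k => ((f k : A k →+* B) : A k →* B)) fun _ _ h a b => hf h a b

theorem prodHom_update (f : ∀ k, A k →ₐ[F] B)
    (hf : Pairwise fun k l => ∀ (a : A k) (b : A l), Commute (f k a) (f l b))
    (inst : DecidableEq (Fin r)) (x : Π k, A k) (i : Fin r) (c : A i) :
    prodHom f hf (Function.update x i c) = f i c * prodHom f hf (Function.update x i 1) := by
  have h : Function.update x i c = Pi.mulSingle i c * Function.update x i 1 := by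
    ext k
    by_cases hk : k = i
    · subst hk; simp
    · simp [hk]
  have h' : prodHom f hf (Pi.mulSingle i c) = f i c := MonoidHom.noncommPiCoprod_mulSingle _ i c
  rw [h, map_mul, h']

/-- Pairwise commuting algebra homomorphisms `f_k : A_k → B` give `⨂ A_k → B`,
`a_1 ⊗ ⋯ ⊗ a_r ↦ f_1(a_1) ⋯ f_r(a_r)`. -/
def tensorLift (f : ∀ k, A k →ₐ[F] B)
    (hf : Pairwise fun k l => ∀ (a : A k) (b : A l), Commute (f k a) (f l b)) :
    (⨂[F] k, A k) →ₐ[F] B :=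
  PiTensorProduct.liftAlgHom
    { toFun := prodHom f hf
      map_update_add' := by
        intro inst x i a b
        rw [prodHom_update, prodHom_update f hf inst x i a, prodHom_update f hf inst x i b,
          map_add, add_mul]
      map_update_smul' := by
        intro inst x i c a
        rw [prodHom_update, prodHom_update f hf inst x i a, map_smul, smul_mul_assoc] }
    (map_one (prodHom f hf)) (map_mul (prodHom f hf))

theorem tensorLift_single (f : ∀ k, A k →ₐ[F] B)
    (hf : Pairwise fun k l => ∀ (a : A k) (b : A l), Commute (f k a) (f l b)) (k : Fin r)
    (a : A k) : tensorLift f hf (PiTensorProduct.singleAlgHom (R := F) (A := A) k a) = f k a := by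
  have h' : prodHom f hf (Pi.mulSingle k a) = f k a := MonoidHom.noncommPiCoprod_mulSingle _ k a
  simpa [tensorLift] using h'

/-- The elements of `A` whose actions are intertwined by the linear map `T`. -/
def intertwined {A : Type u} [Ring A] [Algebra F A] {X Y : Type u} [AddCommGroup X] [Module F X]
    [AddCommGroup Y] [Module F Y] (f : A →ₐ[F] Module.End F X) (g : A →ₐ[F] Module.End F Y)
    (T : X →ₗ[F] Y) : Subalgebra F A where
  carrier := {a | ∀ v, T (f a v) = g a (T v)}
  mul_mem' {a b} ha hb v := by
    simp only [Set.mem_ofPred_eq] at ha hb ⊢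
    rw [map_mul, map_mul, Module.End.mul_apply, Module.End.mul_apply, ha, hb]
  add_mem' {a b} ha hb v := by
    simp only [Set.mem_ofPred_eq] at ha hb ⊢
    rw [map_add, map_add, LinearMap.add_apply, LinearMap.add_apply, map_add, ha, hb]
  algebraMap_mem' c v := by simp [Module.algebraMap_end_apply]

/-- The elements of `A` whose image commutes with `b`. -/
def commuting {A : Type u} [Ring A] [Algebra F A] (f : A →ₐ[F] B) (b : B) : Subalgebra F A :=
  (Subalgebra.centralizer F {b}).comap f

theorem mem_commuting {A : Type u} [Ring A] [Algebra F A] (f : A →ₐ[F] B) (b : B) (a : A) :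
    a ∈ commuting f b ↔ Commute (f a) b := by
  simp only [commuting, Subalgebra.mem_comap, Subalgebra.mem_centralizer_iff, Set.mem_singleton_iff,
    forall_eq]
  exact ⟨fun h => h.symm, fun h => h.symm⟩

/-- Commutation of two homomorphisms out of degenerate affine Hecke algebras can be tested on
generators. -/
theorem deg_commute_of_generators {a b : F} {k l : ℕ}
    (f : DegHecke F a k →ₐ[F] B) (f' : DegHecke F b l →ₐ[F] B)
    (ss : ∀ i j h i' j' h', Commute (f (DegHecke.s i j h)) (f' (DegHecke.s i' j' h')))
    (sy : ∀ i j h i', Commute (f (DegHecke.s i j h)) (f' (DegHecke.y i')))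
    (ys : ∀ i i' j' h', Commute (f (DegHecke.y i)) (f' (DegHecke.s i' j' h')))
    (yy : ∀ i i', Commute (f (DegHecke.y i)) (f' (DegHecke.y i'))) (p q) :
    Commute (f p) (f' q) := by
  have key : ∀ b', (∀ i j h, Commute (f (DegHecke.s i j h)) b') →
      (∀ i, Commute (f (DegHecke.y i)) b') → ∀ p, Commute (f p) b' := by
    intro b' h1 h2 p
    rw [← mem_commuting]
    refine DegHecke.induct _ ?_ ?_ p <;> intros <;> rw [mem_commuting] <;> apply_assumption
  have key' : ∀ b', (∀ i j h, Commute (f' (DegHecke.s i j h)) b') →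
      (∀ i, Commute (f' (DegHecke.y i)) b') → ∀ p, Commute (f' p) b' := by
    intro b' h1 h2 p
    rw [← mem_commuting]
    refine DegHecke.induct _ ?_ ?_ p <;> intros <;> rw [mem_commuting] <;> apply_assumption
  refine (key' _ ?_ ?_ q).symm
  · intro i j h
    exact (key _ (fun i' j' h' => ss i' j' h' i j h) (fun i' => ys i' i j h) p).symm
  · intro i
    exact (key _ (fun i' j' h' => sy i' j' h' i) (fun i' => yy i' i) p).symm

end
/-! ### Isotypical subspaces and homomorphisms out of a simple representation -/

section

variable {F : Type u} [Field F] {H : Type u} [Group H] {V M N : Type u} [AddCommGroup V]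
  [Module F V] [AddCommGroup M] [Module F M] [AddCommGroup N] [Module F N]

/-- The isotypical subspace of `σ` in `ρ`: the sum of all simple subrepresentations of `ρ` that are
isomorphic to `σ`. -/
def isotypical (σ : Representation F H V) (ρ : Representation F H M) : Subrepresentation ρ where
  toSubmodule := ⨆ W : {W : Subrepresentation ρ // W.toRepresentation.IsIrreducible ∧
    Nonempty (W.toRepresentation.Equiv σ)}, W.1.toSubmodule
  apply_mem_toSubmodule g := by
    intro v hv
    induction hv using Submodule.iSup_induction' with
    | mem W v hv => exact Submodule.mem_iSup_of_mem W (W.1.apply_mem_toSubmodule g hv)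
    | zero => rw [map_zero]; exact Submodule.zero_mem _
    | add x y _ _ hx hy => rw [map_add]; exact Submodule.add_mem _ hx hy

theorem irreducible_of_equiv {σ : Representation F H V} {ρ : Representation F H M}
    (e : σ.Equiv ρ) (h : ρ.IsIrreducible) : σ.IsIrreducible := by
  rw [Representation.irreducible_iff_isSimpleModule_asModule] at h ⊢
  have hb : Function.Bijective
      (Representation.IntertwiningMap.equivLinearMapAsModule σ ρ e.toIntertwiningMap) :=
    e.toLinearEquiv.bijective
  exact IsSimpleModule.congr (LinearEquiv.ofBijective _ hb)

theorem range_le_isotypical {σ : Representation F H V} {ρ : Representation F H M}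
    (hσ : σ.IsIrreducible) (f : V →ₗ[F] M) (hf : ∀ g v, f (σ g v) = ρ g (f v)) (v : V) :
    f v ∈ (isotypical σ ρ).toSubmodule := by
  let φ : σ.IntertwiningMap ρ := f.intertwiningMap_of_isIntertwiningMap σ ρ hf
  rcases Representation.IsIrreducible.injective_or_eq_zero φ with h | h
  · let W : Subrepresentation ρ := φ.range
    let e : σ.Equiv W.toRepresentation := Representation.Equiv.mk
      (LinearEquiv.ofInjective f h) (by
        intro g
        ext v
        exact hf g v)
    refine Submodule.mem_iSup_of_mem
      (⟨W, irreducible_of_equiv e.symm hσ, ⟨e.symm⟩⟩ :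
        {W : Subrepresentation ρ // W.toRepresentation.IsIrreducible ∧
          Nonempty (W.toRepresentation.Equiv σ)}) ⟨v, rfl⟩
  · have : f v = 0 := congrArg (fun ψ : σ.IntertwiningMap ρ => ψ v) h
    rw [this]
    exact Submodule.zero_mem _

theorem isotypical_mapsTo {σ : Representation F H V} {ρ : Representation F H M}
    {τ : Representation F H N} (T : M →ₗ[F] N) (P : V →ₗ[F] V) (hP : Function.Surjective P)
    (hTP : ∀ c, ∃ d, (∀ v, P (σ c v) = σ d (P v)) ∧ ∀ m, T (ρ d m) = τ c (T m)) (m : M)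
    (hm : m ∈ (isotypical σ ρ).toSubmodule) : T m ∈ (isotypical σ τ).toSubmodule := by
  change m ∈ (⨆ W : {W : Subrepresentation ρ // W.toRepresentation.IsIrreducible ∧
    Nonempty (W.toRepresentation.Equiv σ)}, W.1.toSubmodule) at hm
  induction hm using Submodule.iSup_induction' with
  | mem W m hm =>
    obtain ⟨W, hW, ⟨e⟩⟩ := W
    obtain ⟨v, hv⟩ := hP (e ⟨m, hm⟩)
    let f : V →ₗ[F] N :=
      T ∘ₗ W.toSubmodule.subtype ∘ₗ e.symm.toIntertwiningMap.toLinearMap ∘ₗ P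
    have hf : ∀ c v, f (σ c v) = τ c (f v) := by
      intro c v
      obtain ⟨d, h1, h2⟩ := hTP c
      change T (W.toSubmodule.subtype (e.symm.toIntertwiningMap (P (σ c v)))) = _
      rw [h1, Representation.IntertwiningMap.isIntertwining]
      exact h2 _
    have hfv : f v = T m := by
      change T (W.toSubmodule.subtype (e.symm (P v))) = _
      rw [hv, Representation.Equiv.symm_apply_apply]
      rfl
    rw [← hfv]
    exact range_le_isotypical (irreducible_of_equiv e.symm hW) f hf v
  | zero => rw [map_zero]; exact Submodule.zero_mem _
  | add x y _ _ hx hy => rw [map_add]; exact Submodule.add_mem _ hx hy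

/-- `Hom_H(V, I)`, where `I` is the isotypical subspace of `V` in `M`. -/
def HomIso (σ : Representation F H V) (ρ : Representation F H M) : Type u :=
  σ.IntertwiningMap (isotypical σ ρ).toRepresentation

instance (σ : Representation F H V) (ρ : Representation F H M) : AddCommGroup (HomIso σ ρ) :=
  inferInstanceAs (AddCommGroup (σ.IntertwiningMap (isotypical σ ρ).toRepresentation))

instance (σ : Representation F H V) (ρ : Representation F H M) : Module F (HomIso σ ρ) :=
  inferInstanceAs (Module F (σ.IntertwiningMap (isotypical σ ρ).toRepresentation))

instance (σ : Representation F H V) (ρ : Representation F H M) :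
    FunLike (HomIso σ ρ) V (isotypical σ ρ).toSubmodule :=
  inferInstanceAs (FunLike (σ.IntertwiningMap (isotypical σ ρ).toRepresentation) V
    (isotypical σ ρ).toSubmodule)

instance (σ : Representation F H V) (ρ : Representation F H M) :
    LinearMapClass (HomIso σ ρ) F V (isotypical σ ρ).toSubmodule :=
  inferInstanceAs (LinearMapClass (σ.IntertwiningMap (isotypical σ ρ).toRepresentation) F V
    (isotypical σ ρ).toSubmodule)

theorem homIso_equivariant {σ : Representation F H V} {ρ : Representation F H M} (φ : HomIso σ ρ)
    (g : H) (v : V) : (φ (σ g v) : M) = ρ g (φ v) :=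
  congrArg Subtype.val (Representation.IntertwiningMap.isIntertwining σ
    (isotypical σ ρ).toRepresentation φ g v)

theorem homIso_ext {σ : Representation F H V} {ρ : Representation F H M} {φ ψ : HomIso σ ρ}
    (h : ∀ v, (φ v : M) = ψ v) : φ = ψ :=
  DFunLike.ext _ _ fun v => Subtype.ext (h v)

/-- The linear map `φ ↦ T ∘ φ ∘ P` on `Hom_H(V, I)`. -/
def homOp {σ : Representation F H V} {ρ : Representation F H M} {τ : Representation F H N}
    (T : M →ₗ[F] N) (P : V →ₗ[F] V) (hP : Function.Surjective P)
    (hTP : ∀ c, ∃ d, (∀ v, P (σ c v) = σ d (P v)) ∧ ∀ m, T (ρ d m) = τ c (T m)) :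
    HomIso σ ρ →ₗ[F] HomIso σ τ where
  toFun φ := LinearMap.intertwiningMap_of_isIntertwiningMap σ (isotypical σ τ).toRepresentation
    (T.restrict (isotypical_mapsTo T P hP hTP) ∘ₗ
      Representation.IntertwiningMap.toLinearMap φ ∘ₗ P) (by
      intro c v
      obtain ⟨d, h1, h2⟩ := hTP c
      apply Subtype.ext
      change T (φ (P (σ c v)) : M) = τ c (T (φ (P v) : M))
      rw [h1, homIso_equivariant]
      exact h2 _)
  map_add' φ ψ := by
    apply homIso_ext
    intro v
    exact map_add T _ _
  map_smul' c φ := by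
    apply homIso_ext
    intro v
    exact map_smul T _ _

end

/-! ### Simple modules of the finite group and the scalars `c_k` -/

/-- A complete set `V_1, …, V_r` of pairwise non-isomorphic finite-dimensional simple
`FG`-modules. -/
structure SimpleSystem (F : Type u) [Field F] (G : Type u) [Group G] (r : ℕ) where
  V : Fin r → Type u
  [addCommGroup : ∀ k, AddCommGroup (V k)]
  [module : ∀ k, Module F (V k)]
  [finite : ∀ k, FiniteDimensional F (V k)]
  ρ : ∀ k, Representation F G (V k)
  irreducible : ∀ k, (ρ k).IsIrreducible
  eq_of_equiv : ∀ k l, Nonempty ((ρ k).Equiv (ρ l)) → k = l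
  complete : ∀ (W : Type u) [AddCommGroup W] [Module F W] [FiniteDimensional F W]
    (σ : Representation F G W), σ.IsIrreducible → ∃ k, Nonempty (σ.Equiv (ρ k))

attribute [instance] SimpleSystem.addCommGroup SimpleSystem.module SimpleSystem.finite

section

variable {F : Type u} [Field F] {G : Type u} [Group G] [Fintype G] {V : Type u}
  [AddCommGroup V] [Module F V]

theorem exists_averaging_scalar [IsAlgClosed F] [FiniteDimensional F V]
    (ρ : Representation F G V) [ρ.IsIrreducible] (φ : Module.Dual F V) (v : V) :
    ∃ c : F, ∀ w, ∑ h : G, φ (ρ h⁻¹ w) • ρ h v = c • w := by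
  let T : V →ₗ[F] V := ∑ h : G, (φ ∘ₗ ρ h⁻¹).smulRight (ρ h v)
  have hT : ∀ w, T w = ∑ h : G, φ (ρ h⁻¹ w) • ρ h v := by intro w; simp [T]
  have hc : ∀ g w, T (ρ g w) = ρ g (T w) := by
    intro g w
    rw [hT, hT, map_sum, ← Equiv.sum_comp (Equiv.mulLeft g)]
    refine Finset.sum_congr rfl fun h _ => ?_
    simp [mul_inv_rev, ← Module.End.mul_apply, mul_assoc, ← map_mul]
  let Φ : ρ.IntertwiningMap ρ := T.intertwiningMap_of_isIntertwiningMap ρ ρ hc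
  obtain ⟨c, hcΦ⟩ := (Representation.IsIrreducible.algebraMap_intertwiningMap_bijective_of_isAlgClosed
    (ρ := ρ)).2 Φ
  refine ⟨c, fun w => ?_⟩
  rw [← hT]
  have := congrArg (fun ψ : ρ.IntertwiningMap ρ => ψ w) hcΦ
  exact this.symm

/-- The element `t_{12}` acts on `V ⊗ V` as a unique multiple of the flip. -/
theorem existsUnique_flip_scalar [IsAlgClosed F] [FiniteDimensional F V]
    (ρ : Representation F G V) (hρ : ρ.IsIrreducible) :
    ∃! c : F, ∀ v w : V, ∑ h : G, ρ h v ⊗ₜ[F] ρ h⁻¹ w = c • (w ⊗ₜ[F] v) := by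
  choose L hL using fun (φ : Module.Dual F V) v => exists_averaging_scalar ρ φ v
  have hnt : Nontrivial V := by
    rw [← not_subsingleton_iff_nontrivial]
    intro hs
    apply bot_ne_top (α := Subrepresentation ρ)
    apply Subrepresentation.toSubmodule_injective
    exact Subsingleton.elim _ _
  obtain ⟨w₀, hw₀⟩ := exists_ne (0 : V)
  obtain ⟨φ₀, hφ₀⟩ : ∃ φ : Module.Dual F V, φ w₀ = 1 := by
    obtain ⟨φ, hφ⟩ := Module.Projective.exists_dual_ne_zero F hw₀
    exact ⟨(φ w₀)⁻¹ • φ, by simp [inv_mul_cancel₀ hφ]⟩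
  have hsymm : ∀ (φ ψ : Module.Dual F V) (v w : V), L ψ v * φ w = L φ w * ψ v := by
    intro φ ψ v w
    have h1 := congrArg φ (hL ψ v w)
    have h2 := congrArg ψ (hL φ w v)
    rw [map_sum, map_smul] at h1 h2
    simp only [map_smul, smul_eq_mul] at h1 h2
    rw [← h1, ← h2, ← Equiv.sum_comp (Equiv.inv G)]
    refine Finset.sum_congr rfl fun h _ => ?_
    simp [mul_comm]
  have hLc : ∀ (ψ : Module.Dual F V) (v : V), L ψ v = L φ₀ w₀ * ψ v := by
    intro ψ v
    have := hsymm φ₀ ψ v w₀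
    rwa [hφ₀, mul_one] at this
  refine ⟨L φ₀ w₀, fun v w => ?_, fun c hc => ?_⟩
  · let b := Module.finBasis F V
    apply (b.tensorProduct b).ext_elem
    rintro ⟨i, j⟩
    have h1 := congrArg (b.coord i) (hL (b.coord j) v w)
    rw [map_sum, hLc] at h1
    simp only [map_smul, smul_eq_mul, Module.Basis.coord_apply] at h1
    simp only [map_sum, map_smul, Finsupp.coe_finsetSum, Finset.sum_apply, Finsupp.smul_apply,
      Module.Basis.tensorProduct_repr_tmul_apply, smul_eq_mul]
    rw [show L φ₀ w₀ * (b.repr v j * b.repr w i) = L φ₀ w₀ * (b.repr v) j * (b.repr w) i by ring,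
      ← h1]
  · have h1 := congrArg (TensorProduct.lift ((LinearMap.mul F F).compl₁₂ φ₀ φ₀)) (hc w₀ w₀)
    have h2 := congrArg φ₀ (hL φ₀ w₀ w₀)
    simp only [map_sum, map_smul, TensorProduct.lift.tmul, LinearMap.compl₁₂_apply,
      LinearMap.mul_apply', hφ₀, smul_eq_mul, mul_one] at h1 h2
    rw [← h1, ← h2]
    exact Finset.sum_congr rfl fun h _ => mul_comm _ _

end

namespace SimpleSystem

variable {F : Type u} [Field F] [IsAlgClosed F] {G : Type u} [Group G] [Fintype G] {r : ℕ}
  (S : SimpleSystem F G r)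

/-- The scalar `c_k`: the element `t_{12} = ∑_h (h, h⁻¹)` acts on `V_k ⊗ V_k` as `c_k` times the
flip of the two factors. -/
def c (k : Fin r) : F := (existsUnique_flip_scalar (S.ρ k) (S.irreducible k)).exists.choose

theorem c_spec (k : Fin r) (v w : S.V k) :
    ∑ h : G, S.ρ k h v ⊗ₜ[F] S.ρ k h⁻¹ w = S.c k • (w ⊗ₜ[F] v) :=
  (existsUnique_flip_scalar (S.ρ k) (S.irreducible k)).exists.choose_spec v w

end SimpleSystem
/-! ### Compositions and Young subgroups -/

/-- The `r`-tuple compositions `(n_1, …, n_r)` of `n`, with zero parts allowed. -/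
@[ext]
structure Comp (r n : ℕ) where
  part : Fin r → ℕ
  sum_part : ∑ k, part k = n

namespace Comp

variable {r n : ℕ} (m : Comp r n)

theorem part_le (k : Fin r) : m.part k ≤ n := by
  have := Finset.single_le_sum (f := m.part) (fun _ _ => Nat.zero_le _) (Finset.mem_univ k)
  rwa [m.sum_part] at this

instance : Finite (Comp r n) :=
  Finite.of_injective
    (fun (m : Comp r n) k => (⟨m.part k, Nat.lt_succ_of_le (m.part_le k)⟩ : Fin (n + 1)))
    (fun _ _ h => Comp.ext (funext fun k => congrArg Fin.val (congrFun h k)))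

instance : DecidableEq (Comp r n) := Classical.decEq _

/-- The positions of the composition: `(k, j)` is the `j`-th position of the `k`-th block. -/
abbrev Pos : Type := Σ k, Fin (m.part k)

/-- The position of the `j`-th element of the `k`-th block in `{0, …, n-1}`, namely
`n_1 + ⋯ + n_{k-1} + j`. -/
def pos : m.Pos ≃ Fin n := finSigmaFinEquiv.trans (finCongr m.sum_part)

theorem pos_val (k : Fin r) (j : Fin (m.part k)) :
    (m.pos ⟨k, j⟩).val = ∑ i : Fin k.val, m.part (Fin.castLE k.isLt.le i) + j.val := by
  simp [pos, finSigmaFinEquiv_apply]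

theorem pos_succ {k : Fin r} {i j : Fin (m.part k)} (h : i.val + 1 = j.val) :
    (m.pos ⟨k, i⟩).val + 1 = (m.pos ⟨k, j⟩).val := by
  rw [pos_val, pos_val]; omega

theorem pos_lt {k : Fin r} {i j : Fin (m.part k)} (h : i < j) : m.pos ⟨k, i⟩ < m.pos ⟨k, j⟩ := by
  rw [Fin.lt_def, pos_val, pos_val]; have := Fin.lt_def.mp h; omega

theorem pos_injective (k : Fin r) : Function.Injective fun j : Fin (m.part k) => m.pos ⟨k, j⟩ := by
  intro i j h
  have := m.pos.injective h
  simpa using this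

theorem pos_swap {k : Fin r} (i j l : Fin (m.part k)) :
    Equiv.swap (m.pos ⟨k, i⟩) (m.pos ⟨k, j⟩) (m.pos ⟨k, l⟩) = m.pos ⟨k, Equiv.swap i j l⟩ :=
  (m.pos_injective k).swap_apply i j l

theorem pos_ne {k l : Fin r} (h : k ≠ l) (i : Fin (m.part k)) (j : Fin (m.part l)) :
    m.pos ⟨k, i⟩ ≠ m.pos ⟨l, j⟩ := by
  intro h'
  have := m.pos.injective h'
  exact h (congrArg Sigma.fst this)

/-- Simple reflections from different blocks are far apart. -/
theorem far {k l : Fin r} (h : k ≠ l) {i j : Fin (m.part k)} (hij : i.val + 1 = j.val)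
    {i' j' : Fin (m.part l)} (hij' : i'.val + 1 = j'.val) :
    m.pos ⟨k, j⟩ < m.pos ⟨l, i'⟩ ∨ m.pos ⟨l, j'⟩ < m.pos ⟨k, i⟩ := by
  have h1 := m.pos_ne h j i'
  have h2 := m.pos_ne h i i'
  have h3 := m.pos_ne h i j'
  have h4 := m.pos_ne h j j'
  have h5 := m.pos_succ hij
  have h6 := m.pos_succ hij'
  simp only [Fin.lt_def, ne_eq, Fin.ext_iff] at *
  omega

variable {G : Type u} [Group G]

/-- The inclusion of the `k`-th block `G^{n_k}` in `G^n`. -/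
def incl (k : Fin r) : (Fin (m.part k) → G) →* (Fin n → G) :=
  Function.ExtendByOne.hom G fun j => m.pos ⟨k, j⟩

theorem incl_same (k : Fin r) (g : Fin (m.part k) → G) (j : Fin (m.part k)) :
    m.incl k g (m.pos ⟨k, j⟩) = g j := by
  simpa [incl] using (m.pos_injective k).extend_apply g 1 j

theorem incl_other {k l : Fin r} (h : k ≠ l) (g : Fin (m.part k) → G) (j : Fin (m.part l)) :
    m.incl k g (m.pos ⟨l, j⟩) = 1 := by
  have : ¬ ∃ i, (fun j : Fin (m.part k) => m.pos ⟨k, j⟩) i = m.pos ⟨l, j⟩ := by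
    rintro ⟨i, hi⟩
    exact m.pos_ne h i j hi
  simpa [incl] using Function.extend_apply' g (1 : Fin n → G) _ this

theorem fn_ext {X : Type u} {f f' : Fin n → X} (h : ∀ k j, f (m.pos ⟨k, j⟩) = f' (m.pos ⟨k, j⟩)) :
    f = f' := by
  funext i
  obtain ⟨⟨k, j⟩, rfl⟩ := m.pos.surjective i
  exact h k j

theorem incl_swap (k : Fin r) (i j : Fin (m.part k)) (g : Fin (m.part k) → G) :
    m.incl k (fun l => g (Equiv.swap i j l)) =
      fun l => m.incl k g (Equiv.swap (m.pos ⟨k, i⟩) (m.pos ⟨k, j⟩) l) := by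
  apply m.fn_ext
  intro l a
  by_cases h : k = l
  · subst h
    rw [incl_same, m.pos_swap, incl_same]
  · rw [incl_other _ h, Equiv.swap_apply_of_ne_of_ne (m.pos_ne (Ne.symm h) _ _)
      (m.pos_ne (Ne.symm h) _ _), incl_other _ h]

theorem incl_swap_other {k l : Fin r} (hkl : k ≠ l) (i j : Fin (m.part k))
    (c : Fin (m.part l) → G) :
    (fun a => m.incl l c (Equiv.swap (m.pos ⟨k, i⟩) (m.pos ⟨k, j⟩) a)) = m.incl l c := by
  apply m.fn_ext
  intro a b
  by_cases ha : l = a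
  · subst ha
    rw [Equiv.swap_apply_of_ne_of_ne (m.pos_ne (Ne.symm hkl) _ _) (m.pos_ne (Ne.symm hkl) _ _)]
  · rw [m.incl_other ha]
    by_cases hb : k = a
    · subst hb
      rw [m.pos_swap, m.incl_other ha]
    · rw [Equiv.swap_apply_of_ne_of_ne (m.pos_ne (Ne.symm hb) _ _) (m.pos_ne (Ne.symm hb) _ _),
        m.incl_other ha]

theorem incl_mulSingle (k : Fin r) (i : Fin (m.part k)) (h : G) :
    m.incl k (Pi.mulSingle i h) = Pi.mulSingle (m.pos ⟨k, i⟩) h := by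
  apply m.fn_ext
  intro l a
  by_cases hk : k = l
  · subst hk
    rw [incl_same]
    by_cases hi : a = i
    · subst hi; simp
    · rw [Pi.mulSingle_eq_of_ne hi, Pi.mulSingle_eq_of_ne fun h' => hi (m.pos_injective k h')]
  · rw [incl_other _ hk, Pi.mulSingle_eq_of_ne (m.pos_ne (Ne.symm hk) _ _)]

theorem incl_antiDiag (k : Fin r) (i j : Fin (m.part k)) (h : G) :
    m.incl k (antiDiag i j h) = antiDiag (m.pos ⟨k, i⟩) (m.pos ⟨k, j⟩) h := by
  rw [antiDiag, map_mul, incl_mulSingle, incl_mulSingle]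
  rfl

theorem incl_commute {k l : Fin r} (hkl : k ≠ l) (g : Fin (m.part k) → G) (g' : Fin (m.part l) → G) :
    Commute (m.incl k g) (m.incl l g') := by
  apply m.fn_ext
  intro a j
  simp only [Pi.mul_apply]
  by_cases h : k = a
  · subst h; rw [m.incl_other (Ne.symm hkl), mul_one, one_mul]
  · rw [m.incl_other h, mul_one, one_mul]

end Comp

/-! ### Parabolic subalgebras -/

section

variable (F : Type u) [Field F] (G : Type u) [Group G] [Fintype G] {r n : ℕ}

/-- The algebra `H_{n_1}(G) ⊗ ⋯ ⊗ H_{n_r}(G)`, which is identified with the subalgebra of `H_n(G)`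
generated by `G^n`, `x_1, …, x_n` and the Young subgroup `S_{n_1} × ⋯ × S_{n_r}`. -/
abbrev ParHecke (m : Comp r n) : Type u := ⨂[F] k, WrHecke F G (m.part k)

variable {F G}

theorem blockHom_relations (m : Comp r n) (k : Fin r) :
    WrHecke.Relations (B := WrHecke F G n) (WrHecke.g.comp (m.incl k))
      (fun i j h => WrHecke.s (m.pos ⟨k, i⟩) (m.pos ⟨k, j⟩) (m.pos_succ h))
      (fun i => WrHecke.x (m.pos ⟨k, i⟩)) where
  xx i j := WrHecke.relations.xx _ _
  xg i c := WrHecke.relations.xg _ _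
  ss i j h := WrHecke.relations.ss _ _ _
  comm i j k l h h' hjk := WrHecke.relations.comm _ _ _ _ _ _ (m.pos_lt hjk)
  braid i j k h h' := WrHecke.relations.braid _ _ _ _ _
  sx i j h := by
    simp only [MonoidHom.comp_apply, m.incl_antiDiag]
    exact WrHecke.relations.sx _ _ _
  sx' i j l h hi hj := WrHecke.relations.sx' _ _ _ _ (fun h' => hi (m.pos_injective k h'))
    (fun h' => hj (m.pos_injective k h'))
  sg i j h c := by
    simp only [MonoidHom.comp_apply, m.incl_swap]
    exact WrHecke.relations.sg _ _ _ _

/-- The inclusion of the `k`-th tensor factor: the homomorphism `H_{n_k}(G) → H_n(G)` that sends the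
generators to the generators in the positions of the `k`-th block. -/
def blockHom (m : Comp r n) (k : Fin r) : WrHecke F G (m.part k) →ₐ[F] WrHecke F G n :=
  WrHecke.lift _ _ _ (blockHom_relations m k)

/-- Commutation of two homomorphisms out of wreath Hecke algebras can be tested on generators. -/
theorem commute_of_generators {B : Type u} [Ring B] [Algebra F B] {a b : ℕ}
    (f : WrHecke F G a →ₐ[F] B) (f' : WrHecke F G b →ₐ[F] B)
    (gg : ∀ c c', Commute (f (WrHecke.g c)) (f' (WrHecke.g c')))
    (gs : ∀ c i j h, Commute (f (WrHecke.g c)) (f' (WrHecke.s i j h)))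
    (gx : ∀ c i, Commute (f (WrHecke.g c)) (f' (WrHecke.x i)))
    (sg : ∀ i j h c, Commute (f (WrHecke.s i j h)) (f' (WrHecke.g c)))
    (ss : ∀ i j h i' j' h', Commute (f (WrHecke.s i j h)) (f' (WrHecke.s i' j' h')))
    (sx : ∀ i j h i', Commute (f (WrHecke.s i j h)) (f' (WrHecke.x i')))
    (xg : ∀ i c, Commute (f (WrHecke.x i)) (f' (WrHecke.g c)))
    (xs : ∀ i i' j' h', Commute (f (WrHecke.x i)) (f' (WrHecke.s i' j' h')))
    (xx : ∀ i i', Commute (f (WrHecke.x i)) (f' (WrHecke.x i'))) (p q) :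
    Commute (f p) (f' q) := by
  have key : ∀ b', (∀ c, Commute (f (WrHecke.g c)) b') → (∀ i j h, Commute (f (WrHecke.s i j h)) b') →
      (∀ i, Commute (f (WrHecke.x i)) b') → ∀ p, Commute (f p) b' := by
    intro b' h1 h2 h3 p
    rw [← mem_commuting]
    refine WrHecke.induct _ ?_ ?_ ?_ p <;> intros <;> rw [mem_commuting] <;> apply_assumption
  have key' : ∀ b', (∀ c, Commute (f' (WrHecke.g c)) b') →
      (∀ i j h, Commute (f' (WrHecke.s i j h)) b') →
      (∀ i, Commute (f' (WrHecke.x i)) b') → ∀ p, Commute (f' p) b' := by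
    intro b' h1 h2 h3 p
    rw [← mem_commuting]
    refine WrHecke.induct _ ?_ ?_ ?_ p <;> intros <;> rw [mem_commuting] <;> apply_assumption
  refine (key' _ ?_ ?_ ?_ q).symm
  · intro c
    exact (key _ (fun c' => gg c' c) (fun i j h => sg i j h c) (fun i => xg i c) p).symm
  · intro i j h
    exact (key _ (fun c' => gs c' i j h) (fun i' j' h' => ss i' j' h' i j h)
      (fun i' => xs i' i j h) p).symm
  · intro i
    exact (key _ (fun c' => gx c' i) (fun i' j' h' => sx i' j' h' i) (fun i' => xx i' i) p).symm

theorem far_commute {m : Comp r n} {k l : Fin r} (hkl : k ≠ l) {i j : Fin (m.part k)}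
    (h : i.val + 1 = j.val) {i' j' : Fin (m.part l)} (h' : i'.val + 1 = j'.val) :
    Commute (WrHecke.s (F := F) (G := G) (m.pos ⟨k, i⟩) (m.pos ⟨k, j⟩) (m.pos_succ h))
      (WrHecke.s (m.pos ⟨l, i'⟩) (m.pos ⟨l, j'⟩) (m.pos_succ h')) := by
  rcases m.far hkl h h' with hl | hl
  · exact WrHecke.relations.comm _ _ _ _ _ _ hl
  · exact (WrHecke.relations.comm _ _ _ _ _ _ hl).symm

theorem far_incl_commute {m : Comp r n} {k l : Fin r} (hkl : k ≠ l) {i j : Fin (m.part k)}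
    (h : i.val + 1 = j.val) (c : Fin (m.part l) → G) :
    Commute (WrHecke.s (F := F) (G := G) (m.pos ⟨k, i⟩) (m.pos ⟨k, j⟩) (m.pos_succ h))
      (WrHecke.g (m.incl l c)) := by
  have := WrHecke.relations (F := F).sg (m.pos ⟨k, i⟩) (m.pos ⟨k, j⟩) (m.pos_succ h) (m.incl l c)
  rwa [m.incl_swap_other hkl] at this

theorem blockHom_commute (m : Comp r n) :
    Pairwise fun k l => ∀ (p : WrHecke F G (m.part k)) (q : WrHecke F G (m.part l)),
      Commute (blockHom m k p) (blockHom m l q) := by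
  intro k l hkl
  apply commute_of_generators <;> intros <;>
    simp only [blockHom, WrHecke.lift_g, WrHecke.lift_s, WrHecke.lift_x, MonoidHom.comp_apply]
  · exact (m.incl_commute hkl _ _).map WrHecke.g
  · rename_i c i j h
    exact (far_incl_commute (Ne.symm hkl) h c).symm
  · exact (WrHecke.relations.xg _ _).symm
  · rename_i i j h c
    exact far_incl_commute hkl h c
  · rename_i i j h i' j' h'
    exact far_commute hkl h h'
  · exact WrHecke.relations.sx' _ _ _ _ (m.pos_ne (Ne.symm hkl) _ _) (m.pos_ne (Ne.symm hkl) _ _)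
  · exact WrHecke.relations.xg _ _
  · exact (WrHecke.relations.sx' _ _ _ _ (m.pos_ne hkl _ _) (m.pos_ne hkl _ _)).symm
  · exact WrHecke.relations.xx _ _

/-- The homomorphism `H_{n_1}(G) ⊗ ⋯ ⊗ H_{n_r}(G) → H_n(G)` onto the parabolic subalgebra. -/
def parHom (m : Comp r n) : ParHecke F G m →ₐ[F] WrHecke F G n :=
  tensorLift (blockHom m) (blockHom_commute m)

end
/-! ### The simple module `V(n̂)` of `G^n` -/

namespace SimpleSystem

variable {F : Type u} [Field F] {G : Type u} [Group G] {r n : ℕ}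
  (S : SimpleSystem F G r) (m : Comp r n)

/-- `V(n̂) = V_1^{⊗ n_1} ⊗ ⋯ ⊗ V_r^{⊗ n_r}`. -/
abbrev TV : Type u := ⨂[F] q : m.Pos, S.V q.1

/-- The action of `G^n` on `V(n̂)`, factor by factor. -/
def tvRep : Representation F (Fin n → G) (S.TV m) :=
  PiTensorProduct.mapMonoidHom.comp
    { toFun := fun g (q : m.Pos) => S.ρ q.1 (g (m.pos q))
      map_one' := by funext q; simp
      map_mul' := fun g g' => by funext q; simp }

theorem tvRep_tprod (g : Fin n → G) (v : ∀ q : m.Pos, S.V q.1) :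
    S.tvRep m g (PiTensorProduct.tprod F v) =
      PiTensorProduct.tprod F fun q => S.ρ q.1 (g (m.pos q)) (v q) :=
  PiTensorProduct.map_tprod _ _

/-- The action of a Young subgroup element `(w_1, …, w_r)` on `V(n̂)` by place permutations. -/
def tvPermLin (w : ∀ k, Equiv.Perm (Fin (m.part k))) : S.TV m →ₗ[F] S.TV m :=
  (PiTensorProduct.reindex F (fun q : m.Pos => S.V q.1) (Equiv.sigmaCongrRight w)).toLinearMap

theorem tvPermLin_tprod (w : ∀ k, Equiv.Perm (Fin (m.part k))) (v : ∀ q : m.Pos, S.V q.1) :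
    S.tvPermLin m w (PiTensorProduct.tprod F v) =
      PiTensorProduct.tprod F fun q : m.Pos => v ⟨q.1, (w q.1)⁻¹ q.2⟩ :=
  PiTensorProduct.reindex_tprod (Equiv.sigmaCongrRight w) v

variable {S m} in
theorem tv_ext {X : Type u} [AddCommGroup X] [Module F X] {f f' : S.TV m →ₗ[F] X}
    (h : ∀ v, f (PiTensorProduct.tprod F v) = f' (PiTensorProduct.tprod F v)) : f = f' :=
  PiTensorProduct.ext (MultilinearMap.ext h)

/-- The action of the Young subgroup on `V(n̂)` by place permutations. -/
def tvPerm : (∀ k, Equiv.Perm (Fin (m.part k))) →* Module.End F (S.TV m) where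
  toFun w := S.tvPermLin m w
  map_one' := by
    apply tv_ext
    intro v
    rw [tvPermLin_tprod]
    rfl
  map_mul' w w' := by
    apply tv_ext
    intro v
    rw [Module.End.mul_apply, tvPermLin_tprod, tvPermLin_tprod, tvPermLin_tprod]
    rfl

theorem tvPerm_tprod (w : ∀ k, Equiv.Perm (Fin (m.part k))) (v : ∀ q : m.Pos, S.V q.1) :
    S.tvPerm m w (PiTensorProduct.tprod F v) =
      PiTensorProduct.tprod F fun q : m.Pos => v ⟨q.1, (w q.1)⁻¹ q.2⟩ :=
  S.tvPermLin_tprod m w v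

/-- The element of the Young subgroup that transposes `i` and `j` in the `k`-th block. -/
def blockSwap (k : Fin r) (i j : Fin (m.part k)) : ∀ l, Equiv.Perm (Fin (m.part l)) :=
  Pi.mulSingle k (Equiv.swap i j)

/-- The operator on `V(n̂)` that exchanges the factors `i` and `j` of the `k`-th block. -/
def flip (k : Fin r) (i j : Fin (m.part k)) : Module.End F (S.TV m) :=
  S.tvPerm m (blockSwap m k i j)

variable {m}

theorem blockSwap_inv_same (k : Fin r) (i j a : Fin (m.part k)) :
    (blockSwap m k i j k)⁻¹ a = Equiv.swap i j a := by
  have : blockSwap m k i j k = Equiv.swap i j :=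
    Pi.mulSingle_eq_same (M := fun l => Equiv.Perm (Fin (m.part l))) k (Equiv.swap i j)
  rw [this, Equiv.swap_inv]

theorem blockSwap_inv_other {k l : Fin r} (h : l ≠ k) (i j : Fin (m.part k))
    (a : Fin (m.part l)) : (blockSwap m k i j l)⁻¹ a = a := by
  have : blockSwap m k i j l = 1 :=
    Pi.mulSingle_eq_of_ne (M := fun l => Equiv.Perm (Fin (m.part l))) h (Equiv.swap i j)
  rw [this, inv_one]
  rfl

theorem flip_tprod (k : Fin r) (i j : Fin (m.part k)) (v : ∀ q : m.Pos, S.V q.1) :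
    S.flip m k i j (PiTensorProduct.tprod F v) =
      PiTensorProduct.tprod F (Function.update (Function.update v ⟨k, i⟩ (v ⟨k, j⟩)) ⟨k, j⟩
        (v ⟨k, i⟩)) := by
  rw [flip, tvPerm_tprod]
  congr 1
  funext q
  obtain ⟨l, a⟩ := q
  by_cases hl : l = k
  · subst hl
    rw [blockSwap_inv_same]
    by_cases haj : a = j
    · subst haj; rw [Equiv.swap_apply_right, Function.update_self]
    · rw [Function.update_of_ne (by simpa using haj)]
      by_cases hai : a = i
      · subst hai; rw [Equiv.swap_apply_left, Function.update_self]
      · rw [Function.update_of_ne (by simpa using hai), Equiv.swap_apply_of_ne_of_ne hai haj]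
  · rw [Function.update_of_ne (by rintro ⟨⟩; exact hl rfl),
      Function.update_of_ne (by rintro ⟨⟩; exact hl rfl)]
    rw [blockSwap_inv_other hl]

theorem flip_flip (k : Fin r) (i j : Fin (m.part k)) : S.flip m k i j * S.flip m k i j = 1 := by
  rw [flip, ← map_mul, blockSwap, ← Pi.mulSingle_mul, Equiv.swap_mul_self, Pi.mulSingle_one, map_one]

theorem flip_flip_apply (k : Fin r) (i j : Fin (m.part k)) (v : S.TV m) :
    S.flip m k i j (S.flip m k i j v) = v :=
  congrArg (fun T : Module.End F (S.TV m) => T v) (S.flip_flip k i j)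

theorem flip_surjective (k : Fin r) (i j : Fin (m.part k)) :
    Function.Surjective (S.flip m k i j) := fun v => ⟨_, S.flip_flip_apply k i j v⟩

theorem flip_comm (k : Fin r) {i j i' j' : Fin (m.part k)} (h : i.val + 1 = j.val)
    (h' : i'.val + 1 = j'.val) (hj : j < i') :
    S.flip m k i j * S.flip m k i' j' = S.flip m k i' j' * S.flip m k i j := by
  rw [flip, flip, ← map_mul, ← map_mul, blockSwap, blockSwap, ← Pi.mulSingle_mul, ← Pi.mulSingle_mul]
  congr 2
  apply Equiv.Perm.Disjoint.commute
  intro a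
  rw [Fin.lt_def] at hj
  by_cases ha : a = i ∨ a = j
  · right
    apply Equiv.swap_apply_of_ne_of_ne <;> rintro rfl <;> rcases ha with rfl | rfl <;> omega
  · left
    exact Equiv.swap_apply_of_ne_of_ne (fun h => ha (Or.inl h)) (fun h => ha (Or.inr h))

theorem flip_braid (k : Fin r) {i j l : Fin (m.part k)} (h : i.val + 1 = j.val)
    (h' : j.val + 1 = l.val) :
    S.flip m k i j * S.flip m k j l * S.flip m k i j =
      S.flip m k j l * S.flip m k i j * S.flip m k j l := by
  simp only [flip, ← map_mul, blockSwap, ← Pi.mulSingle_mul]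
  congr 2
  have hij : i ≠ j := by rintro rfl; omega
  have hjl : j ≠ l := by rintro rfl; omega
  have hil : i ≠ l := by rintro rfl; omega
  have e1 := Equiv.swap_mul_swap_mul_swap (x := l) (y := j) (z := i) hjl.symm hil.symm
  have e2 := Equiv.swap_mul_swap_mul_swap (x := i) (y := j) (z := l) hij hil
  rw [Equiv.swap_comm l j, Equiv.swap_comm j i] at e1
  rw [e1, e2, Equiv.swap_comm]

theorem flip_commute {k l : Fin r} (hkl : k ≠ l) (i j : Fin (m.part k)) (i' j' : Fin (m.part l)) :
    Commute (S.flip m k i j) (S.flip m l i' j') :=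
  (Pi.mulSingle_commute hkl _ _).map (S.tvPerm m)

theorem flip_tvRep (k : Fin r) (i j : Fin (m.part k)) (g : Fin n → G) (v : S.TV m) :
    S.flip m k i j (S.tvRep m g v) =
      S.tvRep m (fun a => g (Equiv.swap (m.pos ⟨k, i⟩) (m.pos ⟨k, j⟩) a)) (S.flip m k i j v) := by
  have : S.flip m k i j ∘ₗ S.tvRep m g =
      S.tvRep m (fun a => g (Equiv.swap (m.pos ⟨k, i⟩) (m.pos ⟨k, j⟩) a)) ∘ₗ S.flip m k i j := by
    apply tv_ext
    intro v
    rw [LinearMap.comp_apply, LinearMap.comp_apply, tvRep_tprod]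
    simp only [flip]
    rw [tvPerm_tprod, tvPerm_tprod, tvRep_tprod]
    congr 1
    funext q
    obtain ⟨l, a⟩ := q
    by_cases hl : l = k
    · subst hl
      simp only [blockSwap_inv_same, m.pos_swap]
    · rw [Equiv.swap_apply_of_ne_of_ne (m.pos_ne hl _ _) (m.pos_ne hl _ _)]
      simp only [blockSwap_inv_other hl]
  exact congrArg (fun T : S.TV m →ₗ[F] S.TV m => T v) this

/-- `t_{ij}` acts on `V(n̂)` as `c_k` times the flip, for positions `i`, `j` in the `k`-th block. -/
theorem sum_antiDiag [IsAlgClosed F] [Fintype G] (k : Fin r) {i j : Fin (m.part k)} (hij : i ≠ j)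
    (v : S.TV m) :
    ∑ h : G, S.tvRep m (antiDiag (m.pos ⟨k, i⟩) (m.pos ⟨k, j⟩) h) v =
      S.c k • S.flip m k i j v := by
  have : ∑ h : G, S.tvRep m (antiDiag (m.pos ⟨k, i⟩) (m.pos ⟨k, j⟩) h) =
      S.c k • S.flip m k i j := by
    apply tv_ext
    intro v
    rw [LinearMap.smul_apply, flip_tprod, LinearMap.sum_apply]
    have hne : (⟨k, j⟩ : m.Pos) ≠ ⟨k, i⟩ := by simpa using Ne.symm hij
    let b : S.V k →ₗ[F] S.V k →ₗ[F] S.TV m := LinearMap.mk₂ F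
      (fun x y => PiTensorProduct.tprod F
        (Function.update (Function.update v ⟨k, i⟩ x) ⟨k, j⟩ y))
      (fun x x' y => by
        rw [Function.update_comm hne.symm, Function.update_comm hne.symm,
          Function.update_comm hne.symm, MultilinearMap.map_update_add])
      (fun c x y => by
        rw [Function.update_comm hne.symm, Function.update_comm hne.symm,
          MultilinearMap.map_update_smul])
      (fun x y y' => by rw [MultilinearMap.map_update_add])
      (fun c x y => by rw [MultilinearMap.map_update_smul])
    have hb := congrArg (TensorProduct.lift b) (S.c_spec k (v ⟨k, i⟩) (v ⟨k, j⟩))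
    rw [map_sum, map_smul] at hb
    simp only [TensorProduct.lift.tmul] at hb
    refine Eq.trans (Finset.sum_congr rfl fun h _ => ?_) hb
    rw [tvRep_tprod]
    change _ = PiTensorProduct.tprod F _
    congr 1
    funext q
    by_cases hqj : q = ⟨k, j⟩
    · subst hqj
      have : m.pos ⟨k, j⟩ ≠ m.pos ⟨k, i⟩ := fun h' => hne (m.pos.injective h')
      simp [antiDiag, Pi.mulSingle_eq_of_ne this]
    · have h1 : m.pos q ≠ m.pos ⟨k, j⟩ := fun h' => hqj (m.pos.injective h')
      rw [Function.update_of_ne hqj]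
      by_cases hqi : q = ⟨k, i⟩
      · subst hqi
        simp [antiDiag, Pi.mulSingle_eq_of_ne h1]
      · have h2 : m.pos q ≠ m.pos ⟨k, i⟩ := fun h' => hqi (m.pos.injective h')
        rw [Function.update_of_ne hqi]
        simp [antiDiag, Pi.mulSingle_eq_of_ne h1, Pi.mulSingle_eq_of_ne h2]
  have h' := congrArg (fun T : S.TV m →ₗ[F] S.TV m => T v) this
  simpa [LinearMap.sum_apply] using h'

end SimpleSystem
/-! ### The algebra `A_{n,r}` and its action on homomorphism spaces -/

set_option linter.unusedSectionVars false

section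

variable {F : Type u} [Field F] {G : Type u} [Group G] [Fintype G] {r n : ℕ}
  {M N : Type u} [AddCommGroup M] [Module F M] [AddCommGroup N] [Module F N]

/-- The restriction to `G^n` of a representation of `H_n(G)`. -/
def gRep (α : WrHecke F G n →ₐ[F] Module.End F M) : Representation F (Fin n → G) M :=
  (α : WrHecke F G n →* Module.End F M).comp WrHecke.g

theorem gRep_apply (α : WrHecke F G n →ₐ[F] Module.End F M) (g : Fin n → G) (v : M) :
    gRep α g v = α (WrHecke.g g) v := rfl

end

namespace SimpleSystem

variable {F : Type u} [Field F] [IsAlgClosed F] {G : Type u} [Group G] [Fintype G] {r n : ℕ}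
  (S : SimpleSystem F G r)

open scoped Classical in
/-- The parameter of the degenerate affine Hecke algebra of the `k`-th block: `1` if `c_k ≠ 0`, and
`0` if `c_k = 0`. -/
def param (k : Fin r) : F := if S.c k = 0 then 0 else 1

open scoped Classical in
/-- The scaling factor between `x` and `y` in the `k`-th block: `c_k` if `c_k ≠ 0`, and `1` if
`c_k = 0`. -/
def scale (k : Fin r) : F := if S.c k = 0 then 1 else S.c k

theorem inv_scale_mul (k : Fin r) : (S.scale k)⁻¹ * S.c k = S.param k := by
  unfold scale param
  split_ifs with h
  · simp [h]
  · exact inv_mul_cancel₀ h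

theorem scale_mul (k : Fin r) : S.scale k * S.param k = S.c k := by
  unfold scale param
  split_ifs with h
  · simp [h]
  · simp

/-- `A_{n̂,r}`, the tensor product over `k` of the algebras `H_{n_k}` (if `c_k ≠ 0`) or
`⁰H_{n_k}` (if `c_k = 0`). -/
abbrev APar (m : Comp r n) : Type u := ⨂[F] k, DegHecke F (S.param k) (m.part k)

/-- `A_{n,r}`, the direct sum of the finitely many algebras `A_{n̂,r}`. -/
abbrev A (n : ℕ) : Type u := ∀ m : Comp r n, S.APar m

section

variable {M N : Type u} [AddCommGroup M] [Module F M] [AddCommGroup N] [Module F N]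
  (α : WrHecke F G n →ₐ[F] Module.End F M) (β : WrHecke F G n →ₐ[F] Module.End F N)
  (m : Comp r n)

/-- `Hom_{FG^n}(V(n̂), I_{n̂} M)`. -/
abbrev HomSp : Type u := HomIso (S.tvRep m) (gRep α)

variable {m}

/-- The action of `s_i` in the `k`-th block: `φ ↦ s_i ∘ φ ∘ (flip)`. -/
def homS (k : Fin r) (i j : Fin (m.part k)) (h : i.val + 1 = j.val) :
    Module.End F (S.HomSp α m) :=
  homOp (α (WrHecke.s (m.pos ⟨k, i⟩) (m.pos ⟨k, j⟩) (m.pos_succ h))) (S.flip m k i j)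
    (S.flip_surjective k i j) (by
      intro c
      refine ⟨_, fun v => S.flip_tvRep k i j c v, fun v => ?_⟩
      rw [gRep_apply, gRep_apply, ← Module.End.mul_apply, ← Module.End.mul_apply, ← map_mul,
        ← map_mul, WrHecke.relations.sg]
      congr 4
      funext a
      simp)

/-- The action of `y_i` in the `k`-th block: `φ ↦ c_k⁻¹ x_i ∘ φ` if `c_k ≠ 0`, and
`φ ↦ x_i ∘ φ` if `c_k = 0`. -/
def homY (k : Fin r) (i : Fin (m.part k)) : Module.End F (S.HomSp α m) :=
  homOp ((S.scale k)⁻¹ • α (WrHecke.x (m.pos ⟨k, i⟩))) LinearMap.id Function.surjective_id (by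
      intro c
      refine ⟨c, fun v => rfl, fun v => ?_⟩
      rw [gRep_apply, gRep_apply, LinearMap.smul_apply, LinearMap.smul_apply, map_smul,
        ← Module.End.mul_apply, ← Module.End.mul_apply, ← map_mul, ← map_mul,
        WrHecke.relations.xg])

theorem homS_apply (k : Fin r) (i j : Fin (m.part k)) (h : i.val + 1 = j.val) (φ : S.HomSp α m)
    (v : S.TV m) : (S.homS α k i j h φ v : M) =
      α (WrHecke.s (m.pos ⟨k, i⟩) (m.pos ⟨k, j⟩) (m.pos_succ h)) (φ (S.flip m k i j v)) := rfl

theorem homY_apply (k : Fin r) (i : Fin (m.part k)) (φ : S.HomSp α m) (v : S.TV m) :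
    (S.homY α k i φ v : M) = (S.scale k)⁻¹ • α (WrHecke.x (m.pos ⟨k, i⟩)) (φ v) := rfl

theorem end_ext {T T' : Module.End F (S.HomSp α m)}
    (h : ∀ φ v, (T φ v : M) = T' φ v) : T = T' :=
  LinearMap.ext fun φ => homIso_ext fun v => h φ v

theorem hom_relations (k : Fin r) :
    DegHecke.Relations (S.param k) (S.homS α (m := m) k) (S.homY α (m := m) k) where
  yy i j := by
    apply S.end_ext
    intro φ v
    simp only [Module.End.mul_apply, homY_apply, map_smul]
    rw [← Module.End.mul_apply, ← Module.End.mul_apply, ← map_mul, ← map_mul, WrHecke.relations.xx]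
  ss i j h := by
    apply S.end_ext
    intro φ v
    simp only [Module.End.mul_apply, homS_apply, flip_flip_apply, Module.End.one_apply]
    rw [← Module.End.mul_apply, ← map_mul, WrHecke.relations.ss, map_one, Module.End.one_apply]
  comm i j i' j' h h' hj := by
    apply S.end_ext
    intro φ v
    simp only [Module.End.mul_apply, homS_apply]
    rw [← Module.End.mul_apply, ← Module.End.mul_apply (α _), ← map_mul, ← map_mul,
      WrHecke.relations.comm _ _ _ _ _ _ (m.pos_lt hj), ← Module.End.mul_apply,
      ← Module.End.mul_apply (S.flip m k i j), S.flip_comm k h h' hj]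
  braid i j l h h' := by
    apply S.end_ext
    intro φ v
    simp only [Module.End.mul_apply, homS_apply]
    simp only [← Module.End.mul_apply, ← map_mul, ← mul_assoc]
    rw [S.flip_braid k h h', WrHecke.relations.braid]
  sy i j h := by
    apply S.end_ext
    intro φ v
    have hij : i ≠ j := by rintro rfl; omega
    have ht : ∀ w, α (∑ c : G, WrHecke.g (antiDiag (m.pos ⟨k, i⟩) (m.pos ⟨k, j⟩) c)) (φ w : M) =
        S.c k • (φ (S.flip m k i j w) : M) := by
      intro w
      have h1 : φ (∑ c : G, S.tvRep m (antiDiag (m.pos ⟨k, i⟩) (m.pos ⟨k, j⟩) c) w) =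
          ∑ c : G, φ (S.tvRep m (antiDiag (m.pos ⟨k, i⟩) (m.pos ⟨k, j⟩) c) w) := map_sum φ _ _
      have h2 := congrArg Subtype.val h1
      rw [S.sum_antiDiag k hij, map_smul] at h2
      rw [map_sum, LinearMap.sum_apply]
      refine Eq.trans ?_ h2.symm
      rw [AddSubmonoidClass.coe_finsetSum]
      refine Finset.sum_congr rfl fun c _ => ?_
      rw [homIso_equivariant]
      rfl
    rw [Module.End.mul_apply, homS_apply, homY_apply, map_smul, ← Module.End.mul_apply, ← map_mul,
      WrHecke.relations.sx, map_sub, LinearMap.sub_apply, ht, flip_flip_apply, smul_sub, smul_smul,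
      inv_scale_mul, LinearMap.sub_apply, Module.End.mul_apply, Module.algebraMap_end_apply]
    change _ = (S.homY α k j (S.homS α k i j h φ) v : M) - S.param k • (φ v : M)
    rw [homY_apply, homS_apply, map_mul, Module.End.mul_apply]
  sy' i j l h hi hj := by
    apply S.end_ext
    intro φ v
    simp only [Module.End.mul_apply, homS_apply, homY_apply, map_smul]
    rw [← Module.End.mul_apply, ← Module.End.mul_apply (α _), ← map_mul, ← map_mul,
      WrHecke.relations.sx' _ _ _ _ (fun h' => hi (m.pos_injective k h'))
        (fun h' => hj (m.pos_injective k h'))]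

/-- The action of the `k`-th tensor factor of `A_{n̂,r}` on `Hom_{FG^n}(V(n̂), I_{n̂} M)`. -/
def homBlock (k : Fin r) : DegHecke F (S.param k) (m.part k) →ₐ[F] Module.End F (S.HomSp α m) :=
  DegHecke.lift _ _ (S.hom_relations α k)

theorem homBlock_commute : Pairwise fun k l => ∀ (p : DegHecke F (S.param k) (m.part k))
    (q : DegHecke F (S.param l) (m.part l)), Commute (S.homBlock α k p) (S.homBlock α l q) := by
  intro k l hkl p q
  have hss : ∀ i j h i' j' h', Commute (S.homS α (m := m) k i j h) (S.homS α l i' j' h') := by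
    intro i j h i' j' h'
    apply S.end_ext
    intro φ v
    simp only [Module.End.mul_apply, homS_apply]
    simp only [← Module.End.mul_apply, ← map_mul]
    rw [(far_commute hkl h h').eq, (S.flip_commute hkl i j i' j').eq]
  have hsy : ∀ {k l : Fin r}, k ≠ l → ∀ i j h i',
      Commute (S.homS α (m := m) k i j h) (S.homY α l i') := by
    intro k l hkl i j h i'
    apply S.end_ext
    intro φ v
    simp only [Module.End.mul_apply, homS_apply, homY_apply, map_smul]
    simp only [← Module.End.mul_apply, ← map_mul]
    rw [WrHecke.relations.sx' _ _ _ _ (m.pos_ne hkl.symm _ _) (m.pos_ne hkl.symm _ _)]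
  have hyy : ∀ i i', Commute (S.homY α (m := m) k i) (S.homY α l i') := by
    intro i i'
    apply S.end_ext
    intro φ v
    simp only [Module.End.mul_apply, homY_apply, map_smul]
    simp only [← Module.End.mul_apply, ← map_mul]
    rw [WrHecke.relations.xx, smul_comm]
  apply deg_commute_of_generators
  · intro i j h i' j' h'
    rw [homBlock, homBlock, DegHecke.lift_s, DegHecke.lift_s]
    exact hss i j h i' j' h'
  · intro i j h i'
    rw [homBlock, homBlock, DegHecke.lift_s, DegHecke.lift_y]
    exact hsy hkl i j h i'
  · intro i i' j' h'
    rw [homBlock, homBlock, DegHecke.lift_s, DegHecke.lift_y]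
    exact (hsy hkl.symm i' j' h' i).symm
  · intro i i'
    rw [homBlock, homBlock, DegHecke.lift_y, DegHecke.lift_y]
    exact hyy i i'

variable (m) in
/-- The action of `A_{n̂,r}` on `Hom_{FG^n}(V(n̂), I_{n̂} M)`. -/
def homAct : S.APar m →ₐ[F] Module.End F (S.HomSp α m) :=
  tensorLift (S.homBlock α) (S.homBlock_commute α)

variable {α β}

/-- Functoriality of `Hom_{FG^n}(V(n̂), I_{n̂} M)` in `M`. -/
def homMap (f : M →ₗ[F] N) (hf : ∀ a v, f (α a v) = β a (f v)) :
    S.HomSp α m →ₗ[F] S.HomSp β m :=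
  homOp f LinearMap.id Function.surjective_id fun c => ⟨c, fun _ => rfl, fun _ => hf _ _⟩

theorem homMap_apply (f : M →ₗ[F] N) (hf : ∀ a v, f (α a v) = β a (f v)) (φ : S.HomSp α m)
    (v : S.TV m) : (S.homMap f hf φ v : N) = f (φ v) := rfl

theorem homMap_act (f : M →ₗ[F] N) (hf : ∀ a v, f (α a v) = β a (f v)) (a : S.APar m)
    (φ : S.HomSp α m) :
    S.homMap f hf (S.homAct α m a φ) = S.homAct β m a (S.homMap f hf φ) := by
  suffices a ∈ intertwined (S.homAct α m) (S.homAct β m) (S.homMap f hf) from this φ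
  apply tensor_induct
  intro k b φ
  simp only [homAct, tensorLift_single]
  suffices b ∈ intertwined (S.homBlock α k) (S.homBlock β k) (S.homMap f hf) from this φ
  apply DegHecke.induct
  · intro i j h φ
    simp only [homBlock, DegHecke.lift_s]
    apply homIso_ext
    intro v
    rw [homMap_apply, homS_apply, homS_apply, homMap_apply, hf]
  · intro i φ
    simp only [homBlock, DegHecke.lift_y]
    apply homIso_ext
    intro v
    rw [homMap_apply, homY_apply, homY_apply, homMap_apply, map_smul, hf]

end

end SimpleSystem
/-! ### The modules `V(n̂) ⊗ U` and induction -/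

namespace SimpleSystem

variable {F : Type u} [Field F] [IsAlgClosed F] {G : Type u} [Group G] [Fintype G] {r n : ℕ}
  (S : SimpleSystem F G r) (m : Comp r n) {U : Type u} [AddCommGroup U] [Module F U]
  (δ : S.APar m →ₐ[F] Module.End F U)

/-- The operator `T ⊗ 1` on `V(n̂) ⊗ U`. -/
def opV : Module.End F (S.TV m) →ₐ[F] Module.End F (S.TV m ⊗[F] U) :=
  Module.End.rTensorAlgHom F (S.TV m) U

/-- The inclusion of the `k`-th tensor factor in `A_{n̂,r}`. -/
def single (k : Fin r) : DegHecke F (S.param k) (m.part k) →ₐ[F] S.APar m :=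
  PiTensorProduct.singleAlgHom (R := F) (A := fun k => DegHecke F (S.param k) (m.part k)) k

/-- The operator `1 ⊗ a` on `V(n̂) ⊗ U`, for `a` in the `k`-th tensor factor of `A_{n̂,r}`. -/
def opU (k : Fin r) :
    DegHecke F (S.param k) (m.part k) →ₐ[F] Module.End F (S.TV m ⊗[F] U) :=
  (Module.End.lTensorAlgHom F U (S.TV m)).comp (δ.comp (S.single m k))

theorem opV_tmul (T : Module.End F (S.TV m)) (v : S.TV m) (z : U) :
    S.opV m (U := U) T (v ⊗ₜ z) = T v ⊗ₜ z := rfl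

theorem opU_tmul (k : Fin r) (a : DegHecke F (S.param k) (m.part k)) (v : S.TV m) (z : U) :
    S.opU m δ k a (v ⊗ₜ z) =
      v ⊗ₜ δ (S.single m k a) z := rfl

theorem opV_opU (T : Module.End F (S.TV m)) (k : Fin r)
    (a : DegHecke F (S.param k) (m.part k)) : Commute (S.opV m T) (S.opU m δ k a) := by
  apply TensorProduct.ext'
  intro v z
  rfl

theorem opU_opU {k l : Fin r} (hkl : k ≠ l) (a : DegHecke F (S.param k) (m.part k))
    (b : DegHecke F (S.param l) (m.part l)) : Commute (S.opU m δ k a) (S.opU m δ l b) := by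
  have h : Commute (S.single m k a) (S.single m l b) :=
    (Pi.mulSingle_commute (f := fun k => DegHecke F (S.param k) (m.part k)) hkl a b).map
      (PiTensorProduct.tprodMonoidHom F)
  exact (h.map δ).map (Module.End.lTensorAlgHom F U (S.TV m))

variable {m}

/-- The action of the elements of `G^{n_k}` on `V(n̂) ⊗ U`. -/
def tenG (k : Fin r) : (Fin (m.part k) → G) →* Module.End F (S.TV m ⊗[F] U) :=
  (S.opV m (U := U) : Module.End F (S.TV m) →* Module.End F (S.TV m ⊗[F] U)).comp
    ((S.tvRep m).comp (m.incl k))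

/-- The action of `s_i` in the `k`-th block on `V(n̂) ⊗ U`: place permutation on `V(n̂)`, and `s_i`
on `U`. -/
def tenS (k : Fin r) (i j : Fin (m.part k)) (h : i.val + 1 = j.val) :
    Module.End F (S.TV m ⊗[F] U) :=
  S.opV m (S.flip m k i j) * S.opU m δ k (DegHecke.s i j h)

/-- The action of `x_i` in the `k`-th block on `V(n̂) ⊗ U`: `c_k ⊗ y_i` if `c_k ≠ 0`, and `1 ⊗ y_i`
if `c_k = 0`. -/
def tenX (k : Fin r) (i : Fin (m.part k)) : Module.End F (S.TV m ⊗[F] U) :=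
  S.scale k • S.opU m δ k (DegHecke.y i)

theorem tenS_mul (k l : Fin r) (i j : Fin (m.part k)) (h : i.val + 1 = j.val)
    (T : Module.End F (S.TV m)) (a : DegHecke F (S.param l) (m.part l)) :
    S.tenS δ k i j h * (S.opV m T * S.opU m δ l a) =
      S.opV m (S.flip m k i j * T) * (S.opU m δ k (DegHecke.s i j h) * S.opU m δ l a) := by
  rw [tenS, map_mul, mul_assoc, mul_assoc, ← mul_assoc (S.opU m δ k _),
    ← (S.opV_opU m δ T k _).eq, mul_assoc]

theorem sum_antiDiag_end (k : Fin r) {i j : Fin (m.part k)} (hij : i ≠ j) :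
    ∑ h : G, S.tvRep m (antiDiag (m.pos ⟨k, i⟩) (m.pos ⟨k, j⟩) h) = S.c k • S.flip m k i j := by
  apply LinearMap.ext
  intro v
  rw [LinearMap.sum_apply, S.sum_antiDiag k hij]
  rfl

theorem flip_tvRep_end (k : Fin r) (i j : Fin (m.part k)) (g : Fin n → G) :
    S.flip m k i j * S.tvRep m g =
      S.tvRep m (fun a => g (Equiv.swap (m.pos ⟨k, i⟩) (m.pos ⟨k, j⟩) a)) * S.flip m k i j :=
  LinearMap.ext fun v => S.flip_tvRep k i j g v

theorem ten_aux {E : Type u} [Ring E] [Algebra F E] {a b y y' : E} {p q c : F}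
    (h1 : Commute a y') (h2 : b * y = y' * b - algebraMap F E q) (h3 : p * q = c) :
    (a * b) * (p • y) = (p • y') * (a * b) - c • a := by
  rw [mul_smul_comm, mul_assoc, h2, mul_sub, ← mul_assoc, h1.eq, smul_sub, smul_mul_assoc,
    mul_assoc, ← Algebra.commutes, ← Algebra.smul_def, smul_smul, h3]

theorem ten_relations (k : Fin r) :
    WrHecke.Relations (S.tenG k) (S.tenS δ k) (S.tenX δ k) where
  xx i j := by
    simp only [tenX, smul_mul_smul_comm, ← map_mul]
    rw [DegHecke.relations.yy]
  xg i c := by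
    rw [tenX, smul_mul_assoc, mul_smul_comm]
    congr 1
    exact (S.opV_opU m δ _ k _).symm
  ss i j h := by
    change S.tenS δ k i j h * (S.opV m _ * S.opU m δ k _) = 1
    rw [tenS_mul]
    rw [← map_mul, DegHecke.relations.ss, flip_flip, map_one, map_one, one_mul]
  comm i j i' j' h h' hj := by
    change S.tenS δ k i j h * (S.opV m _ * S.opU m δ k _) =
      S.tenS δ k i' j' h' * (S.opV m _ * S.opU m δ k _)
    rw [tenS_mul, tenS_mul, ← map_mul (S.opU m δ k), ← map_mul (S.opU m δ k),
      DegHecke.relations.comm _ _ _ _ _ _ hj, S.flip_comm k h h' hj]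
  braid i j l h h' := by
    rw [mul_assoc, mul_assoc]
    change S.tenS δ k i j h * (S.tenS δ k j l h' * (S.opV m _ * S.opU m δ k _)) =
      S.tenS δ k j l h' * (S.tenS δ k i j h * (S.opV m _ * S.opU m δ k _))
    rw [tenS_mul, tenS_mul, ← map_mul (S.opU m δ k), ← map_mul (S.opU m δ k), tenS_mul, tenS_mul,
      ← map_mul (S.opU m δ k), ← map_mul (S.opU m δ k), ← mul_assoc, ← mul_assoc, ← mul_assoc,
      ← mul_assoc, DegHecke.relations.braid, S.flip_braid k h h']
  sx i j h := by
    have hij : i ≠ j := by rintro rfl; omega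
    have h1 : ∑ c : G, S.tenG (U := U) k (antiDiag i j c) = S.c k • S.opV m (S.flip m k i j) := by
      rw [← map_smul, ← S.sum_antiDiag_end k hij, map_sum]
      refine Finset.sum_congr rfl fun c _ => ?_
      rw [← m.incl_antiDiag]
      rfl
    have h2 := congrArg (S.opU m δ k) (DegHecke.relations.sy (F := F) i j h)
    rw [map_mul, map_sub, map_mul, AlgHom.commutes] at h2
    rw [h1]
    exact ten_aux (E := Module.End F (S.TV m ⊗[F] U)) (S.opV_opU m δ _ k _) h2 (S.scale_mul k)
  sx' i j l h hi hj := by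
    rw [tenS, tenX, mul_smul_comm, smul_mul_assoc, mul_assoc, ← map_mul,
      DegHecke.relations.sy' _ _ _ _ hi hj, map_mul, ← mul_assoc, ← mul_assoc,
      (S.opV_opU m δ _ k _).eq]
  sg i j h c := by
    change _ * S.opV m (S.tvRep m (m.incl k c)) =
      S.opV m (S.tvRep m (m.incl k fun a => c (Equiv.swap i j a))) * _
    rw [tenS, mul_assoc, ← (S.opV_opU m δ _ k _).eq, ← mul_assoc, ← mul_assoc, ← map_mul,
      ← map_mul, S.flip_tvRep_end, m.incl_swap]

/-- The action of the `k`-th tensor factor `H_{n_k}(G)` on `V(n̂) ⊗ U`. -/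
def tenBlock (k : Fin r) : WrHecke F G (m.part k) →ₐ[F] Module.End F (S.TV m ⊗[F] U) :=
  WrHecke.lift _ _ _ (S.ten_relations δ k)

theorem flip_incl_commute {k l : Fin r} (hkl : k ≠ l) (i j : Fin (m.part k))
    (c : Fin (m.part l) → G) :
    Commute (S.flip m k i j) (S.tvRep m (m.incl l c)) := by
  have h := S.flip_tvRep_end k i j (m.incl l c)
  rwa [m.incl_swap_other hkl] at h

theorem tenBlock_commute :
    Pairwise fun k l => ∀ (p : WrHecke F G (m.part k)) (q : WrHecke F G (m.part l)),
      Commute (S.tenBlock δ k p) (S.tenBlock δ l q) := by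
  intro k l hkl
  have hgs : ∀ {k l : Fin r}, k ≠ l → ∀ c i j h,
      Commute (S.tenG (U := U) (m := m) k c) (S.tenS δ l i j h) := by
    intro k l hkl c i j h
    exact (((S.flip_incl_commute hkl.symm i j c).map (S.opV m)).symm).mul_right
      (S.opV_opU m δ _ l _)
  have hgx : ∀ {k l : Fin r}, k ≠ l → ∀ c i,
      Commute (S.tenG (U := U) (m := m) k c) (S.tenX δ l i) := by
    intro k l hkl c i
    exact (S.opV_opU m δ _ l _).smul_right _
  have hsx : ∀ {k l : Fin r}, k ≠ l → ∀ i j h i',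
      Commute (S.tenS δ k i j h) (S.tenX (m := m) δ l i') := by
    intro k l hkl i j h i'
    exact ((S.opV_opU m δ _ l _).mul_left (S.opU_opU m δ hkl _ _)).smul_right _
  apply commute_of_generators (B := Module.End F (S.TV m ⊗[F] U)) <;> intros <;>
    simp only [tenBlock, WrHecke.lift_g, WrHecke.lift_s, WrHecke.lift_x]
  · exact ((m.incl_commute hkl _ _).map (S.tvRep m)).map (S.opV m)
  · exact hgs hkl _ _ _ _
  · exact hgx hkl _ _
  · exact (hgs hkl.symm _ _ _ _).symm
  · exact ((((S.flip_commute hkl _ _ _ _).map (S.opV m)).mul_right (S.opV_opU m δ _ l _))).mul_left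
      ((S.opV_opU m δ _ k _).symm.mul_right (S.opU_opU m δ hkl _ _))
  · exact hsx hkl _ _ _ _
  · exact (hgx hkl.symm _ _).symm
  · exact (hsx hkl.symm _ _ _ _).symm
  · exact ((S.opU_opU m δ hkl _ _).smul_right _).smul_left _

/-- The action of the parabolic subalgebra on `V(n̂) ⊗ U`. -/
def tenAct : ParHecke F G m →ₐ[F] Module.End F (S.TV m ⊗[F] U) :=
  tensorLift (B := Module.End F (S.TV m ⊗[F] U)) (S.tenBlock δ) (S.tenBlock_commute δ)

theorem tenAct_map {U' : Type u} [AddCommGroup U'] [Module F U']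
    (δ' : S.APar m →ₐ[F] Module.End F U') (f : U →ₗ[F] U') (hf : ∀ a u, f (δ a u) = δ' a (f u))
    (b : ParHecke F G m) (w : S.TV m ⊗[F] U) :
    f.lTensor (S.TV m) (S.tenAct δ b w) = S.tenAct δ' b (f.lTensor (S.TV m) w) := by
  suffices b ∈ intertwined (S.tenAct δ) (S.tenAct δ') (f.lTensor (S.TV m)) from this w
  apply tensor_induct
  intro k a w
  simp only [tenAct, tensorLift_single]
  suffices a ∈ intertwined (S.tenBlock δ k) (S.tenBlock δ' k) (f.lTensor (S.TV m)) from this w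
  have ext : ∀ {T : Module.End F (S.TV m ⊗[F] U)} {T' : Module.End F (S.TV m ⊗[F] U')},
      (∀ v z, f.lTensor (S.TV m) (T (v ⊗ₜ z)) = T' (v ⊗ₜ f z)) →
      ∀ w, f.lTensor (S.TV m) (T w) = T' (f.lTensor (S.TV m) w) := by
    intro T T' h w
    have : f.lTensor (S.TV m) ∘ₗ T = T' ∘ₗ f.lTensor (S.TV m) := TensorProduct.ext' h
    exact congrArg (fun L : S.TV m ⊗[F] U →ₗ[F] S.TV m ⊗[F] U' => L w) this
  apply WrHecke.induct
  · intro c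
    apply ext
    intro v z
    simp only [tenBlock, WrHecke.lift_g]
    rfl
  · intro i j h
    apply ext
    intro v z
    simp only [tenBlock, WrHecke.lift_s, tenS, Module.End.mul_apply, opU_tmul, opV_tmul,
      LinearMap.lTensor_tmul, hf]
  · intro i
    apply ext
    intro v z
    simp only [tenBlock, WrHecke.lift_x, tenX, LinearMap.smul_apply, opU_tmul, map_smul,
      LinearMap.lTensor_tmul, hf]

end SimpleSystem

/-! ### Induction along an algebra homomorphism -/

section

variable {F : Type u} [Field F] {B H : Type u} [Ring B] [Algebra F B] [Ring H] [Algebra F H]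
  (φ : B →ₐ[F] H) {W W' : Type u} [AddCommGroup W] [Module F W] [AddCommGroup W'] [Module F W']
  (τ : B →ₐ[F] Module.End F W) (τ' : B →ₐ[F] Module.End F W')

/-- The `H`-submodule of `H ⊗_F W` generated by the elements `φ(b) ⊗ w - 1 ⊗ b w`; it is the
`F`-span of all `h φ(b) ⊗ w - h ⊗ b w`. -/
def indRel : Submodule H (H ⊗[F] W) :=
  Submodule.span H {z | ∃ b w, z = φ b ⊗ₜ[F] w - 1 ⊗ₜ[F] τ b w}

/-- The induced module `H ⊗_B W` along `φ : B → H`. -/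
def Ind : Type u := (H ⊗[F] W) ⧸ indRel φ τ

instance : AddCommGroup (Ind φ τ) := inferInstanceAs (AddCommGroup ((H ⊗[F] W) ⧸ indRel φ τ))

instance : Module H (Ind φ τ) := inferInstanceAs (Module H ((H ⊗[F] W) ⧸ indRel φ τ))

/-- The projection of `H ⊗_F W` onto the induced module. -/
def indMk : H ⊗[F] W →ₗ[H] Ind φ τ := (indRel φ τ).mkQ

/-- Functoriality of induction. -/
def indMap (f : W →ₗ[F] W') (hf : ∀ b w, f (τ b w) = τ' b (f w)) : Ind φ τ →ₗ[H] Ind φ τ' :=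
  (indRel φ τ).liftQ (indMk φ τ' ∘ₗ TensorProduct.AlgebraTensorModule.map LinearMap.id f) (by
    rw [indRel, Submodule.span_le]
    rintro _ ⟨b, w, rfl⟩
    refine (Submodule.Quotient.mk_eq_zero (indRel φ τ')).2 (Submodule.subset_span ⟨b, f w, ?_⟩)
    simp [hf])

variable {φ τ τ'} in
theorem ind_ext {X : Type u} [AddCommGroup X] [Module H X] {f g : Ind φ τ →ₗ[H] X}
    (h : ∀ a w, f (indMk φ τ (a ⊗ₜ w)) = g (indMk φ τ (a ⊗ₜ w))) :
    f = g := by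
  apply LinearMap.ext
  intro z
  obtain ⟨z, rfl⟩ := Submodule.mkQ_surjective (indRel φ τ) z
  change f (indMk φ τ z) = g (indMk φ τ z)
  induction z with
  | zero => rw [map_zero, map_zero, map_zero]
  | tmul a w => exact h a w
  | add x y hx hy => rw [map_add, map_add, map_add, hx, hy]

end
/-! ### The components `U_{n̂}` of an `A_{n,r}`-module -/

namespace SimpleSystem

variable {F : Type u} [Field F] [IsAlgClosed F] {G : Type u} [Group G] [Fintype G] {r n : ℕ}
  (S : SimpleSystem F G r) {U U' : Type u} [AddCommGroup U] [Module F U] [AddCommGroup U']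
  [Module F U'] (η : S.A n →ₐ[F] Module.End F U) (η' : S.A n →ₐ[F] Module.End F U')
  (m : Comp r n)

/-- The component `U_{n̂} = e U`, where `e` is the identity element of the summand `A_{n̂,r}`. -/
def component : Submodule F U := LinearMap.range (η (Pi.single m 1))

variable {m} in
theorem single_act_mem (a : S.APar m) (z : U) : η (Pi.single m a) z ∈ S.component η m :=
  ⟨η (Pi.single m a) z, by
    rw [← Module.End.mul_apply, ← map_mul, ← Pi.single_mul, one_mul]⟩

variable {m} in
theorem one_act (z : U) (hz : z ∈ S.component η m) : η (Pi.single m 1) z = z := by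
  obtain ⟨w, rfl⟩ := hz
  rw [← Module.End.mul_apply, ← map_mul, ← Pi.single_mul, one_mul]

/-- The action of `A_{n̂,r}` on the component `U_{n̂}`. -/
def compAct : S.APar m →ₐ[F] Module.End F (S.component η m) where
  toFun a := (η (Pi.single m a)).restrict fun z _ => S.single_act_mem η a z
  map_one' := by
    apply LinearMap.ext
    intro z
    exact Subtype.ext (S.one_act η z z.2)
  map_mul' a b := by
    apply LinearMap.ext
    intro z
    apply Subtype.ext
    change η (Pi.single m (a * b)) z = η (Pi.single m a) (η (Pi.single m b) z)
    rw [Pi.single_mul, map_mul, Module.End.mul_apply]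
  map_zero' := by
    apply LinearMap.ext
    intro z
    apply Subtype.ext
    change η (Pi.single m 0) z = 0
    rw [Pi.single_zero, map_zero, LinearMap.zero_apply]
  map_add' a b := by
    apply LinearMap.ext
    intro z
    apply Subtype.ext
    change η (Pi.single m (a + b)) z = η (Pi.single m a) z + η (Pi.single m b) z
    rw [Pi.single_add, map_add, LinearMap.add_apply]
  commutes' c := by
    apply LinearMap.ext
    intro z
    apply Subtype.ext
    change η (Pi.single m (algebraMap F (S.APar m) c)) z = c • (z : U)
    rw [Algebra.algebraMap_eq_smul_one, Pi.single_smul, map_smul, LinearMap.smul_apply,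
      S.one_act η z z.2]

variable {η η'}

/-- Functoriality of the component. -/
def compMap (f : U →ₗ[F] U') (hf : ∀ a z, f (η a z) = η' a (f z)) :
    S.component η m →ₗ[F] S.component η' m :=
  f.restrict (by
    rintro _ ⟨w, rfl⟩
    exact ⟨f w, (hf _ _).symm⟩)

theorem compMap_act (f : U →ₗ[F] U') (hf : ∀ a z, f (η a z) = η' a (f z)) (a : S.APar m)
    (z : S.component η m) :
    S.compMap m f hf (S.compAct η m a z) = S.compAct η' m a (S.compMap m f hf z) :=
  Subtype.ext (hf _ _)

/-- `ind (V(n̂) ⊗ U_{n̂})`, the module induced from the parabolic subalgebra to `H_n(G)`. -/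
abbrev IndComp (η : S.A n →ₐ[F] Module.End F U) (m : Comp r n) : Type u :=
  Ind (parHom (F := F) (G := G) m) (S.tenAct (S.compAct η m))

/-- Functoriality of `ind (V(n̂) ⊗ U_{n̂})`. -/
def indCompMap (f : U →ₗ[F] U') (hf : ∀ a z, f (η a z) = η' a (f z)) :
    S.IndComp η m →ₗ[WrHecke F G n] S.IndComp η' m :=
  indMap _ _ _ ((S.compMap m f hf).lTensor (S.TV m))
    fun b w => S.tenAct_map _ _ _ (S.compMap_act m f hf) b w

theorem indCompMap_id : S.indCompMap (η := η) m LinearMap.id (fun _ _ => rfl) = LinearMap.id := by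
  refine ind_ext fun a w => ?_
  change indMk _ _ (a ⊗ₜ (LinearMap.lTensor (S.TV m) LinearMap.id w)) = _
  rw [LinearMap.lTensor_id]
  rfl

theorem indCompMap_comp {U'' : Type u} [AddCommGroup U''] [Module F U'']
    {η'' : S.A n →ₐ[F] Module.End F U''} (f : U →ₗ[F] U') (hf : ∀ a z, f (η a z) = η' a (f z))
    (f' : U' →ₗ[F] U'') (hf' : ∀ a z, f' (η' a z) = η'' a (f' z)) :
    S.indCompMap (η := η) (η' := η'') m (f' ∘ₗ f) (fun a z => by simp [hf, hf']) =
      S.indCompMap m f' hf' ∘ₗ S.indCompMap m f hf := by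
  refine ind_ext fun a w => ?_
  change indMk _ _ (a ⊗ₜ (LinearMap.lTensor (S.TV m)
    (S.compMap m f' hf' ∘ₗ S.compMap m f hf) w)) = _
  rw [LinearMap.lTensor_comp]
  rfl

/-- `⨁_{n̂} ind (V(n̂) ⊗ U_{n̂})`. -/
abbrev IndSum (η : S.A n →ₐ[F] Module.End F U) : Type u :=
  DirectSum (Comp r n) fun m => S.IndComp η m

/-- Functoriality of `⨁_{n̂} ind (V(n̂) ⊗ U_{n̂})`. -/
def indSumMap (f : U →ₗ[F] U') (hf : ∀ a z, f (η a z) = η' a (f z)) :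
    S.IndSum η →ₗ[WrHecke F G n] S.IndSum η' :=
  DirectSum.lmap fun m => S.indCompMap m f hf

theorem indSumMap_id : S.indSumMap (η := η) LinearMap.id (fun _ _ => rfl) = LinearMap.id :=
  (congrArg DirectSum.lmap (funext fun m => S.indCompMap_id m)).trans DirectSum.lmap_id

theorem indSumMap_comp {U'' : Type u} [AddCommGroup U''] [Module F U'']
    {η'' : S.A n →ₐ[F] Module.End F U''} (f : U →ₗ[F] U') (hf : ∀ a z, f (η a z) = η' a (f z))
    (f' : U' →ₗ[F] U'') (hf' : ∀ a z, f' (η' a z) = η'' a (f' z)) :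
    S.indSumMap (η := η) (η' := η'') (f' ∘ₗ f) (fun a z => by simp [hf, hf']) =
      S.indSumMap f' hf' ∘ₗ S.indSumMap f hf :=
  (congrArg DirectSum.lmap (funext fun m => S.indCompMap_comp m f hf f' hf')).trans
    (DirectSum.lmap_comp _ _)

end SimpleSystem

/-! ### The categories and the functors -/

section

open scoped ModuleCat

variable (F : Type u) [Field F] (G : Type u) [Group G] [Fintype G] (n : ℕ)

/-- The objects of `H_n(G)-mod^s`: finite-dimensional `H_n(G)`-modules that are semisimple as
`FG^n`-modules. -/
def IsModS : ObjectProperty (ModuleCat.{u} (WrHecke F G n)) := fun M =>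
  Module.Finite F M ∧ (gRep (G := G) (n := n) (M := M)
    (Algebra.lsmul F F M : WrHecke F G n →ₐ[F] Module.End F M)).IsSemisimpleRepresentation

/-- The category `H_n(G)-mod^s`. -/
abbrev ModS : Type (u + 1) := (IsModS F G n).FullSubcategory

/-- The objects of `A-mod`: the finite-dimensional left `A`-modules. -/
def IsFd (A : Type u) [Ring A] [Algebra F A] : ObjectProperty (ModuleCat.{u} A) := fun M =>
  Module.Finite F M

/-- The category `A-mod` of finite-dimensional left `A`-modules. -/
abbrev FdMod (A : Type u) [Ring A] [Algebra F A] : Type (u + 1) := (IsFd F A).FullSubcategory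

end

namespace SimpleSystem

open scoped ModuleCat

variable {F : Type u} [Field F] [IsAlgClosed F] {G : Type u} [Group G] [Fintype G] {r n : ℕ}
  (S : SimpleSystem F G r)

/-- The `A_{n̂,r}`-module `Hom_{FG^n}(V(n̂), I_{n̂} M)`. -/
def HomMod (M : ModuleCat.{u} (WrHecke F G n)) (m : Comp r n) : Type u :=
  S.HomSp (Algebra.lsmul F F M) m

section

variable (M : ModuleCat.{u} (WrHecke F G n)) (m : Comp r n)

instance : AddCommGroup (S.HomMod M m) := inferInstanceAs (AddCommGroup (S.HomSp _ m))

instance : Module F (S.HomMod M m) := inferInstanceAs (Module F (S.HomSp _ m))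

instance : Module (S.APar m) (S.HomMod M m) :=
  Module.compHom (S.HomSp (Algebra.lsmul F F M) m) (S.homAct (Algebra.lsmul F F M) m).toRingHom

instance : IsScalarTower F (S.APar m) (S.HomMod M m) where
  smul_assoc c a φ := by
    change S.homAct (Algebra.lsmul F F M) m (c • a) φ = c • S.homAct (Algebra.lsmul F F M) m a φ
    rw [map_smul]
    rfl

end

/-- The `A_{n̂,r}`-linear map induced by a homomorphism of `H_n(G)`-modules. -/
def homModMap {M N : ModuleCat.{u} (WrHecke F G n)} (f : M ⟶ N) (m : Comp r n) :
    S.HomMod M m →ₗ[S.APar m] S.HomMod N m where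
  toFun := S.homMap (α := Algebra.lsmul F F M) (β := Algebra.lsmul F F N)
    (f.hom.restrictScalars F) fun a v => map_smul f.hom a v
  map_add' := map_add _
  map_smul' a φ := S.homMap_act _ _ a φ

/-- The functor `M ↦ ⨁_{n̂} Hom_{FG^n}(V(n̂), I_{n̂} M)` on all `H_n(G)`-modules; the direct sum
is indexed by the finite set of compositions. -/
def homFunctor (n : ℕ) : ModuleCat.{u} (WrHecke F G n) ⥤ ModuleCat.{u} (S.A n) where
  obj M := ModuleCat.of (S.A n) (∀ m : Comp r n, S.HomMod M m)
  map {M N} f := ModuleCat.ofHom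
    { toFun := fun φ m => S.homModMap f m (φ m)
      map_add' := fun φ ψ => funext fun m => map_add _ _ _
      map_smul' := fun a φ => funext fun m => map_smul (S.homModMap f m) (a m) (φ m) }
  map_id M := rfl
  map_comp f g := rfl

theorem homFunctor_fd (M : ModuleCat.{u} (WrHecke F G n)) (hM : Module.Finite F M) :
    IsFd F (S.A n) ((S.homFunctor n).obj M) := by
  have h1 : ∀ m : Comp r n, Module.Finite F (S.HomMod M m) := by
    intro m
    have : Module.Finite F (S.TV m) := inferInstance
    let L : S.HomSp (Algebra.lsmul F F M : WrHecke F G n →ₐ[F] Module.End F M) m →ₗ[F]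
        (S.TV m →ₗ[F] M) :=
      { toFun := fun φ =>
          { toFun := fun v => (φ v : M)
            map_add' := fun v w => by rw [map_add]; rfl
            map_smul' := fun c v => by rw [map_smul]; rfl }
        map_add' := fun φ ψ => rfl
        map_smul' := fun c φ => rfl }
    exact Module.Finite.of_injective L fun φ ψ h => homIso_ext fun v =>
      congrArg (fun T : S.TV m →ₗ[F] M => T v) h
  have h2 : Module.Finite F (∀ m : Comp r n, S.HomMod M m) := inferInstance
  let L : (∀ m : Comp r n, S.HomMod M m) →ₗ[F] ((S.homFunctor n).obj M) :=
    { toFun := fun φ => φ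
      map_add' := fun _ _ => rfl
      map_smul' := fun c φ =>
        (algebraMap_smul (M := ∀ m : Comp r n, S.HomMod M m) (S.A n) c φ).symm }
  exact Module.Finite.of_surjective L Function.surjective_id

/-- The functor `𝓕 : H_n(G)-mod^s → A_{n,r}-mod`,
`𝓕(M) = ⨁_{n̂} Hom_{FG^n}(V(n̂), I_{n̂} M)`. -/
def functorF (n : ℕ) : ModS F G n ⥤ FdMod F (S.A n) :=
  (IsFd F (S.A n)).lift ((IsModS F G n).ι ⋙ S.homFunctor n) fun M =>
    S.homFunctor_fd M.obj M.property.1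

/-- The functor `𝓖 : A_{n,r}-mod → H_n(G)-Mod`,
`𝓖(⨁_{n̂} U_{n̂}) = ⨁_{n̂} ind (V(n̂) ⊗ U_{n̂})`. -/
def functorG (n : ℕ) : FdMod F (S.A n) ⥤ ModuleCat.{u} (WrHecke F G n) where
  obj U := ModuleCat.of (WrHecke F G n)
    (S.IndSum (Algebra.lsmul F F U.obj : S.A n →ₐ[F] Module.End F U.obj))
  map {U U'} f := ModuleCat.ofHom
    (S.indSumMap (η := Algebra.lsmul F F U.obj) (η' := Algebra.lsmul F F U'.obj)
      (f.hom.hom.restrictScalars F) fun a z => map_smul f.hom.hom a z)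
  map_id U := congrArg ModuleCat.ofHom (S.indSumMap_id (η := Algebra.lsmul F F U.obj))
  map_comp {U U' U''} f g := congrArg ModuleCat.ofHom
    (S.indSumMap_comp (η := Algebra.lsmul F F U.obj) (η' := Algebra.lsmul F F U'.obj)
      (η'' := Algebra.lsmul F F U''.obj) (f.hom.hom.restrictScalars F)
      (fun a z => map_smul f.hom.hom a z) (g.hom.hom.restrictScalars F)
      (fun a z => map_smul g.hom.hom a z))

end SimpleSystem

end WreathMorita

end

noncomputable section

namespace WreathMorita

set_option linter.unusedSectionVars false

/-! ### The Coxeter presentation of the symmetric group -/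

/-! Attach to a simple `FG^n`-module its letters: the sequence of indices `k` of the simple factors
`V_k` at the `n` places. Every nonzero finite-dimensional representation of `G^n` receives a nonzero
map from some `V(n̂)` twisted by a place permutation (`exists_hom`), and homomorphisms between
modules with different letters vanish (`hom_eq_zero`). `FG` need not be semisimple, so the simple
modules are separated by the density theorem (`mem_span_range_rep`) and not by central idempotents.

The decisive computation is `sum_antiDiag_ne`: `t_{ij}` kills `V_k ⊗ V_l` for `k ≠ l`. Between
different letters the relation for `s_i x_i` therefore has no correction term, and `s_i` just
exchanges the two places. Between equal letters `t_{ij}` is `c_k` times the flip, and the place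
permutation on `V(n̂)` cancels the flip, which leaves the relations of a degenerate affine Hecke
algebra.

For this reason `ind (V(n̂) ⊗ U)` has an explicit model with one copy of `V(n̂) ⊗ U` for every
arrangement of the letters. The defining relations are checked on the model directly
(`model_relations`). Every map on `V(n̂) ⊗ U` over the parabolic subalgebra extends to the model
(`modelLift_act`), so the model is the induced module (`indEquiv`); no basis theorem for `H_n(G)`
enters. Distinct pairs of a composition and an arrangement have distinct letters
(`Comp.eq_of_letters`, `Shuffle.eq_of_letters`). Hence a map `V(n̂) → 𝓖(U)` only sees the standard
copy in the summand of `n̂`, where by density it is `v ↦ v ⊗ z`. This is bijectivity of the unit `U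
→ 𝓕𝓖(U)`.

The counit `𝓖𝓕(M) → M` is evaluation. By the triangle identity (`triangle`), `𝓕` of the counit
inverts the bijective unit. It remains to see that `𝓕` detects bijectivity. A nonzero
`G^n`-subrepresentation of an `H_n(G)`-module contains a twisted `V(n̂)`, which an element of the
symmetric group carries to an untwisted one. Applied to the kernel, and to a complement of the
image, this gives `injective_of_homMap` and `surjective_of_homMap`. -/

/-- The Coxeter relations of type `A_n`. -/
structure CoxeterRelations {B : Type*} [Monoid B] {n : ℕ} (S : Fin n → B) : Prop where
  sq : ∀ i, S i * S i = 1
  comm : ∀ i j : Fin n, i.val + 1 < j.val → S i * S j = S j * S i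
  braid : ∀ i j : Fin n, i.val + 1 = j.val → S i * S j * S i = S j * S i * S j

namespace CoxeterRelations

variable {B : Type*} [Monoid B] {n : ℕ}

/-- The graph of the homomorphism from the symmetric group, as a submonoid. -/
def graph (S : Fin n → B) : Submonoid (Equiv.Perm (Fin (n + 1)) × B) :=
  Submonoid.closure (Set.range fun i : Fin n => (Equiv.swap i.castSucc i.succ, S i))

theorem swap_mul_mem_graph {S : Fin n → B} (i : Fin n) {e : Equiv.Perm (Fin (n + 1))} {b : B}
    (h : (e, b) ∈ graph S) : (Equiv.swap i.castSucc i.succ * e, S i * b) ∈ graph S :=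
  Submonoid.mul_mem (graph S) (Submonoid.subset_closure (Set.mem_range_self i)) h

/-- The descending product `s_{p-1} ⋯ s_0`. -/
def descending (S : Fin n → B) (p : Fin (n + 1)) : B :=
  Fin.induction (motive := fun _ => B) 1 (fun i c => S i * c) p

theorem descending_zero (S : Fin n → B) : descending S 0 = 1 := rfl

theorem descending_succ (S : Fin n → B) (i : Fin n) :
    descending S i.succ = S i * descending S i.castSucc := by
  simp [descending]

variable {S : Fin (n + 1) → B} (H : CoxeterRelations S)

-- All factors of the descending product have an index at least two below `i`.
include H in
theorem mul_descending_of_lt (i : Fin (n + 1)) (p : Fin (n + 2)) (h : p.val < i.val) :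
    S i * descending S p = descending S p * S i := by
  induction p using Fin.induction with
  | zero => rw [descending_zero, mul_one, one_mul]
  | succ q ih =>
    rw [descending_succ, ← mul_assoc, ← H.comm q i (by simpa using h), mul_assoc,
      ih (by simp at h ⊢; omega), mul_assoc]

-- The letter `s_i` commutes with the factors on the left until it meets `s_{i+1} s_i`. There the
-- braid relation turns it into `s_{i+1}`, which commutes with everything further right.
include H in
theorem mul_descending_of_gt (i : Fin n) (p : Fin (n + 2)) (h : i.val + 1 < p.val) :
    S i.castSucc * descending S p = descending S p * S i.succ := by
  induction p using Fin.induction with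
  | zero => simp at h
  | succ q ih =>
    rw [descending_succ]
    by_cases hq : i.val + 1 = q.val
    · obtain rfl : q = i.succ := Fin.ext (by simp [hq])
      rw [show i.succ.castSucc = i.castSucc.succ from rfl, descending_succ, ← mul_assoc,
        ← mul_assoc, H.braid _ _ (by simp), mul_assoc, mul_assoc, mul_assoc, mul_assoc,
        H.mul_descending_of_lt _ _ (by simp)]
    · simp only [Fin.val_succ] at h
      rw [← mul_assoc, H.comm _ _ (by simp; omega), mul_assoc, ih (by simp; omega), mul_assoc]

/-- The permutation that sends `0` to `p` and acts on the complements by `e`. -/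
def glue (p : Fin (n + 2)) (e : Equiv.Perm (Fin (n + 1))) : Equiv.Perm (Fin (n + 2)) :=
  p.cycleRange.symm * Equiv.Perm.decomposeFin.symm (0, e)

theorem glue_zero (p : Fin (n + 2)) (e : Equiv.Perm (Fin (n + 1))) : glue p e 0 = p := by
  simp [glue]

theorem glue_succ (p : Fin (n + 2)) (e : Equiv.Perm (Fin (n + 1))) (j : Fin (n + 1)) :
    glue p e j.succ = p.succAbove (e j) := by
  simp [glue]

theorem glue_eq {p p' : Fin (n + 2)} {e e' : Equiv.Perm (Fin (n + 1))}
    {w : Equiv.Perm (Fin (n + 2))} (h0 : w p = p')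
    (h : ∀ j, w (p.succAbove (e j)) = p'.succAbove (e' j)) : w * glue p e = glue p' e' := by
  ext j
  cases j using Fin.cases with
  | zero => rw [Equiv.Perm.mul_apply, glue_zero, glue_zero, h0]
  | succ j => rw [Equiv.Perm.mul_apply, glue_succ, glue_succ, h]

/-- Uniqueness of the normal form: `p` is the image of `0`, and `e` is what remains after deleting
`0` and `p`. -/
theorem glue_injective {p p' : Fin (n + 2)} {e e' : Equiv.Perm (Fin (n + 1))}
    (h : glue p e = glue p' e') : p = p' ∧ e = e' := by
  have h0 : p = p' := by rw [← glue_zero p e, h, glue_zero]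
  subst h0
  refine ⟨rfl, Equiv.ext fun j => ?_⟩
  have := congrArg (fun w : Equiv.Perm (Fin (n + 2)) => w j.succ) h
  simpa [glue_succ] using this

-- The normal form of the symmetric group, computed in `Perm × B` at once: a coset representative
-- `s_{p-1} ⋯ s_0` times an element on the generators `s_1, s_2, …` that fix `0`. Multiplication by
-- `s_i` on the left keeps this form. For `p < i` it passes unchanged into the second factor, for `p
-- = i` it lengthens the descending product, for `p = i + 1` it cancels, and for `p > i + 1` it
-- passes with its index raised by one.
include H in
theorem mem_graph_step (x : Equiv.Perm (Fin (n + 2)) × B) (hx : x ∈ graph S) :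
    ∃ p e b, (e, b) ∈ graph (fun i : Fin n => S i.succ) ∧
      x = (glue p e, descending S p * b) := by
  induction hx using Submonoid.closure_induction_left with
  | one =>
    refine ⟨0, 1, 1, Submonoid.one_mem _, ?_⟩
    rw [descending_zero, one_mul]
    refine Prod.ext ?_ rfl
    ext j
    cases j using Fin.cases with
    | zero => simp [glue_zero]
    | succ j => simp [glue_succ]
  | mul_left g hg y hy ih =>
    obtain ⟨i, rfl⟩ := hg
    obtain ⟨p, e, b, heb, rfl⟩ := ih
    simp only [Prod.mk_mul_mk]
    -- Both maps are rewritten as piecewise formulas on natural numbers, so that the identities of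
    -- permutations below are linear arithmetic.
    have hsw : ∀ a : Fin (n + 2), ((Equiv.swap i.castSucc i.succ a : Fin (n + 2)) : ℕ) =
        if a.val = i.val then i.val + 1 else if a.val = i.val + 1 then i.val else a.val := by
      intro a
      rw [Equiv.swap_apply_def]
      simp only [Fin.ext_iff, Fin.val_castSucc, Fin.val_succ]
      split_ifs <;> simp
    have hsa : ∀ (p : Fin (n + 2)) (a : Fin (n + 1)), ((p.succAbove a : Fin (n + 2)) : ℕ) =
        if a.val < p.val then a.val else a.val + 1 := by
      intro p a
      rw [Fin.succAbove]
      simp only [Fin.lt_def, Fin.val_castSucc]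
      split_ifs <;> simp
    rcases lt_trichotomy p.val i.val with hp | hp | hp
    · obtain ⟨j, rfl⟩ : ∃ j : Fin n, i = j.succ :=
        ⟨i.pred (by rintro rfl; simp at hp), by simp⟩
      refine ⟨p, Equiv.swap j.castSucc j.succ * e, S j.succ * b,
        swap_mul_mem_graph j heb, Prod.ext ?_ ?_⟩
      · apply glue_eq
        · apply Fin.ext
          rw [hsw, if_neg (by omega), if_neg (by omega)]
        · intro a
          apply Fin.ext
          rw [hsw, hsa, hsa, Equiv.Perm.mul_apply, Equiv.swap_apply_def]
          simp only [Fin.ext_iff, Fin.val_castSucc, Fin.val_succ] at hp ⊢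
          split_ifs <;> simp at * <;> omega
      · simp only [← mul_assoc]
        rw [H.mul_descending_of_lt _ _ hp]
    · obtain rfl : p = i.castSucc := Fin.ext hp
      refine ⟨i.succ, e, b, heb, Prod.ext ?_ ?_⟩
      · apply glue_eq
        · simp
        · intro a
          apply Fin.ext
          rw [hsw, hsa, hsa]
          simp only [Fin.val_castSucc, Fin.val_succ]
          split_ifs <;> omega
      · simp only [descending_succ, mul_assoc]
    · by_cases hp' : p.val = i.val + 1
      · obtain rfl : p = i.succ := Fin.ext hp'
        refine ⟨i.castSucc, e, b, heb, Prod.ext ?_ ?_⟩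
        · apply glue_eq
          · simp
          · intro a
            apply Fin.ext
            rw [hsw, hsa, hsa]
            simp only [Fin.val_castSucc, Fin.val_succ]
            split_ifs <;> omega
        · simp only [descending_succ, ← mul_assoc]
          rw [H.sq, one_mul]
      · obtain ⟨j, rfl⟩ : ∃ j : Fin n, i = j.castSucc :=
          ⟨⟨i.val, by have := p.isLt; omega⟩, rfl⟩
        simp only [Fin.val_castSucc] at hp hp'
        refine ⟨p, Equiv.swap j.castSucc j.succ * e, S j.succ * b,
          swap_mul_mem_graph j heb, Prod.ext ?_ ?_⟩
        · apply glue_eq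
          · apply Fin.ext
            rw [hsw, if_neg (by simp; omega), if_neg (by simp; omega)]
          · intro a
            apply Fin.ext
            rw [hsw, hsa, hsa, Equiv.Perm.mul_apply, Equiv.swap_apply_def]
            simp only [Fin.ext_iff, Fin.val_castSucc, Fin.val_succ] at hp ⊢
            split_ifs <;> simp at * <;> omega
        · simp only [← mul_assoc]
          rw [H.mul_descending_of_gt j p (by omega)]

/-- The permutation determines both parts of its normal form, so induction on the second part
determines the element of `B`. This is where the Coxeter relations are seen to suffice for a
presentation. -/
theorem graph_functional {n : ℕ} {S : Fin n → B} (H : CoxeterRelations S)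
    {w : Equiv.Perm (Fin (n + 1))} {b b' : B} (h : (w, b) ∈ graph S) (h' : (w, b') ∈ graph S) :
    b = b' := by
  induction n generalizing b b' with
  | zero =>
    have : graph S = ⊥ := by
      rw [graph, Set.range_eq_empty, Submonoid.closure_empty]
    rw [this, Submonoid.mem_bot] at h h'
    exact (congrArg Prod.snd h).trans (congrArg Prod.snd h').symm
  | succ n ih =>
    obtain ⟨p, e, c, hc, hx⟩ := H.mem_graph_step _ h
    obtain ⟨p', e', c', hc', hx'⟩ := H.mem_graph_step _ h'
    simp only [Prod.mk.injEq] at hx hx'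
    obtain ⟨rfl, rfl⟩ := glue_injective (hx.1.symm.trans hx'.1)
    rw [hx.2, hx'.2, ih ⟨fun i => H.sq _, fun i j hij => H.comm _ _ (by simpa using hij),
      fun i j hij => H.braid _ _ (by simpa using hij)⟩ hc hc']

theorem exists_mem_graph {n : ℕ} (S : Fin n → B) (w : Equiv.Perm (Fin (n + 1))) :
    ∃ b, (w, b) ∈ graph S := by
  have hw : w ∈ Submonoid.closure
      (Set.range fun i : Fin n => Equiv.swap i.castSucc i.succ) := by
    rw [Equiv.Perm.mclosure_swap_castSucc_succ]
    trivial
  induction hw using Submonoid.closure_induction with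
  | mem x hx =>
    obtain ⟨i, rfl⟩ := hx
    exact ⟨_, Submonoid.subset_closure ⟨i, rfl⟩⟩
  | one => exact ⟨1, Submonoid.one_mem _⟩
  | mul x y _ _ hx hy =>
    obtain ⟨b, hb⟩ := hx
    obtain ⟨b', hb'⟩ := hy
    exact ⟨_, Submonoid.mul_mem _ hb hb'⟩

theorem exists_permHom {n : ℕ} {S : Fin n → B} (H : CoxeterRelations S) :
    ∃ T : Equiv.Perm (Fin (n + 1)) →* B, ∀ i, T (Equiv.swap i.castSucc i.succ) = S i := by
  choose t ht using exists_mem_graph S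
  exact ⟨{ toFun := t
           map_one' := H.graph_functional (ht 1) (Submonoid.one_mem _)
           map_mul' := fun x y => H.graph_functional (ht _) (Submonoid.mul_mem _ (ht x) (ht y)) },
    fun i => H.graph_functional (ht _) (Submonoid.subset_closure ⟨i, rfl⟩)⟩

end CoxeterRelations

/-! ### The symmetric group in the wreath Hecke algebra -/

section

variable {F : Type u} [Field F] {G : Type u} [Group G] [Fintype G] {n : ℕ}

/-- Products of the `s_i` in `H_n(G)` may thus be indexed by permutations. Injectivity of the
homomorphism plays no role. -/
theorem WrHecke.exists_permHom : ∃ T : Equiv.Perm (Fin n) →* WrHecke F G n,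
    ∀ i j h, T (Equiv.swap i j) = WrHecke.s i j h := by
  cases n with
  | zero => exact ⟨1, fun i => i.elim0⟩
  | succ n =>
    obtain ⟨T, hT⟩ := CoxeterRelations.exists_permHom (n := n)
      (S := fun i => WrHecke.s (F := F) (G := G) i.castSucc i.succ (by simp))
      ⟨fun i => WrHecke.relations.ss _ _ _,
        fun i j h => WrHecke.relations.comm _ _ _ _ _ _ (by simpa [Fin.lt_def] using h),
        fun i j h => by
          have hj : j.castSucc = i.succ := Fin.ext (by simpa using h.symm)
          simp only [hj]
          exact WrHecke.relations.braid _ _ _ _ _⟩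
    refine ⟨T, fun i j h => ?_⟩
    obtain ⟨k, rfl⟩ : ∃ k : Fin n, i = k.castSucc := ⟨⟨i.val, by omega⟩, rfl⟩
    obtain rfl : j = k.succ := Fin.ext (by simpa using h.symm)
    exact hT k

/-- The homomorphism from the symmetric group to the wreath Hecke algebra. -/
def WrHecke.perm : Equiv.Perm (Fin n) →* WrHecke F G n := WrHecke.exists_permHom.choose

theorem WrHecke.perm_swap (i j : Fin n) (h : i.val + 1 = j.val) :
    WrHecke.perm (F := F) (G := G) (Equiv.swap i j) = WrHecke.s i j h :=
  WrHecke.exists_permHom.choose_spec i j h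

theorem adjacent_swap_induction {P : Equiv.Perm (Fin n) → Prop} (one : P 1)
    (step : ∀ (i j : Fin n) (_ : i.val + 1 = j.val) w, P w → P (Equiv.swap i j * w))
    (w : Equiv.Perm (Fin n)) : P w := by
  cases n with
  | zero => rwa [Subsingleton.elim w 1]
  | succ n =>
    have hw : w ∈ Submonoid.closure
        (Set.range fun i : Fin n => Equiv.swap i.castSucc i.succ) := by
      rw [Equiv.Perm.mclosure_swap_castSucc_succ]
      trivial
    induction hw using Submonoid.closure_induction_left with
    | one => exact one
    | mul_left x hx y _ ih =>
      obtain ⟨i, rfl⟩ := hx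
      exact step _ _ (by simp) _ ih

theorem WrHecke.perm_mul_g (w : Equiv.Perm (Fin n)) (c : Fin n → G) :
    WrHecke.perm (F := F) w * WrHecke.g c = WrHecke.g (c ∘ w.symm) * WrHecke.perm w := by
  induction w using adjacent_swap_induction with
  | one => simp only [map_one, one_mul, mul_one]; rfl
  | step i j h w ih =>
    rw [map_mul, mul_assoc, ih, ← mul_assoc, perm_swap i j h, WrHecke.relations.sg, mul_assoc]
    congr 2

end

/-! ### Density for simple representations -/

section

variable {F : Type u} [Field F] [IsAlgClosed F] {H : Type u} [Group H] {ι : Type} [Fintype ι]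
  {V : ι → Type u} [∀ i, AddCommGroup (V i)] [∀ i, Module F (V i)]
  [∀ i, FiniteDimensional F (V i)] (ρ : ∀ i, Representation F H (V i))

open scoped MonoidAlgebra in
/-- Over an algebraically closed field, the group acts on pairwise non-isomorphic simple
representations with linear span the product of the endomorphism algebras. -/
theorem mem_span_range_rep (hirr : ∀ i, (ρ i).IsIrreducible)
    (hne : ∀ i j, Nonempty ((ρ i).Equiv (ρ j)) → i = j) (T : ∀ i, Module.End F (V i)) :
    T ∈ Submodule.span F (Set.range fun (h : H) i => ρ i h) := by
  classical
  let M := ∀ i, (ρ i).asModule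
  have hss : IsSemisimpleModule F[H] M := inferInstance
  -- Schur's lemma computes the commutant: off-diagonal components of an endomorphism vanish because
  -- the factors are not isomorphic, and diagonal ones are scalars.
  have hcomp : ∀ (φ : Module.End F[H] M) (i : ι), ∃ c : F, ∀ m : M, φ m i = c • m i := by
    intro φ i
    have hcoe : ∀ j, ∃ c : F, ∀ v : (ρ j).asModule, φ (Pi.single j v) i =
        (c • (Pi.single j v : M)) i := by
      intro j
      let ψ : (ρ j).asModule →ₗ[F[H]] (ρ i).asModule :=
        LinearMap.proj i ∘ₗ φ ∘ₗ LinearMap.single F[H] (fun i => (ρ i).asModule) j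
      let ψ' := (Representation.IntertwiningMap.equivLinearMapAsModule (ρ j) (ρ i)).symm ψ
      by_cases hij : j = i
      · subst hij
        have := hirr j
        obtain ⟨c, hc⟩ := (Representation.IsIrreducible.algebraMap_intertwiningMap_bijective_of_isAlgClosed
          (ρ := ρ j)).2 ψ'
        refine ⟨c, fun v => ?_⟩
        have := congrArg (fun χ : (ρ j).IntertwiningMap (ρ j) => χ v) hc
        rw [Pi.smul_apply, Pi.single_eq_same]
        exact this.symm
      · have h1 := hirr j
        have h2 := hirr i
        have : IsEmpty ((ρ j).Equiv (ρ i)) := ⟨fun e => hij (hne _ _ ⟨e⟩)⟩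
        have h0 : ψ' = 0 := Subsingleton.elim _ _
        refine ⟨0, fun v => ?_⟩
        have := congrArg (fun χ : (ρ j).IntertwiningMap (ρ i) => χ v) h0
        rw [zero_smul]
        exact this
    choose c hc using hcoe
    refine ⟨c i, fun m => ?_⟩
    have hm : m = ∑ j, Pi.single j (m j) := (Finset.univ_sum_single m).symm
    conv_lhs => rw [hm]
    rw [map_sum, Finset.sum_apply, Finset.sum_eq_single i]
    · rw [hc, Pi.smul_apply, Pi.single_eq_same]
    · intro j _ hj
      rw [hc, Pi.smul_apply, Pi.single_eq_of_ne hj.symm, smul_zero]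
    · simp
  let T' : ∀ i, (ρ i).asModule →ₗ[F] (ρ i).asModule := T
  -- Acting by scalars on each factor, the commutant commutes with the family `T`; so `T` lies in
  -- the double commutant.
  let f : Module.End (Module.End F[H] M) M :=
    { toFun := fun m i => T' i (m i)
      map_add' := fun m m' => funext fun i => map_add (T' i) _ _
      map_smul' := fun φ m => funext fun i => by
        obtain ⟨c, hc⟩ := hcomp φ i
        change T' i (φ m i) = φ (fun i => T' i (m i)) i
        rw [hc, hc, map_smul] }
  have hfd : ∀ i, Module.Finite F (ρ i).asModule := fun i => inferInstanceAs (Module.Finite F (V i))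
  have hfin : Module.Finite F M := inferInstance
  obtain ⟨s, hs⟩ := Module.Finite.fg_top (R := F) (M := M)
  -- Density gives an element of the group algebra that agrees with `T` on a finite spanning set,
  -- hence everywhere.
  obtain ⟨a, ha⟩ := jacobson_density f s
  have key : ∀ m : M, f m = a • m := by
    intro m
    have hm : m ∈ Submodule.span F (s : Set M) := hs ▸ Submodule.mem_top
    induction hm using Submodule.span_induction with
    | mem x hx => exact ha x hx
    | zero => rw [map_zero, smul_zero]
    | add x y _ _ hx hy => rw [map_add, hx, hy, smul_add]
    | smul c x _ hx =>
      rw [smul_comm, ← hx]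
      funext i
      exact map_smul (T' i) c _
  have hT : T = fun i => (ρ i).asAlgebraHom a := by
    funext i
    apply LinearMap.ext
    intro v
    let v' : (ρ i).asModule := v
    have := congrFun (key (Pi.single i v')) i
    rw [Pi.smul_apply] at this
    change T' i (Pi.single (M := fun i => (ρ i).asModule) i v' i) = _ at this
    rw [Pi.single_eq_same] at this
    exact this
  have hmem : ∀ a : F[H], (fun i => (ρ i).asAlgebraHom a) ∈
      Submodule.span F (Set.range fun (h : H) i => ρ i h) := by
    intro a
    induction a using MonoidAlgebra.induction_linear with
    | zero =>
      simp only [map_zero]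
      exact Submodule.zero_mem _
    | add x y hx hy =>
      simp only [map_add]
      exact Submodule.add_mem _ hx hy
    | single g c =>
      simp only [Representation.asAlgebraHom_single]
      exact Submodule.smul_mem _ c (Submodule.subset_span ⟨g, rfl⟩)
  exact hT ▸ hmem a

/-- A multilinear map takes values in a submodule as soon as it does so on families taken from
sets that span. -/
theorem multilinear_mem_of_span {F : Type*} [Field F] {ι : Type*} [Fintype ι] {E : ι → Type*}
    [∀ i, AddCommGroup (E i)] [∀ i, Module F (E i)] {X : Type*} [AddCommGroup X] [Module F X]
    (L : MultilinearMap F E X) (P : Submodule F X) (A : ∀ i, Set (E i))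
    (h : ∀ a, (∀ i, a i ∈ A i) → L a ∈ P) (a : ∀ i, E i)
    (ha : ∀ i, a i ∈ Submodule.span F (A i)) : L a ∈ P := by
  classical
  -- Induction on the set of slots whose entry is only known to lie in the span; the other slots
  -- hold entries of the spanning sets.
  suffices ∀ (s : Finset ι) (a : ∀ i, E i), (∀ i ∈ s, a i ∈ Submodule.span F (A i)) →
      (∀ i ∉ s, a i ∈ A i) → L a ∈ P from
    this Finset.univ a (fun i _ => ha i) fun i hi => absurd (Finset.mem_univ i) hi
  intro s
  induction s using Finset.induction_on with
  | empty => exact fun a _ h' => h a fun i => h' i (Finset.notMem_empty i)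
  | insert i s his ih =>
    intro a h1 h2
    have key : ∀ x ∈ Submodule.span F (A i), L (Function.update a i x) ∈ P := by
      intro x hx
      induction hx using Submodule.span_induction with
      | mem x hx =>
        refine ih _ (fun j hj => ?_) fun j hj => ?_
        · rw [Function.update_of_ne (by rintro rfl; exact his hj)]
          exact h1 j (Finset.mem_insert_of_mem hj)
        · by_cases hji : j = i
          · subst hji
            rwa [Function.update_self]
          · rw [Function.update_of_ne hji]
            exact h2 j (by simp [hji, hj])
      | zero => rw [MultilinearMap.map_update_zero]; exact P.zero_mem
      | add x y _ _ hx hy => rw [MultilinearMap.map_update_add]; exact P.add_mem hx hy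
      | smul c x _ hx => rw [MultilinearMap.map_update_smul]; exact P.smul_mem c hx
    have := key (a i) (h1 i (Finset.mem_insert_self i s))
    rwa [Function.update_eq_self] at this

end

/-! ### The simple modules `V(n̂)` -/

namespace SimpleSystem

variable {F : Type u} [Field F] [IsAlgClosed F] {G : Type u} [Group G] {r n : ℕ}
  (S : SimpleSystem F G r)

/-- In any characteristic, some element of `FG` acts as `1` on `V_k` and as `0` on the other simple
modules. It need be neither central nor idempotent; only its action on simple modules is used. -/
theorem exists_separating [Fintype G] (k : Fin r) :
    ∃ e : G → F, ∀ l, ∑ g, e g • S.ρ l g = if l = k then 1 else 0 := by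
  have := mem_span_range_rep S.ρ S.irreducible S.eq_of_equiv fun l => if l = k then 1 else 0
  rw [Submodule.mem_span_range_iff_exists_fun] at this
  obtain ⟨e, he⟩ := this
  refine ⟨e, fun l => ?_⟩
  rw [← congrFun he l, Finset.sum_apply]
  rfl

/-- Burnside's theorem: the density statement for a single representation. -/
theorem span_range_rep (k : Fin r) (T : Module.End F (S.V k)) :
    T ∈ Submodule.span F (Set.range (S.ρ k)) := by
  have := mem_span_range_rep (ι := Unit) (fun _ => S.ρ k) (fun _ => S.irreducible k)
    (fun _ _ _ => rfl) fun _ => T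
  have h := Submodule.mem_map_of_mem (f := LinearMap.proj (φ := fun _ : Unit => Module.End F (S.V k)) ()) this
  rw [Submodule.map_span, ← Set.range_comp] at h
  exact h

theorem nontrivial (k : Fin r) : Nontrivial (S.V k) := by
  rw [← not_subsingleton_iff_nontrivial]
  intro hs
  have := S.irreducible k
  apply bot_ne_top (α := Subrepresentation (S.ρ k))
  apply Subrepresentation.toSubmodule_injective
  exact Subsingleton.elim _ _

variable {m : Comp r n}

theorem tv_nontrivial : Nontrivial (S.TV m) := by
  have := S.nontrivial
  let b := fun q : m.Pos => Module.finBasis F (S.V q.1)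
  have : ∀ q : m.Pos, Nonempty (Fin (Module.finrank F (S.V q.1))) := fun q =>
    ⟨⟨0, Module.finrank_pos⟩⟩
  exact nontrivial_of_ne _ _ ((Basis.piTensorProduct b).ne_zero fun _ => Classical.arbitrary _)

/-- The expression is multilinear in the family `T`, and each `T q` is a combination of group
elements. For a family of group elements the operator is the action of one element of `G^n`. -/
theorem map_mem_of_subrep (K : Subrepresentation (S.tvRep m)) (T : ∀ q : m.Pos, Module.End F (S.V q.1))
    (x : S.TV m) (hx : x ∈ K.toSubmodule) : PiTensorProduct.map T x ∈ K.toSubmodule := by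
  let L : MultilinearMap F (fun q : m.Pos => Module.End F (S.V q.1)) (S.TV m) :=
    (LinearMap.applyₗ x).compMultilinearMap (PiTensorProduct.mapMultilinear F _ _)
  refine multilinear_mem_of_span L K.toSubmodule (fun q => Set.range (S.ρ q.1)) ?_ T
    fun q => S.span_range_rep _ _
  intro a ha
  choose g hg using ha
  have := K.apply_mem_toSubmodule (fun i => g (m.pos.symm i)) hx
  convert this using 1
  change PiTensorProduct.map a x = PiTensorProduct.map _ x
  congr 2
  funext q
  change a q = S.ρ q.1 (g (m.pos.symm (m.pos q)))
  rw [Equiv.symm_apply_apply, hg]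

theorem tvRep_irreducible : (S.tvRep m).IsIrreducible := by
  have hnt := S.tv_nontrivial (m := m)
  refine { exists_pair_ne := ⟨⊥, ⊤, fun h => ?_⟩, eq_bot_or_eq_top := fun K => ?_ }
  · exact bot_ne_top (α := Submodule F (S.TV m)) (congrArg Subrepresentation.toSubmodule h)
  · by_cases hK : K.toSubmodule = ⊥
    · exact Or.inl (Subrepresentation.toSubmodule_injective hK)
    · right
      apply Subrepresentation.toSubmodule_injective
      obtain ⟨x, hx, hx0⟩ := Submodule.exists_mem_ne_zero_of_ne_bot hK
      let b := fun q : m.Pos => Module.finBasis F (S.V q.1)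
      obtain ⟨p, hp⟩ : ∃ p, (Basis.piTensorProduct b).repr x p ≠ 0 := by
        by_contra! h
        exact hx0 ((Basis.piTensorProduct b).ext_elem fun p => by rw [h p]; simp)
      -- A tensor product of rank-one operators reads off the coordinate `p` of a tensor and
      -- multiplies it into an arbitrary pure tensor. One nonzero coordinate of `x` therefore yields
      -- all pure tensors.
      have hmap : ∀ (v : ∀ q : m.Pos, S.V q.1) (y : S.TV m),
          PiTensorProduct.map (fun q => ((b q).coord (p q)).smulRight (v q)) y =
            (Basis.piTensorProduct b).repr y p • PiTensorProduct.tprod F v := by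
        intro v y
        suffices PiTensorProduct.map (fun q => ((b q).coord (p q)).smulRight (v q)) =
            ((Basis.piTensorProduct b).coord p).smulRight (PiTensorProduct.tprod F v) from
          congrArg (fun L : S.TV m →ₗ[F] S.TV m => L y) this
        apply tv_ext
        intro w
        rw [PiTensorProduct.map_tprod, LinearMap.smulRight_apply, Module.Basis.coord_apply,
          Basis.piTensorProduct_repr_tprod_apply]
        simp only [LinearMap.smulRight_apply, Module.Basis.coord_apply]
        exact MultilinearMap.map_smul_univ _ _ _
      change K.toSubmodule = ⊤
      rw [eq_top_iff, ← PiTensorProduct.span_tprod_eq_top, Submodule.span_le]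
      rintro _ ⟨v, rfl⟩
      have := S.map_mem_of_subrep K (fun q => ((b q).coord (p q)).smulRight (v q)) x hx
      rw [hmap] at this
      exact (Submodule.smul_mem_iff _ hp).1 this

theorem tvRep_mulSingle (q : m.Pos) (h : G) (v : ∀ q : m.Pos, S.V q.1) :
    S.tvRep m (Pi.mulSingle (m.pos q) h) (PiTensorProduct.tprod F v) =
      PiTensorProduct.tprod F (Function.update v q (S.ρ q.1 h (v q))) := by
  rw [tvRep_tprod]
  congr 1
  funext p
  by_cases hp : p = q
  · subst hp; simp
  · rw [Function.update_of_ne hp, Pi.mulSingle_eq_of_ne fun h => hp (m.pos.injective h)]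
    simp

/-- It transfers a separating element to one factor of `G^n`, where it acts on `V(n̂)` by the scalar
`1` or `0` according to the letter at that place. -/
theorem sum_mulSingle [Fintype G] (q : m.Pos) (e : G → F) (c : F)
    (he : ∑ g, e g • S.ρ q.1 g = c • 1) :
    ∑ g, e g • S.tvRep m (Pi.mulSingle (m.pos q) g) = c • 1 := by
  apply tv_ext
  intro v
  have h := congrArg (fun T : Module.End F (S.V q.1) =>
    PiTensorProduct.tprod F (Function.update v q (T (v q)))) he
  simp only [LinearMap.sum_apply, LinearMap.smul_apply, Module.End.one_apply,
    MultilinearMap.map_update_sum, MultilinearMap.map_update_smul, Function.update_eq_self] at h ⊢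
  rw [← h]
  exact Finset.sum_congr rfl fun g _ => by rw [tvRep_mulSingle]

theorem antiDiag_comp_symm {n : ℕ} (w : Equiv.Perm (Fin n)) (i j : Fin n) (h : G) :
    antiDiag i j h ∘ w.symm = antiDiag (w i) (w j) h := by
  funext a
  simp [antiDiag, Pi.mulSingle_apply, Equiv.symm_apply_eq]

/-- `t_{ij}` acts on `V(n̂)` by zero, for positions in different blocks. -/
theorem sum_antiDiag_ne [Fintype G] {q q' : m.Pos} (hq : q.1 ≠ q'.1) :
    ∑ h : G, S.tvRep m (antiDiag (m.pos q) (m.pos q') h) = 0 := by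
  obtain ⟨e, he⟩ := S.exists_separating q.1
  have h1 := S.sum_mulSingle q e 1 (by rw [he, if_pos rfl, one_smul])
  have h2 := S.sum_mulSingle q' e 0 (by rw [he, if_neg hq.symm, zero_smul])
  have hne : m.pos q ≠ m.pos q' := fun h => hq (by rw [m.pos.injective h])
  rw [one_smul] at h1
  rw [zero_smul] at h2
  -- Since `t_{ij} g^{(i)} = g^{(j)} t_{ij}`, the element separating the letter of `q` can be moved
  -- across. It acts as `1` at the position `q` and as `0` at `q'`, so `t_{ij}` is zero.
  have hmul : ∀ g : G, (∑ h : G, S.tvRep m (antiDiag (m.pos q) (m.pos q') h)) *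
      S.tvRep m (Pi.mulSingle (m.pos q) g) = S.tvRep m (Pi.mulSingle (m.pos q') g) *
      ∑ h : G, S.tvRep m (antiDiag (m.pos q) (m.pos q') h) := by
    intro g
    rw [Finset.sum_mul, Finset.mul_sum, ← Equiv.sum_comp (Equiv.mulRight g⁻¹)]
    refine Finset.sum_congr rfl fun h _ => ?_
    rw [← map_mul, ← map_mul]
    congr 1
    simp only [antiDiag, Equiv.coe_mulRight, mul_inv_rev, inv_inv]
    rw [mul_assoc, (Pi.mulSingle_commute hne.symm _ _).eq, ← mul_assoc, ← Pi.mulSingle_mul,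
      inv_mul_cancel_right, Pi.mulSingle_mul, ← mul_assoc, ← mul_assoc,
      (Pi.mulSingle_commute hne.symm _ _).eq]
  rw [← mul_one (∑ h : G, S.tvRep m (antiDiag (m.pos q) (m.pos q') h)), ← h1, Finset.mul_sum]
  simp only [mul_smul_comm, hmul]
  simp only [← smul_mul_assoc, ← Finset.sum_mul, h2, zero_mul]

variable {U : Type u} [AddCommGroup U] [Module F U]

/-- There are no homomorphisms from `V(n̂)` to twisted multiples of `V(n̂')` if some letters are
different. -/
theorem hom_eq_zero [Fintype G] {m' : Comp r n} (σ : Fin n ≃ m'.Pos)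
    (Φ : S.TV m →ₗ[F] S.TV m' ⊗[F] U)
    (hΦ : ∀ g v, Φ (S.tvRep m g v) = S.opV m' (S.tvRep m' (g ∘ (σ.trans m'.pos).symm)) (Φ v))
    (i : Fin n) (hi : (m.pos.symm i).1 ≠ (σ i).1) : Φ = 0 := by
  -- The separating element, put in the `i`-th factor of `G^n`, acts as `1` on the source and as `0`
  -- on the target.
  obtain ⟨e, he⟩ := S.exists_separating (m.pos.symm i).1
  have h1 := S.sum_mulSingle (m.pos.symm i) e 1 (by rw [he, if_pos rfl, one_smul])
  have h2 := S.sum_mulSingle (σ i) e 0 (by rw [he, if_neg hi.symm, zero_smul])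
  rw [one_smul, Equiv.apply_symm_apply] at h1
  rw [zero_smul] at h2
  apply LinearMap.ext
  intro v
  have h3 := congrArg (fun T : Module.End F (S.TV m) => Φ (T v)) h1
  simp only [LinearMap.sum_apply, LinearMap.smul_apply, map_sum, map_smul, hΦ,
    Module.End.one_apply] at h3
  rw [LinearMap.zero_apply, ← h3]
  have h4 : ∀ g : G, (Pi.mulSingle i g : Fin n → G) ∘ (σ.trans m'.pos).symm =
      Pi.mulSingle (m'.pos (σ i)) g := by
    intro g
    funext a
    have : (σ.trans m'.pos).symm a = i ↔ a = m'.pos (σ i) := by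
      rw [Equiv.symm_apply_eq]; rfl
    simp only [Function.comp_apply, Pi.mulSingle_apply, this]
  simp only [h4]
  have h5 := congrArg (fun T : Module.End F (S.TV m') => S.opV m' T (Φ v)) h2
  simp only [map_sum, map_smul, LinearMap.sum_apply, LinearMap.smul_apply, map_zero,
    LinearMap.zero_apply] at h5
  exact h5

/-- Homomorphisms from `V(n̂)` to `V(n̂) ⊗ U` are given by elements of `U`. -/
theorem exists_tmul_of_hom (Φ : S.TV m →ₗ[F] S.TV m ⊗[F] U)
    (hΦ : ∀ g v, Φ (S.tvRep m g v) = S.opV m (S.tvRep m g) (Φ v)) :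
    ∃ z : U, ∀ v, Φ v = v ⊗ₜ z := by
  -- By irreducibility the group spans all endomorphisms, so equivariance extends from `G^n` to the
  -- full endomorphism algebra.
  have hT : ∀ (T : Module.End F (S.TV m)) v, Φ (T v) = S.opV m T (Φ v) := by
    intro T
    have hspan := mem_span_range_rep (ι := Unit) (fun _ => S.tvRep m)
      (fun _ => S.tvRep_irreducible) (fun _ _ _ => rfl) fun _ => T
    have h := Submodule.mem_map_of_mem
      (f := LinearMap.proj (φ := fun _ : Unit => Module.End F (S.TV m)) ()) hspan
    rw [Submodule.map_span, ← Set.range_comp] at h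
    change T ∈ _ at h
    clear hspan
    induction h using Submodule.span_induction with
    | mem x hx => obtain ⟨g, rfl⟩ := hx; exact hΦ g
    | zero => intro v; simp
    | add x y _ _ hx hy => intro v; simp [hx, hy]
    | smul c x _ hx => intro v; simp [hx]
  have := S.tv_nontrivial (m := m)
  obtain ⟨w, hw⟩ := exists_ne (0 : S.TV m)
  obtain ⟨φ, hφ⟩ := Module.Projective.exists_dual_ne_zero F hw
  -- The operator `φ(·) v` sends `w` to `φ(w) v`. Commutation with it expresses `φ(w) Φ(v)` as `v`
  -- tensored with the contraction of `Φ(w)` by `φ`, a vector that does not depend on `v`.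
  refine ⟨(φ w)⁻¹ • TensorProduct.lid F U (φ.rTensor U (Φ w)), fun v => ?_⟩
  have h1 := hT (φ.smulRight v) w
  have h2 : ∀ y : S.TV m ⊗[F] U, S.opV m (φ.smulRight v) y =
      v ⊗ₜ TensorProduct.lid F U (φ.rTensor U y) := by
    intro y
    induction y with
    | zero => simp
    | tmul a b =>
      simp only [opV_tmul, LinearMap.smulRight_apply, LinearMap.rTensor_tmul,
        TensorProduct.lid_tmul, TensorProduct.tmul_smul, TensorProduct.smul_tmul']
    | add x y hx hy => simp only [map_add, hx, hy, TensorProduct.tmul_add]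
  rw [h2, LinearMap.smulRight_apply, map_smul] at h1
  rw [TensorProduct.tmul_smul, ← h1, smul_smul, inv_mul_cancel₀ hφ, one_smul]

end SimpleSystem

/-! ### Shuffles -/

namespace Comp

variable {r n : ℕ}

/-- The arrangements of the positions of a composition in which every block is in increasing
order; they index the cosets of the Young subgroup. -/
structure Shuffle (m : Comp r n) : Type where
  toEquiv : Fin n ≃ m.Pos
  lt : ∀ i j, i < j → (toEquiv i).1 = (toEquiv j).1 → (toEquiv i).2.val < (toEquiv j).2.val

variable {m : Comp r n}

instance : CoeFun m.Shuffle fun _ => Fin n → m.Pos := ⟨fun σ => σ.toEquiv⟩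

theorem Shuffle.toEquiv_injective : Function.Injective (Shuffle.toEquiv (m := m)) := by
  rintro ⟨σ, _⟩ ⟨τ, _⟩ h
  congr

instance : Finite m.Shuffle := Finite.of_injective _ Shuffle.toEquiv_injective

instance : Fintype m.Shuffle := Fintype.ofFinite _

instance : DecidableEq m.Shuffle := Classical.decEq _

theorem Shuffle.ext {σ τ : m.Shuffle} (h : ∀ i, σ i = τ i) : σ = τ :=
  Shuffle.toEquiv_injective (Equiv.ext h)

theorem pos_lt_iff {k : Fin r} {i j : Fin (m.part k)} :
    m.pos ⟨k, i⟩ < m.pos ⟨k, j⟩ ↔ i < j := by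
  refine ⟨fun h => ?_, m.pos_lt⟩
  by_contra h'
  rcases (not_lt.1 h').eq_or_lt with h' | h'
  · subst h'; exact lt_irrefl _ h
  · exact lt_asymm h (m.pos_lt h')

variable (m) in
/-- The standard arrangement. -/
def Shuffle.base : m.Shuffle := ⟨m.pos.symm, by
  intro i j hij h
  obtain ⟨⟨k, a⟩, rfl⟩ := m.pos.surjective i
  obtain ⟨⟨l, b⟩, rfl⟩ := m.pos.surjective j
  rw [Equiv.symm_apply_apply, Equiv.symm_apply_apply] at h ⊢
  subst h
  exact m.pos_lt_iff.1 hij⟩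

theorem Shuffle.lt_of_lt (σ : m.Shuffle) {i j : Fin n} (h : (σ i).1 = (σ j).1)
    (h' : (σ i).2.val < (σ j).2.val) : i < j := by
  by_contra hij
  rcases (not_lt.1 hij).eq_or_lt with hij | hij
  · subst hij; exact lt_irrefl _ h'
  · exact lt_asymm h' (σ.lt j i hij h.symm)

/-- Adjacent positions with the same letter are consecutive in their block. -/
theorem Shuffle.consecutive (σ : m.Shuffle) {i j : Fin n} (hij : i.val + 1 = j.val)
    (h : (σ i).1 = (σ j).1) : (σ i).2.val + 1 = (σ j).2.val := by
  have hlt := σ.lt i j (by rw [Fin.lt_def]; omega) h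
  by_contra hne
  have hb : (σ i).2.val + 1 < m.part (σ i).1 := by
    have := (σ j).2.isLt
    have h2 : m.part (σ i).1 = m.part (σ j).1 := by rw [h]
    omega
  -- Otherwise the entry that follows `σ i` in its block stands at a place `l` strictly between the
  -- adjacent places `i` and `j`.
  let l := σ.toEquiv.symm ⟨(σ i).1, ⟨(σ i).2.val + 1, hb⟩⟩
  have hl : σ l = ⟨(σ i).1, ⟨(σ i).2.val + 1, hb⟩⟩ := σ.toEquiv.apply_symm_apply _
  have h1 : i < l := σ.lt_of_lt (by rw [hl]) (by rw [hl]; simp)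
  have h2 : l < j := σ.lt_of_lt (by rw [hl]; exact h) (by rw [hl]; simp only; omega)
  rw [Fin.lt_def] at h1 h2
  omega

/-- Exchange of the entries in two adjacent positions with different letters. -/
def Shuffle.swap (σ : m.Shuffle) (i j : Fin n) (hij : i.val + 1 = j.val)
    (h : (σ i).1 ≠ (σ j).1) : m.Shuffle := ⟨(Equiv.swap i j).trans σ.toEquiv, by
  intro a b hab hs
  simp only [Equiv.trans_apply] at hs ⊢
  refine σ.lt _ _ ?_ hs
  rw [Fin.lt_def] at hab ⊢
  -- An adjacent transposition reverses the order of no pair except `(i, j)`, and these two entries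
  -- belong to different blocks.
  have hab' : ¬ (a = i ∧ b = j) := by
    rintro ⟨rfl, rfl⟩
    rw [Equiv.swap_apply_left, Equiv.swap_apply_right] at hs
    exact h hs.symm
  simp only [Fin.ext_iff] at hab'
  rw [Equiv.swap_apply_def, Equiv.swap_apply_def]
  simp only [Fin.ext_iff]
  split_ifs <;> omega⟩

theorem Shuffle.swap_apply (σ : m.Shuffle) (i j : Fin n) (hij : i.val + 1 = j.val)
    (h : (σ i).1 ≠ (σ j).1) (a : Fin n) : σ.swap i j hij h a = σ (Equiv.swap i j a) := rfl

theorem Shuffle.swap_left (σ : m.Shuffle) (i j : Fin n) (hij : i.val + 1 = j.val)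
    (h : (σ i).1 ≠ (σ j).1) : σ.swap i j hij h i = σ j := by
  rw [swap_apply, Equiv.swap_apply_left]

theorem Shuffle.swap_right (σ : m.Shuffle) (i j : Fin n) (hij : i.val + 1 = j.val)
    (h : (σ i).1 ≠ (σ j).1) : σ.swap i j hij h j = σ i := by
  rw [swap_apply, Equiv.swap_apply_right]

theorem Shuffle.swap_other (σ : m.Shuffle) (i j : Fin n) (hij : i.val + 1 = j.val)
    (h : (σ i).1 ≠ (σ j).1) {a : Fin n} (hi : a ≠ i) (hj : a ≠ j) :
    σ.swap i j hij h a = σ a := by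
  rw [swap_apply, Equiv.swap_apply_of_ne_of_ne hi hj]

theorem Shuffle.swap_letter (σ : m.Shuffle) (i j : Fin n) (hij : i.val + 1 = j.val)
    (h : (σ i).1 ≠ (σ j).1) : (σ.swap i j hij h i).1 ≠ (σ.swap i j hij h j).1 := by
  rw [swap_left, swap_right]; exact h.symm

theorem Shuffle.swap_swap (σ : m.Shuffle) (i j : Fin n) (hij : i.val + 1 = j.val)
    (h : (σ i).1 ≠ (σ j).1) (h') : (σ.swap i j hij h).swap i j hij h' = σ :=
  Shuffle.ext fun a => by rw [swap_apply, swap_apply, Equiv.swap_apply_self]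

theorem strictMono_of_adjacent {n : ℕ} {f : Fin n → Fin n}
    (hf : ∀ i j : Fin n, i.val + 1 = j.val → f i < f j) : StrictMono f := by
  cases n with
  | zero => exact fun i => i.elim0
  | succ n => exact Fin.strictMono_iff_lt_succ.2 fun i => hf _ _ (by simp)

/-- Every arrangement is obtained from the standard one by exchanging adjacent entries with
different letters. -/
theorem Shuffle.induction {P : m.Shuffle → Prop} (base : P (Shuffle.base m))
    (step : ∀ (σ : m.Shuffle) (i j) (hij : i.val + 1 = j.val) (h : (σ i).1 ≠ (σ j).1), P σ →
      P (σ.swap i j hij h)) (σ : m.Shuffle) : P σ := by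
  -- The weight `∑ a · pos (σ a)` is bounded and grows when an adjacent descent is removed, so the
  -- difference to its bound serves as the induction measure.
  let μ : m.Shuffle → ℕ := fun σ => ∑ a : Fin n, a.val * (m.pos (σ a)).val
  have hμ : ∀ σ, μ σ ≤ n * (n * n) := by
    intro σ
    calc μ σ ≤ ∑ a : Fin n, n * n :=
          Finset.sum_le_sum fun a _ => Nat.mul_le_mul a.isLt.le (m.pos (σ a)).isLt.le
      _ = n * (n * n) := by simp
  suffices ∀ d σ, n * (n * n) - μ σ = d → P σ from this _ σ rfl
  intro d
  induction d using Nat.strong_induction_on with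
  | _ d ih =>
    intro σ hd
    by_cases hdesc : ∃ i j : Fin n, i.val + 1 = j.val ∧ m.pos (σ j) < m.pos (σ i)
    · obtain ⟨i, j, hij, hlt⟩ := hdesc
      have hne : (σ i).1 ≠ (σ j).1 := by
        intro h
        have h1 := σ.lt i j (by rw [Fin.lt_def]; omega) h
        generalize σ i = p at *
        generalize σ j = q at *
        obtain ⟨k, a⟩ := p
        obtain ⟨l, b⟩ := q
        simp only at h
        subst h
        exact lt_asymm h1 (m.pos_lt_iff.1 hlt)
      have hne' : i ≠ j := by rintro rfl; omega
      have hlt' : μ σ < μ (σ.swap i j hij hne) := by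
        have e : ∀ τ : m.Shuffle, μ τ = i.val * (m.pos (τ i)).val + (j.val * (m.pos (τ j)).val +
            ∑ a ∈ (Finset.univ.erase i).erase j, a.val * (m.pos (τ a)).val) := by
          intro τ
          rw [Finset.add_sum_erase _ (fun a => a.val * (m.pos (τ a)).val)
            (Finset.mem_erase.2 ⟨hne'.symm, Finset.mem_univ _⟩),
            Finset.add_sum_erase _ (fun a => a.val * (m.pos (τ a)).val) (Finset.mem_univ i)]
        rw [e, e, swap_left, swap_right]
        have : ∑ a ∈ (Finset.univ.erase i).erase j, a.val * (m.pos (σ.swap i j hij hne a)).val =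
            ∑ a ∈ (Finset.univ.erase i).erase j, a.val * (m.pos (σ a)).val := by
          refine Finset.sum_congr rfl fun a ha => ?_
          simp only [Finset.mem_erase] at ha
          rw [swap_other _ _ _ _ _ ha.2.1 ha.1]
        rw [this, ← hij]
        rw [Fin.lt_def] at hlt
        have : (i.val + 1) * (m.pos (σ j)).val + i.val * (m.pos (σ i)).val <
          (i.val + 1) * (m.pos (σ i)).val + i.val * (m.pos (σ j)).val := by
          rw [add_mul, add_mul]; omega
        omega
      have := ih (n * (n * n) - μ (σ.swap i j hij hne)) (by
        have := hμ (σ.swap i j hij hne); omega) _ rfl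
      -- The induction hypothesis holds for the exchanged arrangement; exchanging again returns to
      -- `σ`.
      have := step _ i j hij (σ.swap_letter i j hij hne) this
      rwa [swap_swap] at this
    · push Not at hdesc
      -- Without descents the arrangement is an increasing bijection of `Fin n`, hence the identity.
      have hmono : StrictMono fun i => m.pos (σ i) := strictMono_of_adjacent fun i j hij =>
        lt_of_le_of_ne (hdesc i j hij) fun h => by
          have := σ.toEquiv.injective (m.pos.injective h)
          subst this; omega
      have hid : (fun i => m.pos (σ i)) = id := by
        refine (StrictMono.range_inj hmono strictMono_id).1 ?_
        rw [Set.range_id]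
        exact (σ.toEquiv.trans m.pos).surjective.range_eq
      have : σ = Shuffle.base m := Shuffle.ext fun i => by
        change _ = m.pos.symm i
        rw [Equiv.eq_symm_apply]
        exact congrFun hid i
      rw [this]
      exact base

theorem card_letter (σ : Fin n ≃ m.Pos) (k : Fin r) :
    (Finset.univ.filter fun i => (σ i).1 = k).card = m.part k := by
  have : (Finset.univ.filter fun i => (σ i).1 = k) =
      (Finset.univ : Finset (Fin (m.part k))).image fun a => σ.symm ⟨k, a⟩ := by
    ext i
    simp only [Finset.mem_filter, Finset.mem_univ, true_and, Finset.mem_image]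
    constructor
    · rintro rfl
      exact ⟨(σ i).2, σ.symm_apply_apply i⟩
    · rintro ⟨a, rfl⟩
      rw [Equiv.apply_symm_apply]
  rw [this, Finset.card_image_of_injective _ (f := fun a => σ.symm ⟨k, a⟩)
    (σ.symm.injective.comp sigma_mk_injective), Finset.card_univ, Fintype.card_fin]

/-- The part `m.part k` counts the places with letter `k`; hence summands of `𝓖(U)` for different
compositions share no simple `FG^n`-constituent. -/
theorem eq_of_letters {m' : Comp r n} (σ : Fin n ≃ m.Pos) (τ : Fin n ≃ m'.Pos)
    (h : ∀ i, (σ i).1 = (τ i).1) : m = m' := by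
  apply Comp.ext
  funext k
  rw [← card_letter σ, ← card_letter τ]
  simp only [h]

theorem pos_mk_cast (p : m.Pos) {k : Fin r} (h : p.1 = k) :
    (⟨k, Fin.cast (congrArg m.part h) p.2⟩ : m.Pos) = p := by
  subst h
  rfl

/-- Blocks are in increasing order, so the earlier places with the same letter are exactly those
holding the smaller indices of the block. -/
theorem Shuffle.rank (σ : m.Shuffle) (i : Fin n) :
    (Finset.univ.filter fun j => j < i ∧ (σ j).1 = (σ i).1).card = (σ i).2.val := by
  have : (Finset.univ.filter fun j => j < i ∧ (σ j).1 = (σ i).1) =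
      (Finset.Iio (σ i).2).image fun a => σ.toEquiv.symm ⟨(σ i).1, a⟩ := by
    ext j
    simp only [Finset.mem_filter, Finset.mem_univ, true_and, Finset.mem_image, Finset.mem_Iio]
    constructor
    · rintro ⟨hj, hl⟩
      have h1 := σ.lt j i hj hl
      refine ⟨Fin.cast (congrArg m.part hl) (σ j).2, h1, ?_⟩
      rw [Equiv.symm_apply_eq]
      exact pos_mk_cast _ hl
    · rintro ⟨a, ha, rfl⟩
      refine ⟨σ.lt_of_lt ?_ ?_, ?_⟩ <;> rw [Equiv.apply_symm_apply]
      exact ha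
  rw [this, Finset.card_image_of_injective _
    (f := fun a => σ.toEquiv.symm ⟨(σ i).1, a⟩)
    (σ.toEquiv.symm.injective.comp sigma_mk_injective), Fin.card_Iio]

/-- The index within a block is the rank among places with the same letter. Hence different
arrangements give non-isomorphic twists of `V(n̂)`. -/
theorem Shuffle.eq_of_letters (σ τ : m.Shuffle) (h : ∀ i, (σ i).1 = (τ i).1) : σ = τ := by
  refine Shuffle.ext fun i => ?_
  have h1 := σ.rank i
  have h2 := τ.rank i
  simp only [h] at h1
  have h3 := h i
  have h4 := h1.symm.trans h2
  clear h1 h2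
  generalize σ.toEquiv i = p at *
  generalize τ.toEquiv i = q at *
  obtain ⟨k, a⟩ := p
  obtain ⟨l, b⟩ := q
  simp only at h3
  subst h3
  exact congrArg (Sigma.mk k) (Fin.ext h4)

end Comp

namespace SimpleSystem

variable {F : Type u} [Field F] [IsAlgClosed F] {G : Type u} [Group G] [Fintype G] {r n : ℕ}
  (S : SimpleSystem F G r) {m : Comp r n} {U : Type u} [AddCommGroup U] [Module F U]
  (δ : S.APar m →ₐ[F] Module.End F U)

/-! ### Operators on `V(n̂) ⊗ U` indexed by positions -/

theorem tenS_tenS {k l : Fin r} (hkl : k ≠ l) (i j h i' j' h') :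
    Commute (S.tenS δ k i j h) (S.tenS (m := m) δ l i' j' h') := by
  have := S.tenBlock_commute δ hkl (WrHecke.s i j h) (WrHecke.s i' j' h')
  simpa only [tenBlock, WrHecke.lift_s] using this

theorem tenS_tenX {k l : Fin r} (hkl : k ≠ l) (i j h i') :
    Commute (S.tenS δ k i j h) (S.tenX (m := m) δ l i') := by
  have := S.tenBlock_commute δ hkl (WrHecke.s i j h) (WrHecke.x i')
  simpa only [tenBlock, WrHecke.lift_s, WrHecke.lift_x] using this

theorem tenX_tenX {k l : Fin r} (i i') :
    Commute (S.tenX (m := m) δ k i) (S.tenX δ l i') := by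
  by_cases hkl : k = l
  · subst hkl
    exact (S.ten_relations δ k).xx i i'
  · have := S.tenBlock_commute δ hkl (WrHecke.x i) (WrHecke.x i')
    simpa only [tenBlock, WrHecke.lift_x] using this

theorem tenS_opV_tvRep (k : Fin r) (i j : Fin (m.part k)) (h : i.val + 1 = j.val)
    (c : Fin n → G) :
    S.tenS δ k i j h * S.opV m (S.tvRep m c) =
      S.opV m (S.tvRep m fun a => c (Equiv.swap (m.pos ⟨k, i⟩) (m.pos ⟨k, j⟩) a)) *
        S.tenS δ k i j h := by
  rw [tenS, mul_assoc, ← (S.opV_opU m δ _ k _).eq, ← mul_assoc, ← mul_assoc, ← map_mul,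
    ← map_mul, S.flip_tvRep_end]

open scoped Classical in
/-- The operator of a simple reflection on `V(n̂) ⊗ U`, indexed by two consecutive positions of a
block. -/
def tenSPos (q q' : m.Pos) : Module.End F (S.TV m ⊗[F] U) :=
  if h : ∃ _ : q'.1 = q.1, q.2.val + 1 = q'.2.val then
    S.tenS δ q.1 q.2 (Fin.cast (congrArg m.part h.1) q'.2) h.2 else 0

theorem tenSPos_mk (k : Fin r) (i j : Fin (m.part k)) (h : i.val + 1 = j.val) :
    S.tenSPos δ ⟨k, i⟩ ⟨k, j⟩ = S.tenS δ k i j h := by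
  rw [tenSPos, dif_pos ⟨rfl, h⟩]
  rfl

/-- Consecutive positions in a block. -/
def _root_.WreathMorita.Comp.Consec (q q' : m.Pos) : Prop :=
  ∃ (k : Fin r) (i j : Fin (m.part k)), i.val + 1 = j.val ∧ q = ⟨k, i⟩ ∧ q' = ⟨k, j⟩

theorem _root_.WreathMorita.Comp.Shuffle.consec (σ : m.Shuffle) {i j : Fin n}
    (hij : i.val + 1 = j.val) (h : (σ i).1 = (σ j).1) : Comp.Consec (σ i) (σ j) :=
  ⟨(σ j).1, Fin.cast (congrArg m.part h) (σ i).2, (σ j).2, σ.consecutive hij h,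
    (Comp.pos_mk_cast _ h).symm, rfl⟩

theorem tenSPos_sq {q q' : m.Pos} (h : Comp.Consec q q') :
    S.tenSPos δ q q' * S.tenSPos δ q q' = 1 := by
  obtain ⟨k, i, j, h, rfl, rfl⟩ := h
  rw [tenSPos_mk _ _ _ _ _ h, (S.ten_relations δ k).ss]

theorem tenSPos_comm {q q' p p' : m.Pos} (h : Comp.Consec q q') (h' : Comp.Consec p p')
    (hlt : q'.1 = p.1 → q'.2.val < p.2.val) :
    S.tenSPos δ q q' * S.tenSPos δ p p' = S.tenSPos δ p p' * S.tenSPos δ q q' := by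
  obtain ⟨k, i, j, h, rfl, rfl⟩ := h
  obtain ⟨l, i', j', h', rfl, rfl⟩ := h'
  rw [tenSPos_mk _ _ _ _ _ h, tenSPos_mk _ _ _ _ _ h']
  by_cases hkl : k = l
  · subst hkl
    exact (S.ten_relations δ k).comm _ _ _ _ _ _ (hlt rfl)
  · exact S.tenS_tenS δ hkl _ _ _ _ _ _

theorem tenSPos_braid {q q' q'' : m.Pos} (h : Comp.Consec q q') (h' : Comp.Consec q' q'') :
    S.tenSPos δ q q' * S.tenSPos δ q' q'' * S.tenSPos δ q q' =
      S.tenSPos δ q' q'' * S.tenSPos δ q q' * S.tenSPos δ q' q'' := by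
  obtain ⟨k, i, j, h, rfl, rfl⟩ := h
  obtain ⟨l, i', j', h', e, rfl⟩ := h'
  obtain ⟨rfl, e⟩ := Sigma.mk.inj_iff.1 e
  obtain rfl := eq_of_heq e
  rw [tenSPos_mk _ _ _ _ _ h, tenSPos_mk _ _ _ _ _ h', (S.ten_relations δ k).braid]

theorem tenSPos_tenX {q q' : m.Pos} (h : Comp.Consec q q') :
    S.tenSPos δ q q' * S.tenX δ q.1 q.2 = S.tenX δ q'.1 q'.2 * S.tenSPos δ q q' -
      ∑ c : G, S.opV m (S.tvRep m (antiDiag (m.pos q) (m.pos q') c)) := by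
  obtain ⟨k, i, j, h, rfl, rfl⟩ := h
  rw [tenSPos_mk _ _ _ _ _ h, (S.ten_relations δ k).sx]
  congr 1
  refine Finset.sum_congr rfl fun c _ => ?_
  rw [← m.incl_antiDiag]
  rfl

theorem tenSPos_tenX' {q q' p : m.Pos} (h : Comp.Consec q q') (hq : p ≠ q) (hq' : p ≠ q') :
    S.tenSPos δ q q' * S.tenX δ p.1 p.2 = S.tenX δ p.1 p.2 * S.tenSPos δ q q' := by
  obtain ⟨k, i, j, h, rfl, rfl⟩ := h
  obtain ⟨l, a⟩ := p
  rw [tenSPos_mk _ _ _ _ _ h]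
  by_cases hkl : k = l
  · subst hkl
    exact (S.ten_relations δ k).sx' _ _ _ _ (by rintro rfl; exact hq rfl)
      (by rintro rfl; exact hq' rfl)
  · exact S.tenS_tenX δ hkl _ _ _ _

theorem tenSPos_opV {q q' : m.Pos} (h : Comp.Consec q q') (c : Fin n → G) :
    S.tenSPos δ q q' * S.opV m (S.tvRep m c) =
      S.opV m (S.tvRep m (c ∘ Equiv.swap (m.pos q) (m.pos q'))) * S.tenSPos δ q q' := by
  obtain ⟨k, i, j, h, rfl, rfl⟩ := h
  rw [tenSPos_mk _ _ _ _ _ h, tenS_opV_tvRep]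
  rfl

/-! ### The model of the induced module -/

/-- The space underlying the model of the induced module: one copy of `V(n̂) ⊗ U` for every
arrangement. -/
abbrev Model (m : Comp r n) (U : Type u) [AddCommGroup U] [Module F U] : Type u :=
  m.Shuffle → S.TV m ⊗[F] U

/-- The permutation of the positions defined by an arrangement. -/
def _root_.WreathMorita.Comp.Shuffle.toPerm (σ : m.Shuffle) : Equiv.Perm (Fin n) :=
  σ.toEquiv.trans m.pos

/-- The action of `G^n` on the model. -/
def modelG : (Fin n → G) →* Module.End F (S.Model m U) where
  toFun c := LinearMap.pi fun σ =>
    S.opV m (S.tvRep m (c ∘ σ.toPerm.symm)) ∘ₗ LinearMap.proj σ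
  map_one' := by
    refine LinearMap.ext fun ξ => funext fun σ => ?_
    change S.opV m (S.tvRep m 1) (ξ σ) = ξ σ
    rw [map_one, map_one, Module.End.one_apply]
  map_mul' c c' := by
    refine LinearMap.ext fun ξ => funext fun σ => ?_
    change S.opV m (S.tvRep m ((c ∘ σ.toPerm.symm) * (c' ∘ σ.toPerm.symm))) (ξ σ) = _
    rw [map_mul, map_mul]
    rfl

theorem modelG_apply (c : Fin n → G) (ξ : S.Model m U) (σ : m.Shuffle) :
    S.modelG c ξ σ = S.opV m (S.tvRep m (c ∘ σ.toPerm.symm)) (ξ σ) := rfl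

/-- The action of `x_j` on the model. -/
def modelX (j : Fin n) : Module.End F (S.Model m U) :=
  LinearMap.pi fun σ => S.tenX δ (σ j).1 (σ j).2 ∘ₗ LinearMap.proj σ

theorem modelX_apply (j : Fin n) (ξ : S.Model m U) (σ : m.Shuffle) :
    S.modelX δ j ξ σ = S.tenX δ (σ j).1 (σ j).2 (ξ σ) := rfl

/-- The action of `s_i` on the model. -/
def modelS (i j : Fin n) (hij : i.val + 1 = j.val) : Module.End F (S.Model m U) :=
  LinearMap.pi fun σ =>
    -- With equal letters the two entries are consecutive in their block, and `s_i` acts inside the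
    -- copy as a generator of the Young subgroup. With different letters it exchanges two copies.
    if h : (σ i).1 = (σ j).1 then S.tenSPos δ (σ i) (σ j) ∘ₗ LinearMap.proj σ
    else LinearMap.proj (σ.swap i j hij h)

theorem modelS_same {i j : Fin n} (hij : i.val + 1 = j.val) (ξ : S.Model m U) (σ : m.Shuffle)
    (h : (σ i).1 = (σ j).1) :
    S.modelS δ i j hij ξ σ = S.tenSPos δ (σ i) (σ j) (ξ σ) := by
  rw [modelS, LinearMap.pi_apply, dif_pos h]
  rfl

theorem modelS_diff {i j : Fin n} (hij : i.val + 1 = j.val) (ξ : S.Model m U) (σ : m.Shuffle)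
    (h : (σ i).1 ≠ (σ j).1) : S.modelS δ i j hij ξ σ = ξ (σ.swap i j hij h) := by
  rw [modelS, LinearMap.pi_apply, dif_neg h]
  rfl

theorem model_ss (i j : Fin n) (hij : i.val + 1 = j.val) :
    S.modelS (m := m) δ i j hij * S.modelS δ i j hij = 1 := by
  refine LinearMap.ext fun ξ => funext fun σ => ?_
  rw [Module.End.mul_apply, Module.End.one_apply]
  by_cases h : (σ i).1 = (σ j).1
  · rw [modelS_same _ _ _ _ _ h, modelS_same _ _ _ _ _ h, ← Module.End.mul_apply,
      S.tenSPos_sq δ (σ.consec hij h), Module.End.one_apply]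
  · rw [modelS_diff _ _ _ _ _ h, modelS_diff _ _ _ _ _ (σ.swap_letter i j hij h),
      Comp.Shuffle.swap_swap]

theorem model_comm (i j k l : Fin n) (h : i.val + 1 = j.val) (h' : k.val + 1 = l.val)
    (hjk : j < k) :
    S.modelS (m := m) δ i j h * S.modelS δ k l h' = S.modelS δ k l h' * S.modelS δ i j h := by
  refine LinearMap.ext fun ξ => funext fun σ => ?_
  rw [Module.End.mul_apply, Module.End.mul_apply]
  rw [Fin.lt_def] at hjk
  have ik : i ≠ k := by rintro rfl; omega
  have il : i ≠ l := by rintro rfl; omega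
  have jk : j ≠ k := by rintro rfl; omega
  have jl : j ≠ l := by rintro rfl; omega
  by_cases hs : (σ i).1 = (σ j).1 <;> by_cases hs' : (σ k).1 = (σ l).1
  · rw [modelS_same _ _ _ _ _ hs, modelS_same _ _ _ _ _ hs', modelS_same _ _ _ _ _ hs',
      modelS_same _ _ _ _ _ hs, ← Module.End.mul_apply, ← Module.End.mul_apply,
      S.tenSPos_comm δ (σ.consec h hs) (σ.consec h' hs') (σ.lt j k hjk)]
  · have e1 := σ.swap_other k l h' hs' ik il
    have e2 := σ.swap_other k l h' hs' jk jl
    rw [modelS_same _ _ _ _ _ hs, modelS_diff _ _ _ _ _ hs', modelS_diff _ _ _ _ _ hs',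
      modelS_same _ _ _ _ _ (by rwa [e1, e2]), e1, e2]
  · have e1 := σ.swap_other i j h hs ik.symm jk.symm
    have e2 := σ.swap_other i j h hs il.symm jl.symm
    rw [modelS_same _ _ _ _ _ hs', modelS_diff _ _ _ _ _ hs, modelS_diff _ _ _ _ _ hs,
      modelS_same _ _ _ _ _ (by rwa [e1, e2]), e1, e2]
  · have e1 := σ.swap_other i j h hs ik.symm jk.symm
    have e2 := σ.swap_other i j h hs il.symm jl.symm
    have e3 := σ.swap_other k l h' hs' ik il
    have e4 := σ.swap_other k l h' hs' jk jl
    rw [modelS_diff _ _ _ _ _ hs, modelS_diff _ _ _ _ _ hs', modelS_diff _ _ _ _ _ (by rwa [e1, e2]),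
      modelS_diff _ _ _ _ _ (by rwa [e3, e4])]
    congr 1
    refine Comp.Shuffle.ext fun a => ?_
    simp only [Comp.Shuffle.swap_apply]
    congr 1
    have : Commute (Equiv.swap i j) (Equiv.swap k l) := by
      apply Equiv.Perm.Disjoint.commute
      intro a
      by_cases ha : a = i ∨ a = j
      · right
        apply Equiv.swap_apply_of_ne_of_ne <;> rintro rfl <;> rcases ha with rfl | rfl <;>
          contradiction
      · left
        exact Equiv.swap_apply_of_ne_of_ne (fun h => ha (Or.inl h)) (fun h => ha (Or.inr h))
    exact congrArg (fun w : Equiv.Perm (Fin n) => w a) this.eq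

/-- The cases are the possible coincidences among three letters. If all agree, this is the braid
relation within a block. If exactly two agree, both sides lead to the same copy with one block
reflection applied. If none agree, it is the braid relation for permutations of places. -/
theorem model_braid (i j l : Fin n) (h : i.val + 1 = j.val) (h' : j.val + 1 = l.val) :
    S.modelS (m := m) δ i j h * S.modelS δ j l h' * S.modelS δ i j h =
      S.modelS δ j l h' * S.modelS δ i j h * S.modelS δ j l h' := by
  refine LinearMap.ext fun ξ => funext fun σ => ?_
  simp only [Module.End.mul_apply]
  have ij : i ≠ j := by rintro rfl; omega
  have il : i ≠ l := by rintro rfl; omega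
  have jl : j ≠ l := by rintro rfl; omega
  have left : ∀ hs : (σ i).1 ≠ (σ j).1, σ.swap i j h hs i = σ j ∧ σ.swap i j h hs j = σ i ∧
      σ.swap i j h hs l = σ l := fun hs =>
    ⟨σ.swap_left _ _ _ _, σ.swap_right _ _ _ _, σ.swap_other _ _ _ _ il.symm jl.symm⟩
  have right : ∀ hs : (σ j).1 ≠ (σ l).1, σ.swap j l h' hs i = σ i ∧ σ.swap j l h' hs j = σ l ∧
      σ.swap j l h' hs l = σ j := fun hs =>
    ⟨σ.swap_other _ _ _ _ ij il, σ.swap_left _ _ _ _, σ.swap_right _ _ _ _⟩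
  by_cases hs : (σ i).1 = (σ j).1 <;> by_cases hs' : (σ j).1 = (σ l).1
  · rw [modelS_same _ _ _ _ _ hs, modelS_same _ _ _ _ _ hs', modelS_same _ _ _ _ _ hs,
      modelS_same _ _ _ _ _ hs', modelS_same _ _ _ _ _ hs, modelS_same _ _ _ _ _ hs']
    simp only [← Module.End.mul_apply, ← mul_assoc]
    rw [S.tenSPos_braid δ (σ.consec h hs) (σ.consec h' hs')]
  · obtain ⟨e1, e2, e3⟩ := right hs'
    have d : (σ.swap j l h' hs' i).1 ≠ (σ.swap j l h' hs' j).1 := by rw [e1, e2, hs]; exact hs'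
    rw [modelS_same _ _ _ _ _ hs, modelS_diff _ _ _ _ _ hs', modelS_diff _ _ _ _ _ d,
      modelS_diff _ _ _ _ _ hs', modelS_diff _ _ _ _ _ d]
    have f1 := (σ.swap j l h' hs').swap_right i j h d
    have f2 := (σ.swap j l h' hs').swap_other i j h d il.symm jl.symm
    rw [e1] at f1
    rw [e3] at f2
    rw [modelS_same _ _ _ _ _ (by rwa [f1, f2]), f1, f2]
  · obtain ⟨e1, e2, e3⟩ := left hs
    have d : (σ.swap i j h hs j).1 ≠ (σ.swap i j h hs l).1 := by rw [e2, e3, ← hs']; exact hs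
    rw [modelS_same _ _ _ _ _ hs', modelS_diff _ _ _ _ _ hs, modelS_diff _ _ _ _ _ d,
      modelS_diff _ _ _ _ _ hs, modelS_diff _ _ _ _ _ d]
    have f1 := (σ.swap i j h hs).swap_other j l h' d ij il
    have f2 := (σ.swap i j h hs).swap_left j l h' d
    rw [e1] at f1
    rw [e3] at f2
    rw [modelS_same _ _ _ _ _ (by rwa [f1, f2]), f1, f2]
  · obtain ⟨e1, e2, e3⟩ := left hs
    obtain ⟨e4, e5, e6⟩ := right hs'
    rw [modelS_diff _ _ _ _ _ hs, modelS_diff _ _ _ _ _ hs']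
    by_cases ht : (σ i).1 = (σ l).1
    · have d : (σ.swap i j h hs j).1 = (σ.swap i j h hs l).1 := by rwa [e2, e3]
      have d' : (σ.swap j l h' hs' i).1 = (σ.swap j l h' hs' j).1 := by rwa [e4, e5]
      rw [modelS_same _ _ _ _ _ d, modelS_same _ _ _ _ _ d', e2, e3, e4, e5, modelS_diff _ _ _ _ _ (σ.swap_letter i j h hs),
        modelS_diff _ _ _ _ _ (σ.swap_letter j l h' hs'), Comp.Shuffle.swap_swap,
        Comp.Shuffle.swap_swap]
    · have d : (σ.swap i j h hs j).1 ≠ (σ.swap i j h hs l).1 := by rwa [e2, e3]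
      have d' : (σ.swap j l h' hs' i).1 ≠ (σ.swap j l h' hs' j).1 := by rwa [e4, e5]
      rw [modelS_diff _ _ _ _ _ d, modelS_diff _ _ _ _ _ d']
      have f1 := (σ.swap i j h hs).swap_other j l h' d ij il
      have f2 := (σ.swap i j h hs).swap_left j l h' d
      have f3 := (σ.swap j l h' hs').swap_right i j h d'
      have f4 := (σ.swap j l h' hs').swap_other i j h d' il.symm jl.symm
      rw [e1] at f1
      rw [e3] at f2
      rw [e4] at f3
      rw [e6] at f4
      rw [modelS_diff _ _ _ _ _ (by rwa [f1, f2]), modelS_diff _ _ _ _ _ (by rwa [f3, f4])]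
      congr 1
      refine Comp.Shuffle.ext fun a => ?_
      simp only [Comp.Shuffle.swap_apply]
      congr 1
      have h1 := Equiv.swap_mul_swap_mul_swap (x := l) (y := j) (z := i) jl.symm il.symm
      have h2 := Equiv.swap_mul_swap_mul_swap (x := i) (y := j) (z := l) ij il
      rw [Equiv.swap_comm l j, Equiv.swap_comm j i] at h1
      exact congrArg (fun w : Equiv.Perm (Fin n) => w a)
        (h1.trans ((Equiv.swap_comm _ _).trans h2.symm))

theorem comp_swap_toPerm_symm (σ : m.Shuffle) (i j : Fin n) (c : Fin n → G) :
    (fun k => c (Equiv.swap i j k)) ∘ σ.toPerm.symm =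
      (c ∘ σ.toPerm.symm) ∘ Equiv.swap (m.pos (σ i)) (m.pos (σ j)) := by
  funext a
  obtain ⟨b, rfl⟩ := σ.toPerm.surjective a
  change c (Equiv.swap i j (σ.toPerm.symm (σ.toPerm b))) =
    c (σ.toPerm.symm (Equiv.swap (σ.toPerm i) (σ.toPerm j) (σ.toPerm b)))
  rw [σ.toPerm.injective.swap_apply, Equiv.symm_apply_apply, Equiv.symm_apply_apply]

theorem comp_toPerm_swap_symm (σ : m.Shuffle) (i j : Fin n) (hij : i.val + 1 = j.val)
    (h : (σ i).1 ≠ (σ j).1) (c : Fin n → G) :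
    c ∘ (σ.swap i j hij h).toPerm.symm = (fun k => c (Equiv.swap i j k)) ∘ σ.toPerm.symm := by
  rfl

/-- Each relation is checked at one arrangement, split by whether the letters at `i` and `i + 1`
agree. Equal letters reduce to the relations on `V(n̂) ⊗ U`. -/
theorem model_relations : WrHecke.Relations (B := Module.End F (S.Model m U))
    (S.modelG (m := m)) (S.modelS δ)
    (S.modelX δ) where
  xx i j := LinearMap.ext fun ξ => funext fun σ => by
    simp only [Module.End.mul_apply, modelX_apply]
    rw [← Module.End.mul_apply, ← Module.End.mul_apply, (S.tenX_tenX δ _ _).eq]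
  xg i c := LinearMap.ext fun ξ => funext fun σ => by
    simp only [Module.End.mul_apply, modelX_apply, modelG_apply]
    rw [← Module.End.mul_apply, ← Module.End.mul_apply]
    exact congrArg (fun T : Module.End F (S.TV m ⊗[F] U) => T (ξ σ))
      ((S.opV_opU m δ _ _ _).smul_right _).symm.eq
  ss := S.model_ss δ
  comm := S.model_comm δ
  braid := S.model_braid δ
  sx i j h := LinearMap.ext fun ξ => funext fun σ => by
    simp only [Module.End.mul_apply, LinearMap.sub_apply, LinearMap.sum_apply, Pi.sub_apply,
      Finset.sum_apply, modelX_apply, modelG_apply]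
    have hd : ∀ c : G, antiDiag i j c ∘ σ.toPerm.symm =
        antiDiag (m.pos (σ i)) (m.pos (σ j)) c := antiDiag_comp_symm σ.toPerm i j
    simp only [hd]
    by_cases hs : (σ i).1 = (σ j).1
    · rw [modelS_same _ _ _ _ _ hs, modelS_same _ _ _ _ _ hs, modelX_apply,
        ← Module.End.mul_apply, S.tenSPos_tenX δ (σ.consec h hs), LinearMap.sub_apply,
        LinearMap.sum_apply]
      rfl
    -- For different letters `t_{i,i+1}` acts by zero on this copy, and the relation says only that
    -- the exchange of copies carries the action of `x_i` to that of `x_{i+1}`.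
    · rw [modelS_diff _ _ _ _ _ hs, modelS_diff _ _ _ _ _ hs, modelX_apply,
        Comp.Shuffle.swap_left, ← LinearMap.sum_apply, ← map_sum, S.sum_antiDiag_ne hs, map_zero,
        LinearMap.zero_apply, sub_zero]
  sx' i j k h hi hj := LinearMap.ext fun ξ => funext fun σ => by
    simp only [Module.End.mul_apply, modelX_apply]
    by_cases hs : (σ i).1 = (σ j).1
    · rw [modelS_same _ _ _ _ _ hs, modelS_same _ _ _ _ _ hs, modelX_apply,
        ← Module.End.mul_apply, S.tenSPos_tenX' δ (σ.consec h hs)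
          (fun e => hi (σ.toEquiv.injective e)) (fun e => hj (σ.toEquiv.injective e))]
      rfl
    · rw [modelS_diff _ _ _ _ _ hs, modelS_diff _ _ _ _ _ hs, modelX_apply,
        Comp.Shuffle.swap_other _ _ _ _ _ hi hj]
  sg i j h c := LinearMap.ext fun ξ => funext fun σ => by
    simp only [Module.End.mul_apply, modelG_apply]
    by_cases hs : (σ i).1 = (σ j).1
    · rw [modelS_same _ _ _ _ _ hs, modelS_same _ _ _ _ _ hs, modelG_apply,
        ← Module.End.mul_apply, S.tenSPos_opV δ (σ.consec h hs), comp_swap_toPerm_symm]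
      rfl
    · rw [modelS_diff _ _ _ _ _ hs, modelS_diff _ _ _ _ _ hs, modelG_apply,
        comp_toPerm_swap_symm]

/-- The action of the wreath Hecke algebra on the model. -/
def modelAct : WrHecke F G n →ₐ[F] Module.End F (S.Model m U) :=
  WrHecke.lift (B := Module.End F (S.Model m U)) _ _ _ (S.model_relations δ)

end SimpleSystem

namespace SimpleSystem

variable {F : Type u} [Field F] [IsAlgClosed F] {G : Type u} [Group G] [Fintype G] {r n : ℕ}
  (S : SimpleSystem F G r) {m : Comp r n} {U : Type u} [AddCommGroup U] [Module F U]
  (δ : S.APar m →ₐ[F] Module.End F U)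

/-! ### The action on elements supported on one arrangement -/

theorem toPerm_base : (Comp.Shuffle.base m).toPerm = 1 :=
  Equiv.ext fun i => m.pos.apply_symm_apply i

theorem toPerm_swap_inv (σ : m.Shuffle) (i j : Fin n) (hij : i.val + 1 = j.val)
    (h : (σ i).1 ≠ (σ j).1) :
    (σ.swap i j hij h).toPerm⁻¹ = Equiv.swap i j * σ.toPerm⁻¹ := rfl

theorem swap_mul_toPerm_inv (σ : m.Shuffle) (i j : Fin n) :
    Equiv.swap i j * σ.toPerm⁻¹ = σ.toPerm⁻¹ * Equiv.swap (m.pos (σ i)) (m.pos (σ j)) := by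
  have := Equiv.mul_swap_eq_swap_mul (f := σ.toPerm⁻¹) (m.pos (σ i)) (m.pos (σ j))
  rw [this]
  congr 2
  · exact (σ.toPerm.symm_apply_apply i).symm
  · exact (σ.toPerm.symm_apply_apply j).symm

/-- The element of the model with the single entry `w` at the arrangement `σ`. -/
abbrev modelSingle (σ : m.Shuffle) : S.TV m ⊗[F] U →ₗ[F] S.Model m U :=
  LinearMap.single F (fun _ : m.Shuffle => S.TV m ⊗[F] U) σ

theorem modelG_single (c : Fin n → G) (σ : m.Shuffle) (w : S.TV m ⊗[F] U) :
    S.modelG c (S.modelSingle σ w) =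
      S.modelSingle σ (S.opV m (S.tvRep m (c ∘ σ.toPerm.symm)) w) := by
  funext τ
  rw [modelG_apply]
  by_cases h : τ = σ
  · subst h
    simp
  · simp [h]

theorem modelX_single (j : Fin n) (σ : m.Shuffle) (w : S.TV m ⊗[F] U) :
    S.modelX δ j (S.modelSingle σ w) = S.modelSingle σ (S.tenX δ (σ j).1 (σ j).2 w) := by
  funext τ
  rw [modelX_apply]
  by_cases h : τ = σ
  · subst h
    simp
  · simp [h]

theorem modelS_single_diff {i j : Fin n} (hij : i.val + 1 = j.val) (σ : m.Shuffle)
    (h : (σ i).1 ≠ (σ j).1) (w : S.TV m ⊗[F] U) :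
    S.modelS δ i j hij (S.modelSingle σ w) = S.modelSingle (σ.swap i j hij h) w := by
  funext τ
  by_cases hs : (τ i).1 = (τ j).1
  · have h1 : τ ≠ σ := by rintro rfl; exact h hs
    have h2 : τ ≠ σ.swap i j hij h := by rintro rfl; exact σ.swap_letter i j hij h hs
    rw [modelS_same _ _ _ _ _ hs]
    simp [h1, h2]
  · rw [modelS_diff _ _ _ _ _ hs]
    by_cases h1 : τ = σ.swap i j hij h
    · subst h1
      simp only [Comp.Shuffle.swap_swap]
      simp
    · have h2 : τ.swap i j hij hs ≠ σ := by
        rintro rfl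
        exact h1 (by rw [Comp.Shuffle.swap_swap])
      simp [h1, h2]

theorem modelS_single_same {i j : Fin n} (hij : i.val + 1 = j.val) (σ : m.Shuffle)
    (h : (σ i).1 = (σ j).1) (w : S.TV m ⊗[F] U) :
    S.modelS δ i j hij (S.modelSingle σ w) = S.modelSingle σ (S.tenSPos δ (σ i) (σ j) w) := by
  funext τ
  by_cases hs : (τ i).1 = (τ j).1
  · rw [modelS_same _ _ _ _ _ hs]
    by_cases h1 : τ = σ
    · subst h1; simp
    · simp [h1]
  · have h1 : τ ≠ σ := by rintro rfl; exact hs h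
    have h2 : τ.swap i j hij hs ≠ σ := by rintro rfl; exact τ.swap_letter i j hij hs h
    rw [modelS_diff _ _ _ _ _ hs]
    simp [h1, h2]

theorem modelAct_g (c : Fin n → G) : S.modelAct (m := m) δ (WrHecke.g c) = S.modelG c :=
  WrHecke.lift_g (B := Module.End F (S.Model m U)) _ _ _ _ _

theorem modelAct_s (i j : Fin n) (h : i.val + 1 = j.val) :
    S.modelAct (m := m) δ (WrHecke.s i j h) = S.modelS δ i j h :=
  WrHecke.lift_s (B := Module.End F (S.Model m U)) _ _ _ _ _ _ _

theorem modelAct_x (j : Fin n) : S.modelAct (m := m) δ (WrHecke.x j) = S.modelX δ j :=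
  WrHecke.lift_x (B := Module.End F (S.Model m U)) _ _ _ _ _

/-- The permutations `σ.toPerm⁻¹` act as coset representatives. Along a chain of exchanges of
different letters each `s_i` only moves the support, so no vector of `V(n̂) ⊗ U` is altered. -/
theorem modelAct_perm (σ : m.Shuffle) (w : S.TV m ⊗[F] U) :
    S.modelAct δ (WrHecke.perm σ.toPerm⁻¹) (S.modelSingle (Comp.Shuffle.base m) w) =
      S.modelSingle σ w := by
  induction σ using Comp.Shuffle.induction with
  | base => rw [toPerm_base, inv_one, map_one, map_one, Module.End.one_apply]
  | step σ i j hij h ih =>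
    rw [toPerm_swap_inv, map_mul, map_mul, Module.End.mul_apply, ih, WrHecke.perm_swap i j hij,
      modelAct_s, S.modelS_single_diff δ hij σ h]

theorem base_pos (q : m.Pos) : Comp.Shuffle.base m (m.pos q) = q := m.pos.symm_apply_apply q

/-- The inclusion at the standard arrangement is a homomorphism over the parabolic subalgebra. -/
theorem modelSingle_base (b : ParHecke F G m) (w : S.TV m ⊗[F] U) :
    S.modelSingle (Comp.Shuffle.base m) (S.tenAct δ b w) =
      S.modelAct δ (parHom m b) (S.modelSingle (Comp.Shuffle.base m) w) := by
  suffices b ∈ intertwined (S.tenAct δ) ((S.modelAct δ).comp (parHom m))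
    (S.modelSingle (Comp.Shuffle.base m)) from this w
  apply tensor_induct
  intro k a w
  simp only [tenAct, tensorLift_single, AlgHom.comp_apply, parHom]
  suffices a ∈ intertwined (S.tenBlock δ k) ((S.modelAct δ).comp (blockHom m k))
    (S.modelSingle (Comp.Shuffle.base m)) from this w
  apply WrHecke.induct
  · intro c w
    simp only [tenBlock, WrHecke.lift_g, AlgHom.comp_apply, blockHom, MonoidHom.comp_apply]
    rw [modelAct_g, modelG_single, toPerm_base]
    rfl
  · intro i j h w
    simp only [tenBlock, WrHecke.lift_s, AlgHom.comp_apply, blockHom]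
    rw [modelAct_s, modelS_single_same, base_pos, base_pos, tenSPos_mk]
    rw [base_pos, base_pos]
  · intro i w
    simp only [tenBlock, WrHecke.lift_x, AlgHom.comp_apply, blockHom]
    rw [modelAct_x, modelX_single, base_pos]

/-! ### The universal property of the model -/

section

variable {S δ} {M : Type u} [AddCommGroup M] [Module F M] {α : WrHecke F G n →ₐ[F] Module.End F M}
  {f : S.TV m ⊗[F] U →ₗ[F] M}
  (hf : ∀ b w, f (S.tenAct δ b w) = α (parHom m b) (f w))

include hf in
theorem parabolic_block (k : Fin r) (a : WrHecke F G (m.part k)) (w : S.TV m ⊗[F] U) :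
    f (S.tenBlock δ k a w) = α (blockHom m k a) (f w) := by
  have := hf (PiTensorProduct.singleAlgHom (R := F) (A := fun k => WrHecke F G (m.part k)) k a) w
  simpa only [tenAct, parHom, tensorLift_single] using this

-- The factors `G^{n_k}` lie in the single tensor factors of the parabolic algebra, and together
-- they generate `G^n`.
include hf in
theorem parabolic_g (c : Fin n → G) (w : S.TV m ⊗[F] U) :
    f (S.opV m (S.tvRep m c) w) = α (WrHecke.g c) (f w) := by
  let P : Submonoid (Fin n → G) :=
    { carrier := {c | ∀ w, f (S.opV m (S.tvRep m c) w) = α (WrHecke.g c) (f w)}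
      one_mem' := fun w => by rw [map_one, map_one, map_one, map_one]; rfl
      mul_mem' := fun {c d} hc hd w => by
        rw [map_mul, map_mul, map_mul, map_mul, Module.End.mul_apply, Module.End.mul_apply,
          hc, hd] }
  suffices c ∈ P from this w
  refine Submonoid.pi_mem_of_mulSingle_mem c fun i => ?_
  intro w
  obtain ⟨⟨k, a⟩, rfl⟩ := m.pos.surjective i
  have := parabolic_block hf k (WrHecke.g (Pi.mulSingle a (c (m.pos ⟨k, a⟩)))) w
  simp only [tenBlock, blockHom, WrHecke.lift_g, MonoidHom.comp_apply, m.incl_mulSingle] at this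
  rw [← this, ← m.incl_mulSingle]
  rfl

include hf in
theorem parabolic_x (q : m.Pos) (w : S.TV m ⊗[F] U) :
    f (S.tenX δ q.1 q.2 w) = α (WrHecke.x (m.pos q)) (f w) := by
  have := parabolic_block hf q.1 (WrHecke.x q.2) w
  simpa only [tenBlock, blockHom, WrHecke.lift_x] using this

include hf in
theorem parabolic_s {q q' : m.Pos} (h : Comp.Consec q q') (w : S.TV m ⊗[F] U) :
    f (S.tenSPos δ q q' w) =
      α (WrHecke.perm (Equiv.swap (m.pos q) (m.pos q'))) (f w) := by
  obtain ⟨k, i, j, h, rfl, rfl⟩ := h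
  have := parabolic_block hf k (WrHecke.s i j h) w
  simp only [tenBlock, blockHom, WrHecke.lift_s] at this
  rw [tenSPos_mk _ _ _ _ _ h, this, WrHecke.perm_swap _ _ (m.pos_succ h)]

variable (α f) in
/-- The extension to the model of a homomorphism over the parabolic subalgebra. -/
def modelLift : S.Model m U →ₗ[F] M :=
  ∑ σ : m.Shuffle, α (WrHecke.perm σ.toPerm⁻¹) ∘ₗ f ∘ₗ LinearMap.proj σ

theorem modelLift_apply (ξ : S.Model m U) :
    modelLift α f ξ = ∑ σ : m.Shuffle, α (WrHecke.perm σ.toPerm⁻¹) (f (ξ σ)) := by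
  simp [modelLift]

-- Moving `g` past the coset representative permutes its entries, and the permuted element is
-- absorbed by `f`. This matches the twisted action of `G^n` on the copy at `σ`.
include hf in
theorem g_perm_parabolic (σ : m.Shuffle) (c : Fin n → G) (w : S.TV m ⊗[F] U) :
    α (WrHecke.g c) (α (WrHecke.perm σ.toPerm⁻¹) (f w)) =
      α (WrHecke.perm σ.toPerm⁻¹) (f (S.opV m (S.tvRep m (c ∘ σ.toPerm.symm)) w)) := by
  rw [parabolic_g hf, ← Module.End.mul_apply, ← Module.End.mul_apply, ← map_mul, ← map_mul,
    WrHecke.perm_mul_g]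
  congr 4
  funext a
  exact congrArg c (σ.toPerm.symm_apply_apply a).symm

-- Behind the coset representative, `t_{ij}` becomes the corresponding sum at two positions of
-- different blocks, which vanishes on `V(n̂)`.
include hf in
theorem sum_antiDiag_perm_parabolic (σ : m.Shuffle) {i j : Fin n} (h : (σ i).1 ≠ (σ j).1)
    (w : S.TV m ⊗[F] U) :
    α (∑ c : G, WrHecke.g (antiDiag i j c)) (α (WrHecke.perm σ.toPerm⁻¹) (f w)) = 0 := by
  have hd : ∀ c : G, antiDiag i j c ∘ σ.toPerm.symm =
      antiDiag (m.pos (σ i)) (m.pos (σ j)) c := antiDiag_comp_symm σ.toPerm i j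
  rw [map_sum, LinearMap.sum_apply]
  simp only [g_perm_parabolic hf, hd]
  rw [← map_sum, ← map_sum, ← LinearMap.sum_apply, ← map_sum, S.sum_antiDiag_ne h, map_zero,
    LinearMap.zero_apply, map_zero, map_zero]

-- In general `x_a` passes a permutation only up to correction terms. Here the coset representative
-- is a product of exchanges of different letters, and each correction term is zero by
-- `sum_antiDiag_perm_parabolic`.
include hf in
theorem x_perm_parabolic (σ : m.Shuffle) (a : Fin n) (w : S.TV m ⊗[F] U) :
    α (WrHecke.x a) (α (WrHecke.perm σ.toPerm⁻¹) (f w)) =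
      α (WrHecke.perm σ.toPerm⁻¹) (f (S.tenX δ (σ a).1 (σ a).2 w)) := by
  induction σ using Comp.Shuffle.induction generalizing a w with
  | base =>
    rw [toPerm_base, inv_one, map_one, map_one, Module.End.one_apply, Module.End.one_apply,
      parabolic_x hf]
    congr 3
    exact (m.pos.apply_symm_apply a).symm
  | step σ i j hij h ih =>
    have hs : ∀ y, α (WrHecke.perm (σ.swap i j hij h).toPerm⁻¹) y =
        α (WrHecke.s i j hij) (α (WrHecke.perm σ.toPerm⁻¹) y) := by
      intro y
      rw [toPerm_swap_inv, map_mul, map_mul, Module.End.mul_apply, WrHecke.perm_swap i j hij]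
    have hss : ∀ y, α (WrHecke.s i j hij) (α (WrHecke.s i j hij) y) = y := by
      intro y
      rw [← Module.End.mul_apply, ← map_mul, WrHecke.relations.ss, map_one, Module.End.one_apply]
    have hsx : ∀ y, α (WrHecke.x j) (α (WrHecke.s i j hij) y) =
        α (WrHecke.s i j hij) (α (WrHecke.x i) y) +
          α (∑ c : G, WrHecke.g (antiDiag i j c)) y := by
      intro y
      have := congrArg (fun z => α z y) (WrHecke.relations (F := F) (G := G).sx i j hij)
      simp only [map_sub, map_mul, LinearMap.sub_apply, Module.End.mul_apply] at this
      rw [this, sub_add_cancel]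
    by_cases haj : a = j
    · subst haj
      rw [hs, hs, hsx, ih, sum_antiDiag_perm_parabolic hf σ h, add_zero, Comp.Shuffle.swap_right]
    · by_cases hai : a = i
      · subst hai
        -- The relation for `x_{i+1} s_i` is applied to `s_i` times the vector; with `s_i² = 1` it
        -- becomes a formula for `x_i s_i`. Its correction term vanishes because the exchanged
        -- letters are still different.
        have h1 := hsx (α (WrHecke.s a j hij) (α (WrHecke.perm σ.toPerm⁻¹) (f w)))
        rw [hss, ← hs (f w), sum_antiDiag_perm_parabolic hf _ (σ.swap_letter a j hij h), add_zero,
          ih] at h1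
        rw [Comp.Shuffle.swap_left, hs (f (S.tenX δ _ _ w)), h1, hss]
      · rw [hs, hs, Comp.Shuffle.swap_other _ _ _ _ _ hai haj, ← ih, ← Module.End.mul_apply,
          ← map_mul, ← WrHecke.relations.sx' _ _ _ _ hai haj, map_mul, Module.End.mul_apply]

-- The reflection permutes the arrangements by the involution `ν`, along which the sum is reindexed.
-- At a fixed arrangement, `s_i` is conjugated through the coset representative into the Young
-- subgroup, over which `f` is equivariant.
include hf in
theorem modelLift_s {i j : Fin n} (hij : i.val + 1 = j.val) (ξ : S.Model m U) :
    modelLift α f (S.modelS δ i j hij ξ) = α (WrHecke.s i j hij) (modelLift α f ξ) := by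
  let ν : m.Shuffle → m.Shuffle := fun σ =>
    if h : (σ i).1 = (σ j).1 then σ else σ.swap i j hij h
  have hν : Function.Involutive ν := by
    intro σ
    by_cases h : (σ i).1 = (σ j).1
    · have : ν σ = σ := dif_pos h
      rw [this, this]
    · have h1 : ν σ = σ.swap i j hij h := dif_neg h
      rw [h1]
      exact (dif_neg (σ.swap_letter i j hij h)).trans (σ.swap_swap i j hij h _)
  rw [modelLift_apply, modelLift_apply, map_sum, ← Equiv.sum_comp hν.toPerm]
  refine Finset.sum_congr rfl fun σ _ => ?_
  change α (WrHecke.perm (ν σ).toPerm⁻¹) (f (S.modelS δ i j hij ξ (ν σ))) = _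
  rw [← Module.End.mul_apply, ← map_mul, ← WrHecke.perm_swap i j hij, ← map_mul]
  by_cases h : (σ i).1 = (σ j).1
  · have : ν σ = σ := dif_pos h
    rw [this, modelS_same _ _ _ _ _ h, parabolic_s hf (σ.consec hij h), swap_mul_toPerm_inv,
      map_mul, map_mul, Module.End.mul_apply]
  · have : ν σ = σ.swap i j hij h := dif_neg h
    rw [this, modelS_diff _ _ _ _ _ (σ.swap_letter i j hij h), Comp.Shuffle.swap_swap,
      toPerm_swap_inv]

include hf in
theorem modelLift_act (a : WrHecke F G n) (ξ : S.Model m U) :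
    modelLift α f (S.modelAct δ a ξ) = α a (modelLift α f ξ) := by
  suffices a ∈ intertwined (S.modelAct δ) α (modelLift α f) from this ξ
  apply WrHecke.induct
  · intro c ξ
    rw [modelAct_g, modelLift_apply, modelLift_apply, map_sum]
    exact Finset.sum_congr rfl fun σ _ => (g_perm_parabolic hf σ c (ξ σ)).symm
  · intro i j h ξ
    rw [modelAct_s, modelLift_s hf]
  · intro j ξ
    rw [modelAct_x, modelLift_apply, modelLift_apply, map_sum]
    exact Finset.sum_congr rfl fun σ _ => (x_perm_parabolic hf σ j (ξ σ)).symm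

theorem modelLift_base (w : S.TV m ⊗[F] U) :
    modelLift α f (S.modelSingle (Comp.Shuffle.base m) w) = f w := by
  rw [modelLift_apply, Finset.sum_eq_single (Comp.Shuffle.base m)]
  · rw [toPerm_base, inv_one, map_one, map_one, Module.End.one_apply]
    simp
  · intro σ _ hσ
    simp [hσ]
  · simp

end

end SimpleSystem

/-! ### Homomorphisms out of induced modules -/

section

variable {F : Type u} [Field F] {B H : Type u} [Ring B] [Algebra F B] [Ring H] [Algebra F H]
  {φ : B →ₐ[F] H} {W : Type u} [AddCommGroup W] [Module F W] {τ : B →ₐ[F] Module.End F W}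

instance : Module F (Ind φ τ) := inferInstanceAs (Module F ((H ⊗[F] W) ⧸ indRel φ τ))

instance : IsScalarTower F H (Ind φ τ) :=
  inferInstanceAs (IsScalarTower F H ((H ⊗[F] W) ⧸ indRel φ τ))

variable {X : Type u} [AddCommGroup X] [Module H X] [Module F X] [IsScalarTower F H X]

variable (φ τ) in
/-- Frobenius reciprocity: the homomorphism out of the induced module given by a homomorphism
over the subalgebra. -/
def indLift (f : W →ₗ[F] X) (hf : ∀ b w, f (τ b w) = φ b • f w) : Ind φ τ →ₗ[H] X :=
  (indRel φ τ).liftQ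
    (TensorProduct.AlgebraTensorModule.lift (LinearMap.toSpanSingleton H (W →ₗ[F] X) f)) (by
      rw [indRel, Submodule.span_le]
      rintro _ ⟨b, w, rfl⟩
      simp [hf])

theorem indLift_mk (f : W →ₗ[F] X) (hf : ∀ b w, f (τ b w) = φ b • f w) (a : H) (w : W) :
    indLift φ τ f hf (indMk φ τ (a ⊗ₜ w)) = a • f w := by
  change (indRel φ τ).liftQ _ _ (Submodule.Quotient.mk _) = _
  rw [Submodule.liftQ_apply]
  simp

variable (φ τ) in
/-- The canonical map to the induced module. -/
def indUnit : W →ₗ[F] Ind φ τ :=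
  (indMk φ τ).restrictScalars F ∘ₗ TensorProduct.mk F H W 1

theorem indUnit_apply (w : W) : indUnit φ τ w = indMk φ τ (1 ⊗ₜ w) := rfl

theorem smul_indUnit (a : H) (w : W) : a • indUnit φ τ w = indMk φ τ (a ⊗ₜ w) := by
  rw [indUnit_apply, ← map_smul, TensorProduct.smul_tmul', smul_eq_mul, mul_one]

/-- The generators of `indRel` say exactly this. -/
theorem indUnit_act (b : B) (w : W) : indUnit φ τ (τ b w) = φ b • indUnit φ τ w := by
  rw [smul_indUnit, indUnit_apply, eq_comm, ← sub_eq_zero, ← map_sub]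
  exact (Submodule.Quotient.mk_eq_zero (indRel φ τ)).2 (Submodule.subset_span ⟨b, w, rfl⟩)

end

/-! ### Identification of the induced module with the model -/

namespace SimpleSystem

variable {F : Type u} [Field F] [IsAlgClosed F] {G : Type u} [Group G] [Fintype G] {r n : ℕ}
  (S : SimpleSystem F G r) {m : Comp r n} {U : Type u} [AddCommGroup U] [Module F U]
  (δ : S.APar m →ₐ[F] Module.End F U)

/-- The model as a module over the wreath Hecke algebra. -/
def ModelMod (_ : S.APar m →ₐ[F] Module.End F U) : Type u := S.Model m U

instance : AddCommGroup (S.ModelMod δ) := inferInstanceAs (AddCommGroup (S.Model m U))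

instance : Module F (S.ModelMod δ) := inferInstanceAs (Module F (S.Model m U))

instance : Module (WrHecke F G n) (S.ModelMod δ) :=
  Module.compHom (S.Model m U) (S.modelAct δ).toRingHom

instance : IsScalarTower F (WrHecke F G n) (S.ModelMod δ) where
  smul_assoc c a ξ := by
    change S.modelAct δ (c • a) ξ = c • S.modelAct δ a ξ
    rw [map_smul]
    rfl

/-- The homomorphism from the induced module to the model. -/
def indToModel : Ind (parHom m) (S.tenAct δ) →ₗ[WrHecke F G n] S.ModelMod δ :=
  indLift (H := WrHecke F G n) (parHom m) (S.tenAct δ) (X := S.ModelMod δ)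
    (S.modelSingle (Comp.Shuffle.base m)) (S.modelSingle_base δ)

theorem indToModel_unit (w : S.TV m ⊗[F] U) :
    S.indToModel δ (indUnit (parHom m) (S.tenAct δ) w) =
      S.modelSingle (Comp.Shuffle.base m) w := by
  rw [indUnit_apply]
  exact (indLift_mk _ _ _ _).trans (one_smul _ _)

/-- The comparison of the induced module with the model. -/
def indEquiv : Ind (parHom m) (S.tenAct δ) ≃ₗ[WrHecke F G n] S.ModelMod δ :=
  let κ := S.indToModel δ
  let l : S.Model m U →ₗ[F] Ind (parHom m) (S.tenAct δ) :=
    modelLift (Algebra.lsmul F F (Ind (parHom m) (S.tenAct δ)))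
      (indUnit (H := WrHecke F G n) (parHom m) (S.tenAct δ))
  let L : S.ModelMod δ →ₗ[WrHecke F G n] Ind (parHom m) (S.tenAct δ) :=
    { toFun := l
      map_add' := map_add l
      map_smul' := modelLift_act indUnit_act }
  -- This replaces freeness of `H_n(G)` over the parabolic subalgebra: `κ ∘ L = 1` makes the
  -- translates by coset representatives independent, and `L ∘ κ = 1` makes them span.
  LinearEquiv.ofLinearMap κ L
    (by
      apply LinearMap.ext
      intro ξ
      change κ (l ξ) = ξ
      -- The translate of `1 ⊗ w` by the representative of `σ` goes to the copy at `σ`, and every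
      -- element of the model is the sum of its entries.
      have h1 : ∀ (σ : m.Shuffle) w, κ ((WrHecke.perm σ.toPerm⁻¹ : WrHecke F G n) •
          indUnit (parHom m) (S.tenAct δ) w) = S.modelSingle σ w := by
        intro σ w
        rw [map_smul, show κ (indUnit _ _ w) = _ from S.indToModel_unit δ w]
        exact S.modelAct_perm δ σ w
      have h2 : l ξ = ∑ σ : m.Shuffle, (WrHecke.perm σ.toPerm⁻¹ : WrHecke F G n) •
          indUnit (parHom m) (S.tenAct δ) (ξ σ) := modelLift_apply _
      rw [h2, map_sum]
      simp only [h1]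
      exact LinearMap.sum_single_apply _ ξ)
    (by
      -- Both maps are `H_n(G)`-linear, so it suffices to compare them on the generators `1 ⊗ w`.
      apply ind_ext
      intro a w
      rw [← smul_indUnit, map_smul, map_smul]
      congr 1
      change L (κ (indUnit (parHom m) (S.tenAct δ) w)) = _
      rw [show κ (indUnit _ _ w) = _ from S.indToModel_unit δ w]
      exact modelLift_base w)

theorem indEquiv_unit (w : S.TV m ⊗[F] U) :
    S.indEquiv δ (indUnit (parHom m) (S.tenAct δ) w) = S.modelSingle (Comp.Shuffle.base m) w :=
  S.indToModel_unit δ w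

end SimpleSystem

/-! ### Simple constituents of representations of `G^n` -/

section

variable {F : Type u} [Field F] {H : Type u} [Group H] {K : Type u} [AddCommGroup K] [Module F K]

/-- The cyclic subrepresentation generated by a vector. -/
def cyclicSubrep (κ : Representation F H K) (x : K) : Subrepresentation κ where
  toSubmodule := Submodule.span F (Set.range fun h => κ h x)
  apply_mem_toSubmodule g := by
    intro v hv
    have := Submodule.mem_map_of_mem (f := κ g) hv
    rw [Submodule.map_span, ← Set.range_comp] at this
    refine Submodule.span_mono ?_ this
    rintro _ ⟨h, rfl⟩
    exact ⟨g * h, by simp⟩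

theorem mem_cyclicSubrep (κ : Representation F H K) (x : K) :
    x ∈ (cyclicSubrep κ x).toSubmodule :=
  Submodule.subset_span ⟨1, by simp⟩

theorem irreducible_of_isAtom {κ : Representation F H K} (W : Subrepresentation κ)
    (hW : IsAtom W) : W.toRepresentation.IsIrreducible := by
  have key : ∀ L : Subrepresentation W.toRepresentation, ∃ L' : Subrepresentation κ,
      L'.toSubmodule = L.toSubmodule.map W.toSubmodule.subtype := fun L =>
    ⟨⟨L.toSubmodule.map W.toSubmodule.subtype, by
      rintro g _ ⟨v, hv, rfl⟩
      exact ⟨_, L.apply_mem_toSubmodule g hv, rfl⟩⟩, rfl⟩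
  refine { exists_pair_ne := ⟨⊥, ⊤, fun h => hW.1 ?_⟩, eq_bot_or_eq_top := fun L => ?_ }
  · apply Subrepresentation.toSubmodule_injective
    have h' : (⊥ : Submodule F W.toSubmodule) = ⊤ := congrArg Subrepresentation.toSubmodule h
    exact Submodule.subsingleton_iff_eq_bot.1 ((Submodule.subsingleton_iff F).1
      (subsingleton_of_bot_eq_top h'))
  · obtain ⟨L', hL'⟩ := key L
    have hle : L' ≤ W := by
      intro v hv
      have hv' : v ∈ L'.toSubmodule := hv
      rw [hL'] at hv'
      obtain ⟨w, _, rfl⟩ := hv'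
      exact w.2
    rcases hW.le_iff.1 hle with h | h
    · left
      apply Subrepresentation.toSubmodule_injective
      have h1 : L.toSubmodule.map W.toSubmodule.subtype = ⊥ := by rw [← hL', h]; rfl
      exact Submodule.map_injective_of_injective (f := W.toSubmodule.subtype) Subtype.val_injective
        (h1.trans (Submodule.map_bot _).symm)
    · right
      apply Subrepresentation.toSubmodule_injective
      apply Submodule.map_injective_of_injective (f := W.toSubmodule.subtype) Subtype.val_injective
      rw [← hL', h]
      exact (Submodule.map_subtype_top _).symm

/-- Finite dimension gives the descending chain condition, so there is an atom below `W`; atoms are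
irreducible. -/
theorem exists_irreducible_le [FiniteDimensional F K] (κ : Representation F H K)
    (W : Subrepresentation κ) (hW : W ≠ ⊥) :
    ∃ W' ≤ W, W'.toRepresentation.IsIrreducible := by
  have hwf : WellFoundedLT (Subrepresentation κ) :=
    ⟨(InvImage.wf (fun L : Subrepresentation κ => L.toSubmodule)
      (wellFounded_lt (α := Submodule F K))).mono fun a b h => h⟩
  have : IsAtomic (Subrepresentation κ) := inferInstance
  obtain ⟨W', h1, h2⟩ := (IsAtomic.eq_bot_or_exists_atom_le W).resolve_left hW
  exact ⟨W', h2, irreducible_of_isAtom W' h1⟩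

theorem asAlgebraHom_equivariant {V : Type u} [AddCommGroup V] [Module F V]
    {ρ : Representation F H V} {κ : Representation F H K} (e : V →ₗ[F] K)
    (he : ∀ g v, e (ρ g v) = κ g (e v)) (a : MonoidAlgebra F H) (v : V) :
    e (ρ.asAlgebraHom a v) = κ.asAlgebraHom a (e v) := by
  induction a using MonoidAlgebra.induction_linear with
  | zero => simp
  | add a b ha hb => simp [ha, hb]
  | single g c => simp [Representation.asAlgebraHom_single, he]

/-- The orbit of `v` under the group algebra is a nonzero subrepresentation, hence everything. -/
theorem asAlgebraHom_surjective {V : Type u} [AddCommGroup V] [Module F V]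
    {ρ : Representation F H V} (hρ : ρ.IsIrreducible) {v : V} (hv : v ≠ 0) (w : V) :
    ∃ a, ρ.asAlgebraHom a v = w := by
  let L : Subrepresentation ρ :=
    { toSubmodule := LinearMap.range ((LinearMap.applyₗ v).comp ρ.asAlgebraHom.toLinearMap)
      apply_mem_toSubmodule := by
        rintro g _ ⟨a, rfl⟩
        refine ⟨MonoidAlgebra.single g 1 * a, ?_⟩
        simp [Representation.asAlgebraHom_single] }
  have hvL : v ∈ L.toSubmodule := ⟨1, by simp⟩
  rcases hρ.eq_bot_or_eq_top L with h | h
  · rw [h] at hvL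
    exact absurd ((Submodule.mem_bot F).1 hvL) hv
  · have : w ∈ L.toSubmodule := by rw [h]; exact Submodule.mem_top
    obtain ⟨a, ha⟩ := this
    exact ⟨a, ha⟩

end

/-! ### Products of commuting group actions -/

section

variable {F : Type u} [Field F] {G : Type u} [Group G] {K : Type u} [AddCommGroup K] [Module F K]
  {ι : Type} [Fintype ι] [hdec : DecidableEq ι] {κ : ι → Representation F G K}
  (hκ : Pairwise fun q q' => ∀ g g', Commute (κ q g) (κ q' g'))

include hκ in
theorem asAlgebraHom_commute : Pairwise fun q q' => ∀ a b,
    Commute ((κ q).asAlgebraHom a) ((κ q').asAlgebraHom b) := by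
  intro q q' hq a b
  have h2 : ∀ g b, Commute (κ q g) ((κ q').asAlgebraHom b) := by
    intro g b
    induction b using MonoidAlgebra.induction_linear with
    | zero => rw [map_zero]; exact Commute.zero_right _
    | add a b ha hb => rw [map_add]; exact ha.add_right hb
    | single g' c =>
      rw [Representation.asAlgebraHom_single]
      exact (hκ hq g g').smul_right c
  induction a using MonoidAlgebra.induction_linear with
  | zero => rw [map_zero]; exact Commute.zero_left _
  | add a b ha hb => rw [map_add]; exact ha.add_left hb
  | single g' c =>
    rw [Representation.asAlgebraHom_single]
    exact (h2 g' b).smul_left c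

/-- The product of commuting actions of the group algebra. -/
def commProd : (ι → MonoidAlgebra F G) →* Module.End F K :=
  MonoidHom.noncommPiCoprod (fun q => ((κ q).asAlgebraHom : MonoidAlgebra F G →* Module.End F K))
    fun _ _ h a b => asAlgebraHom_commute hκ h a b

theorem commProd_mulSingle (q : ι) (a : MonoidAlgebra F G) :
    commProd hκ (Pi.mulSingle q a) = (κ q).asAlgebraHom a :=
  MonoidHom.noncommPiCoprod_mulSingle (N := fun _ : ι => MonoidAlgebra F G) _ q a

theorem commProd_update (a : ι → MonoidAlgebra F G) (q : ι) (b : MonoidAlgebra F G) :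
    commProd hκ (Function.update a q b) =
      commProd hκ (Function.update a q 1) * (κ q).asAlgebraHom b := by
  rw [← commProd_mulSingle hκ, ← map_mul]
  congr 1
  funext p
  by_cases hp : p = q
  · subst hp; simp
  · simp [hp]

/-- With the entry `1` in slot `q`, only the actions of the other slots occur in the product. -/
theorem commProd_update_commute (a : ι → MonoidAlgebra F G) (q : ι) (g : G) :
    Commute (commProd hκ (Function.update a q 1)) (κ q g) := by
  have : κ q g = commProd hκ (Pi.mulSingle q (MonoidAlgebra.single g 1)) := by
    rw [commProd_mulSingle, Representation.asAlgebraHom_single, one_smul]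
  rw [this]
  refine Commute.map ?_ (commProd hκ)
  funext p
  by_cases hp : p = q
  · subst hp; simp
  · simp [hp]

variable {V : ι → Type u} [∀ q, AddCommGroup (V q)] [∀ q, Module F (V q)]
  {ρ : ∀ q, Representation F G (V q)} {e : ∀ q, V q →ₗ[F] K}
  (he : ∀ q g w, e q (ρ q g w) = κ q g (e q w)) {v : ∀ q, V q} {x : K} (hev : ∀ q, e q (v q) = x)

-- The factor of slot `q` may be applied to `x` first, and there the action on `K` is computed in `V
-- q` through `e q`.
include he hev in
theorem commProd_update_apply (a : ι → MonoidAlgebra F G) (q : ι) (b : MonoidAlgebra F G) :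
    commProd hκ (Function.update a q b) x =
      commProd hκ (Function.update a q 1) (e q ((ρ q).asAlgebraHom b (v q))) := by
  rw [commProd_update, Module.End.mul_apply, asAlgebraHom_equivariant (κ := κ q) (e q) (he q), hev]

variable {P : ∀ q, V q →ₗ[F] MonoidAlgebra F G}
  (hP : ∀ q w, (ρ q).asAlgebraHom (P q w) (v q) = w)

theorem section_update (w : ∀ q, V q) (q : ι) (z : V q) :
    (fun p => P p (Function.update w q z p)) =
      Function.update (fun p => P p (w p)) q (P q z) := by
  funext p
  by_cases hp : p = q
  · subst hp; simp
  · simp [hp]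

include he hev hP in
theorem commProd_section_update (w : ∀ q, V q) (q : ι) (z : V q) :
    commProd hκ (fun p => P p (Function.update w q z p)) x =
      commProd hκ (Function.update (fun p => P p (w p)) q 1) (e q z) := by
  rw [section_update, commProd_update_apply hκ he hev, hP]

-- The slots are filled one at a time, and each keeps `x`: `P q (v q)` fixes `v q`, hence its image
-- `x` under `e q`.
include he hev hP in
theorem commProd_section_base : commProd hκ (fun p => P p (v p)) x = x := by
  suffices ∀ T : Finset ι, commProd hκ (fun q => if q ∈ T then P q (v q) else 1) x = x by
    simpa using this Finset.univ
  intro T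
  induction T using Finset.induction_on with
  | empty =>
    have : (fun q : ι => if q ∈ (∅ : Finset ι) then P q (v q) else 1) = 1 := by
      funext q; simp
    rw [this, map_one, Module.End.one_apply]
  | insert q T hq ih =>
    have h1 : (fun p => if p ∈ insert q T then P p (v p) else 1) =
        Function.update (fun p => if p ∈ T then P p (v p) else 1) q (P q (v q)) := by
      funext p
      by_cases hp : p = q
      · subst hp; simp
      · simp [hp]
    have h2 : Function.update (fun p => if p ∈ T then P p (v p) else 1) q 1 =
        fun p => if p ∈ T then P p (v p) else 1 := by
      rw [Function.update_eq_self_iff]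
      simp [hq]
    rw [h1, commProd_update_apply hκ he hev, hP, h2, hev, ih]

-- If `x` lies in the image of a map from `V q` for each of the commuting actions, these maps
-- combine to one map on all the `V q`: write `w q = a q · v q` with `a q` in the group algebra, and
-- apply the product of the `a q` to `x`.
include hκ he hev in
theorem exists_multilinear_equivariant (hρ : ∀ q, (ρ q).IsIrreducible) (hx : x ≠ 0) :
    ∃ L : MultilinearMap F V K, L v = x ∧
      ∀ q g w, L (Function.update w q (ρ q g (w q))) = κ q g (L w) := by
  have hv : ∀ q, v q ≠ 0 := fun q hq => hx (by rw [← hev q, hq, map_zero])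
  -- The sections are linear but not equivariant. This does no harm: in slot `q` the choice
  -- disappears, since `P q z` sends `x` to `e q z`, and `e q` is equivariant.
  have hsec : ∀ q, ∃ P : V q →ₗ[F] MonoidAlgebra F G,
      ∀ w, (ρ q).asAlgebraHom (P w) (v q) = w := by
    intro q
    obtain ⟨P, hP⟩ := LinearMap.exists_rightInverse_of_surjective
      ((LinearMap.applyₗ (v q)).comp (ρ q).asAlgebraHom.toLinearMap)
      (LinearMap.range_eq_top.2 fun w => asAlgebraHom_surjective (hρ q) (hv q) w)
    exact ⟨P, fun w => congrArg (fun T : V q →ₗ[F] V q => T w) hP⟩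
  choose P hP using hsec
  have hup := commProd_section_update hκ he hev hP
  let L : MultilinearMap F V K :=
    { toFun := fun w => commProd hκ (fun q => P q (w q)) x
      map_update_add' := by
        intro inst w q a b
        obtain rfl : inst = hdec := Subsingleton.elim _ _
        rw [hup, hup, hup, map_add, map_add]
      map_update_smul' := by
        intro inst w q c a
        obtain rfl : inst = hdec := Subsingleton.elim _ _
        rw [hup, hup, map_smul, map_smul] }
  refine ⟨L, commProd_section_base hκ he hev hP, fun q g w => ?_⟩
  change commProd hκ _ x = κ q g (commProd hκ _ x)
  rw [hup, he]
  have h2 := hup w q (w q)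
  rw [Function.update_eq_self] at h2
  rw [h2]
  exact congrArg (fun T : Module.End F K => T (e q (w q))) (commProd_update_commute hκ _ q g).eq

end

/-! ### Existence of a twisted `V(n̂)` in a representation of `G^n` -/

namespace SimpleSystem

variable {F : Type u} [Field F] [IsAlgClosed F] {G : Type u} [Group G] [Fintype G] {r n : ℕ}
  (S : SimpleSystem F G r) {K : Type u} [AddCommGroup K] [Module F K]
  (κ : Representation F (Fin n → G) K)

/-- The vector `x` lies in the image of a homomorphism from `V_k`, for the `i`-th factor of
`G^n`. -/
def LiesIn (x : K) (i : Fin n) (k : Fin r) : Prop :=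
  ∃ (v : S.V k) (e : S.V k →ₗ[F] K),
    (∀ g w, e (S.ρ k g w) = κ (Pi.mulSingle i g) (e w)) ∧ e v = x

/-- The factors of `G^n` are treated one at a time. At factor `i` the vector is replaced by a
nonzero one from a simple submodule of the `G`-module it generates, and the properties obtained
before survive. -/
theorem exists_liesIn [FiniteDimensional F K] [Nontrivial K] (T : Finset (Fin n)) :
    ∃ x : K, x ≠ 0 ∧ ∀ i ∈ T, ∃ k, S.LiesIn κ x i k := by
  induction T using Finset.induction_on with
  | empty =>
    obtain ⟨x, hx⟩ := exists_ne (0 : K)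
    exact ⟨x, hx, by simp⟩
  | insert i T hi ih =>
    obtain ⟨x, hx, ih⟩ := ih
    let κi : Representation F G K := κ.comp (MonoidHom.mulSingle (fun _ => G) i)
    obtain ⟨W, hW, hirr⟩ := exists_irreducible_le κi (cyclicSubrep κi x) (by
      intro h
      have := mem_cyclicSubrep κi x
      rw [h] at this
      exact hx ((Submodule.mem_bot F).1 this))
    obtain ⟨k, ⟨E⟩⟩ := S.complete _ W.toRepresentation hirr
    have := S.nontrivial k
    obtain ⟨v, hv⟩ := exists_ne (0 : S.V k)
    let e : S.V k →ₗ[F] K := W.toSubmodule.subtype ∘ₗ E.symm.toIntertwiningMap.toLinearMap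
    have hev : e v ≠ 0 := fun h => hv (by
      have h1 : E.symm v = 0 := Subtype.ext h
      rw [← E.apply_symm_apply v, h1]
      exact map_zero E.toLinearEquiv)
    have hmem : e v ∈ (cyclicSubrep κi x).toSubmodule := hW (E.symm v).2
    obtain ⟨c, hc⟩ := (Submodule.mem_span_range_iff_exists_fun F).1 hmem
    refine ⟨e v, hev, fun j hj => ?_⟩
    rcases Finset.mem_insert.1 hj with rfl | hj
    · refine ⟨k, v, e, fun g w => ?_, rfl⟩
      change W.toSubmodule.subtype (E.symm.toIntertwiningMap (S.ρ k g w)) = _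
      rw [Representation.IntertwiningMap.isIntertwining]
      rfl
    · obtain ⟨l, u, d, hd, hu⟩ := ih j hj
      have hij : i ≠ j := by rintro rfl; exact hi hj
      refine ⟨l, u, (∑ g, c g • κi g) ∘ₗ d, fun g w => ?_, ?_⟩
      -- The new vector is a combination of translates of `x` under factor `i`. This combination
      -- commutes with factor `j`, so composing it with the earlier map from `V_l` keeps that map
      -- equivariant.
      · have hcomm : Commute (∑ g, c g • κi g) (κ (Pi.mulSingle j g)) :=
          Commute.sum_left _ _ _ fun g' _ => Commute.smul_left
            ((Pi.mulSingle_commute (f := fun _ => G) hij g' g).map κ) _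
        rw [LinearMap.comp_apply, hd]
        exact congrArg (fun T : Module.End F K => T (d w)) hcomm.eq
      · rw [LinearMap.comp_apply, hu, ← hc]
        simp [LinearMap.sum_apply]

theorem exists_positions (k : Fin n → Fin r) :
    ∃ (m : Comp r n) (σ : Fin n ≃ m.Pos), ∀ i, (σ i).1 = k i := by
  classical
  let m : Comp r n :=
    { part := fun l => Fintype.card {i // k i = l}
      sum_part := by
        rw [← Fintype.card_sigma, Fintype.card_congr (Equiv.sigmaFiberEquiv k), Fintype.card_fin] }
  exact ⟨m, (Equiv.sigmaFiberEquiv k).symm.trans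
    (Equiv.sigmaCongrRight fun l => Fintype.equivFin {i // k i = l}), fun i => rfl⟩

/-- The multilinear map of `exists_multilinear_equivariant` descends to `V(n̂)` and is nonzero since
`x` is a value. Equivariance is tested on elements with a single nontrivial entry, which generate
`G^n`. -/
theorem exists_hom_of_liesIn {m : Comp r n} (σ : Fin n ≃ m.Pos) {x : K} (hx : x ≠ 0)
    (h : ∀ q : m.Pos, S.LiesIn κ x (σ.symm q) q.1) :
    ∃ φ : S.TV m →ₗ[F] K, φ ≠ 0 ∧
      ∀ c v, φ (S.tvRep m (c ∘ (σ.trans m.pos).symm) v) = κ c (φ v) := by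
  choose v e he hev using h
  obtain ⟨L, hLv, hL⟩ := exists_multilinear_equivariant
    (κ := fun q : m.Pos => κ.comp (MonoidHom.mulSingle (fun _ => G) (σ.symm q)))
    (fun q q' hq g g' =>
      (Pi.mulSingle_commute (f := fun _ => G) (fun h => hq (σ.symm.injective h)) g g').map κ)
    he hev (fun q => S.irreducible q.1) hx
  refine ⟨PiTensorProduct.lift L, fun h0 => hx ?_, ?_⟩
  · rw [← hLv, ← PiTensorProduct.lift.tprod (φ := L) v, h0, LinearMap.zero_apply]
  · let Q : Submonoid (Fin n → G) :=
      { carrier := {c | ∀ z, PiTensorProduct.lift L (S.tvRep m (c ∘ (σ.trans m.pos).symm) z) =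
          κ c (PiTensorProduct.lift L z)}
        one_mem' := fun z => by
          rw [show (1 : Fin n → G) ∘ (σ.trans m.pos).symm = 1 from rfl, map_one, map_one]
          rfl
        mul_mem' := fun {c d} hc hd z => by
          rw [show (c * d) ∘ (σ.trans m.pos).symm = (c ∘ (σ.trans m.pos).symm) *
            (d ∘ (σ.trans m.pos).symm) from rfl, map_mul, map_mul, Module.End.mul_apply,
            Module.End.mul_apply, hc, hd] }
    intro c
    suffices c ∈ Q from this
    refine Submonoid.pi_mem_of_mulSingle_mem c fun i => ?_
    obtain ⟨q, rfl⟩ := σ.symm.surjective i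
    have hcs : (Pi.mulSingle (σ.symm q) (c (σ.symm q)) : Fin n → G) ∘ (σ.trans m.pos).symm =
        Pi.mulSingle (m.pos q) (c (σ.symm q)) := by
      funext a
      simp [Pi.mulSingle_apply, Equiv.symm_apply_eq]
    suffices PiTensorProduct.lift L ∘ₗ S.tvRep m (Pi.mulSingle (m.pos q) (c (σ.symm q))) =
        κ (Pi.mulSingle (σ.symm q) (c (σ.symm q))) ∘ₗ PiTensorProduct.lift L by
      intro z
      rw [hcs]
      exact congrArg (fun T : S.TV m →ₗ[F] K => T z) this
    apply tv_ext
    intro w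
    rw [LinearMap.comp_apply, LinearMap.comp_apply, tvRep_mulSingle, PiTensorProduct.lift.tprod,
      PiTensorProduct.lift.tprod]
    exact hL q _ w

/-- Every nonzero representation of `G^n` has a constituent `V(n̂)`, up to a place permutation. -/
theorem exists_hom [FiniteDimensional F K] [Nontrivial K] :
    ∃ (m : Comp r n) (σ : Fin n ≃ m.Pos) (φ : S.TV m →ₗ[F] K), φ ≠ 0 ∧
      ∀ c v, φ (S.tvRep m (c ∘ (σ.trans m.pos).symm) v) = κ c (φ v) := by
  obtain ⟨x, hx, h⟩ := S.exists_liesIn κ Finset.univ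
  choose k hk using fun i => h i (Finset.mem_univ i)
  obtain ⟨m, σ, hσ⟩ := exists_positions k
  refine ⟨m, σ, S.exists_hom_of_liesIn κ σ hx fun q => ?_⟩
  obtain ⟨i, rfl⟩ := σ.surjective q
  rw [σ.symm_apply_apply, hσ]
  exact hk i

end SimpleSystem

namespace SimpleSystem

variable {F : Type u} [Field F] [IsAlgClosed F] {G : Type u} [Group G] [Fintype G] {r n : ℕ}
  (S : SimpleSystem F G r) {m : Comp r n} {M N : Type u} [AddCommGroup M] [Module F M]
  [AddCommGroup N] [Module F N] {α : WrHecke F G n →ₐ[F] Module.End F M}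
  {β : WrHecke F G n →ₐ[F] Module.End F N}

/-! ### Evaluation and currying -/

theorem scale_ne_zero (k : Fin r) : S.scale k ≠ 0 := by
  unfold scale
  split_ifs with h
  · exact one_ne_zero
  · exact h

/-- A homomorphism `V(n̂) → M` over `FG^n` has its image in the isotypical subspace. -/
def mkHom (f : S.TV m →ₗ[F] M) (hf : ∀ c v, f (S.tvRep m c v) = α (WrHecke.g c) (f v)) :
    S.HomSp α m :=
  LinearMap.intertwiningMap_of_isIntertwiningMap (S.tvRep m)
    (isotypical (S.tvRep m) (gRep α)).toRepresentation
    (f.codRestrict _ (range_le_isotypical S.tvRep_irreducible f hf))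
    fun c v => Subtype.ext (hf c v)

variable (α m) in
/-- The evaluation map `V(n̂) ⊗ Hom(V(n̂), I M) → M`. -/
def evalMap : S.TV m ⊗[F] S.HomSp α m →ₗ[F] M :=
  TensorProduct.lift (LinearMap.mk₂ F (fun v (φ : S.HomSp α m) => (φ v : M))
    (fun v w φ => by rw [map_add]; rfl) (fun c v φ => by rw [map_smul]; rfl)
    (fun v φ ψ => rfl) (fun c v φ => rfl))

theorem evalMap_tmul (v : S.TV m) (φ : S.HomSp α m) : S.evalMap m α (v ⊗ₜ φ) = φ v := rfl

theorem homAct_single (k : Fin r) (a : DegHecke F (S.param k) (m.part k)) :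
    S.homAct α m (S.single m k a) = S.homBlock α k a :=
  tensorLift_single _ _ _ _

/-- On generators: the flip on `V(n̂)` in the action of `s_i` cancels the flip in its action on `φ`,
and the scaling of `x_i` cancels the inverse scaling in the definition of `y_i φ`. -/
theorem evalMap_act (b : ParHecke F G m) (w : S.TV m ⊗[F] S.HomSp α m) :
    S.evalMap m α (S.tenAct (S.homAct α m) b w) = α (parHom m b) (S.evalMap m α w) := by
  suffices b ∈ intertwined (S.tenAct (S.homAct α m)) (α.comp (parHom m)) (S.evalMap m α) from
    this w
  apply tensor_induct
  intro k a w
  simp only [tenAct, tensorLift_single, AlgHom.comp_apply, parHom]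
  suffices a ∈ intertwined (S.tenBlock (S.homAct α m) k) (α.comp (blockHom m k))
    (S.evalMap m α) from this w
  have ext : ∀ {T : Module.End F (S.TV m ⊗[F] S.HomSp α m)} {T' : Module.End F M},
      (∀ v φ, S.evalMap m α (T (v ⊗ₜ φ)) = T' (φ v)) →
      ∀ w, S.evalMap m α (T w) = T' (S.evalMap m α w) := by
    intro T T' h w
    have : S.evalMap m α ∘ₗ T = T' ∘ₗ S.evalMap m α := TensorProduct.ext' h
    exact congrArg (fun L : S.TV m ⊗[F] S.HomSp α m →ₗ[F] M => L w) this
  apply WrHecke.induct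
  · intro c
    apply ext
    intro v φ
    simp only [tenBlock, WrHecke.lift_g, AlgHom.comp_apply, blockHom, MonoidHom.comp_apply]
    exact homIso_equivariant φ _ v
  · intro i j h
    apply ext
    intro v φ
    simp only [tenBlock, WrHecke.lift_s, AlgHom.comp_apply, blockHom, tenS, Module.End.mul_apply,
      opU_tmul, opV_tmul, homAct_single, homBlock, DegHecke.lift_s, evalMap_tmul, homS_apply,
      flip_flip_apply]
  · intro i
    apply ext
    intro v φ
    simp only [tenBlock, WrHecke.lift_x, AlgHom.comp_apply, blockHom, tenX, LinearMap.smul_apply,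
      opU_tmul, map_smul, homAct_single, homBlock, DegHecke.lift_y, evalMap_tmul, homY_apply]
    rw [smul_smul, mul_inv_cancel₀ (S.scale_ne_zero k), one_smul]

section

variable {S} {U : Type u} [AddCommGroup U] [Module F U] {δ : S.APar m →ₐ[F] Module.End F U}
  {f : S.TV m ⊗[F] U →ₗ[F] M} (hf : ∀ b w, f (S.tenAct δ b w) = α (parHom m b) (f w))

/-- The linear map `U → Hom(V(n̂), I M)` that corresponds to a homomorphism `V(n̂) ⊗ U → M` over
the parabolic subalgebra. -/
def curryHom : U →ₗ[F] S.HomSp α m where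
  toFun z := S.mkHom (f ∘ₗ (TensorProduct.mk F (S.TV m) U).flip z)
    fun c v => parabolic_g hf c (v ⊗ₜ z)
  map_add' y z := homIso_ext fun v => by
    change f (v ⊗ₜ (y + z)) = f (v ⊗ₜ y) + f (v ⊗ₜ z)
    rw [TensorProduct.tmul_add, map_add]
  map_smul' c z := homIso_ext fun v => by
    change f (v ⊗ₜ (c • z)) = c • f (v ⊗ₜ z)
    rw [TensorProduct.tmul_smul, map_smul]

/-- The counterpart of `evalMap_act` under the adjunction of tensor product and homomorphisms, with
the same cancellations of flips and scalars. -/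
theorem curryHom_act (a : S.APar m) (z : U) :
    curryHom hf (δ a z) = S.homAct α m a (curryHom hf z) := by
  suffices a ∈ intertwined δ (S.homAct α m) (curryHom hf) from this z
  apply tensor_induct
  intro k b z
  change curryHom hf (δ (S.single m k b) z) = S.homAct α m (S.single m k b) (curryHom hf z)
  rw [homAct_single]
  suffices b ∈ intertwined (δ.comp (S.single m k)) (S.homBlock α k) (curryHom hf) from this z
  apply DegHecke.induct
  · intro i j h z
    apply homIso_ext
    intro v
    simp only [homBlock, DegHecke.lift_s]
    have := parabolic_block hf k (WrHecke.s i j h) (S.flip m k i j v ⊗ₜ z)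
    simp only [tenBlock, blockHom, WrHecke.lift_s, tenS, Module.End.mul_apply, opU_tmul,
      opV_tmul, flip_flip_apply] at this
    exact this
  · intro i z
    apply homIso_ext
    intro v
    simp only [homBlock, DegHecke.lift_y]
    have := parabolic_block hf k (WrHecke.x i) (v ⊗ₜ z)
    simp only [tenBlock, blockHom, WrHecke.lift_x, tenX, LinearMap.smul_apply, opU_tmul,
      map_smul] at this
    rw [homY_apply]
    change f (v ⊗ₜ δ (S.single m k (DegHecke.y i)) z) = (S.scale k)⁻¹ • α _ (f (v ⊗ₜ z))
    rw [← this, smul_smul, inv_mul_cancel₀ (S.scale_ne_zero k), one_smul]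

end

/-! ### Bijectivity is detected on homomorphism spaces -/

theorem perm_inv_perm (τ : Equiv.Perm (Fin n)) (y : M) :
    α (WrHecke.perm τ⁻¹) (α (WrHecke.perm τ) y) = y := by
  rw [← Module.End.mul_apply, ← map_mul, ← map_mul, inv_mul_cancel, map_one, map_one,
    Module.End.one_apply]

/-- A subrepresentation over `G^n` contains some `V(n̂)` only up to a place permutation. The
symmetric group in `H_n(G)` undoes the twist; the resulting map need not land in `W`, but it does
after the inverse permutation. -/
theorem exists_homSp [FiniteDimensional F M] (W : Subrepresentation (gRep α)) (hW : W ≠ ⊥) :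
    ∃ (m : Comp r n) (τ : Equiv.Perm (Fin n)) (φ : S.HomSp α m), φ ≠ 0 ∧
      ∀ v, α (WrHecke.perm τ) (φ v) ∈ W.toSubmodule := by
  have : Nontrivial W.toSubmodule := Submodule.nontrivial_iff_ne_bot.2 fun h =>
    hW (Subrepresentation.toSubmodule_injective h)
  obtain ⟨m, σ, φ, hφ, hφc⟩ := S.exists_hom W.toRepresentation
  let τ : Equiv.Perm (Fin n) := σ.trans m.pos
  let ψ : S.TV m →ₗ[F] M := α (WrHecke.perm τ) ∘ₗ W.toSubmodule.subtype ∘ₗ φ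
  have hψ : ∀ c v, ψ (S.tvRep m c v) = α (WrHecke.g c) (ψ v) := by
    intro c v
    have hc : c = (c ∘ τ) ∘ τ.symm := by funext a; simp
    have h1 := congrArg Subtype.val (hφc (c ∘ τ) v)
    change (φ (S.tvRep m ((c ∘ τ) ∘ τ.symm) v) : M) = α (WrHecke.g (c ∘ τ)) (φ v) at h1
    rw [← hc] at h1
    change α (WrHecke.perm τ) (φ (S.tvRep m c v)) = α (WrHecke.g c) (α (WrHecke.perm τ) (φ v))
    rw [h1, ← Module.End.mul_apply, ← Module.End.mul_apply, ← map_mul, ← map_mul,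
      WrHecke.perm_mul_g, ← hc]
  have hinv : ∀ v, α (WrHecke.perm τ⁻¹) (S.mkHom ψ hψ v) = φ v := fun v => perm_inv_perm τ _
  refine ⟨m, τ⁻¹, S.mkHom ψ hψ, fun h => hφ ?_, fun v => ?_⟩
  · apply LinearMap.ext
    intro v
    apply Subtype.ext
    rw [← hinv, h]
    exact map_zero _
  · rw [hinv]
    exact (φ v).2

variable (f : M →ₗ[F] N) (hf : ∀ a v, f (α a v) = β a (f v))

/-- A nonzero kernel would contain a permuted image of some nonzero `φ`; as `f` commutes with
permutations, `f ∘ φ = 0`. -/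
theorem injective_of_homMap [FiniteDimensional F M]
    (h : ∀ m : Comp r n, Function.Injective (S.homMap (m := m) f hf)) : Function.Injective f := by
  let W : Subrepresentation (gRep α) :=
    { toSubmodule := LinearMap.ker f
      apply_mem_toSubmodule := fun g v hv => by
        rw [LinearMap.mem_ker] at hv ⊢
        rw [gRep_apply, hf, hv, map_zero] }
  by_contra hinj
  have hW : W ≠ ⊥ := fun h => hinj (LinearMap.ker_eq_bot.1 (congrArg Subrepresentation.toSubmodule h))
  obtain ⟨m, τ, φ, hφ, hφW⟩ := S.exists_homSp W hW
  refine hφ (h m ?_)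
  rw [map_zero]
  apply homIso_ext
  intro v
  rw [homMap_apply]
  have h1 : f (α (WrHecke.perm τ) (φ v)) = 0 := hφW v
  rw [hf] at h1
  have h2 := perm_inv_perm (α := β) τ (f (φ v))
  rw [h1, map_zero] at h2
  exact h2.symm

/-- Semisimplicity gives a complement of the image. A nonzero complement would contain a permuted
image of some `φ ≠ 0`, but `φ` factors through `f`, so that image also lies in the range. -/
theorem surjective_of_homMap [FiniteDimensional F N]
    (hN : (gRep β).IsSemisimpleRepresentation)
    (h : ∀ m : Comp r n, Function.Surjective (S.homMap (m := m) f hf)) :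
    Function.Surjective f := by
  let R : Subrepresentation (gRep β) :=
    { toSubmodule := LinearMap.range f
      apply_mem_toSubmodule := by
        rintro g _ ⟨v, rfl⟩
        exact ⟨α (WrHecke.g g) v, hf _ _⟩ }
  obtain ⟨C, hC⟩ := hN.exists_isCompl R
  have hC0 : C = ⊥ := by
    by_contra hne
    obtain ⟨m, τ, φ, hφ, hφW⟩ := S.exists_homSp C hne
    apply hφ
    apply homIso_ext
    intro v
    obtain ⟨ψ, rfl⟩ := h m φ
    have h1 : β (WrHecke.perm τ) (f (ψ v)) ∈ R.toSubmodule ⊓ C.toSubmodule :=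
      ⟨⟨α (WrHecke.perm τ) (ψ v), hf _ _⟩, hφW v⟩
    have h2 : R.toSubmodule ⊓ C.toSubmodule = ⊥ :=
      congrArg Subrepresentation.toSubmodule hC.inf_eq_bot
    rw [h2, Submodule.mem_bot] at h1
    have h3 := perm_inv_perm (α := β) τ (f (ψ v))
    rw [h1, map_zero] at h3
    exact h3.symm
  have h1 : R ⊔ C = ⊤ := hC.sup_eq_top
  rw [hC0, sup_bot_eq] at h1
  exact LinearMap.range_eq_top.1 (congrArg Subrepresentation.toSubmodule h1)

end SimpleSystem

/-! ### Auxiliary facts: semisimplicity criterion, twisted representations, pure tensors -/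

section

variable {F : Type u} [Field F] {H : Type u} [Group H] {K : Type u} [AddCommGroup K] [Module F K]

/-- The whole module is the sum of the images of the simple modules, and each image is semisimple.
-/
theorem semisimple_of_span {κ : Representation F H K} {ι : Type*} {V : ι → Type u}
    [∀ i, AddCommGroup (V i)] [∀ i, Module F (V i)] (ρ : ∀ i, Representation F H (V i))
    (hρ : ∀ i, (ρ i).IsIrreducible) (f : ∀ i, V i →ₗ[F] K)
    (hf : ∀ i g v, f i (ρ i g v) = κ g (f i v))
    (hspan : ∀ P : Submodule F K, (∀ i v, f i v ∈ P) → P = ⊤) :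
    κ.IsSemisimpleRepresentation := by
  rw [Representation.isSemisimpleRepresentation_iff_isSemisimpleModule_asModule]
  let φ : ∀ i, (ρ i).asModule →ₗ[MonoidAlgebra F H] κ.asModule := fun i =>
    Representation.IntertwiningMap.equivLinearMapAsModule (ρ i) κ
      ((f i).intertwiningMap_of_isIntertwiningMap (ρ i) κ (hf i))
  have hs : ∀ i, IsSimpleModule (MonoidAlgebra F H) (ρ i).asModule := fun i =>
    (Representation.irreducible_iff_isSimpleModule_asModule _).1 (hρ i)
  refine isSemisimpleModule_of_isSemisimpleModule_submodule'
    (p := fun i => LinearMap.range (φ i)) (fun i => .range _) ?_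
  have h := hspan (Subrepresentation.subrepresentationSubmoduleOrderIso.symm
    (⨆ i, LinearMap.range (φ i))).toSubmodule fun i v =>
      (le_iSup (fun i => LinearMap.range (φ i)) i) ⟨v, rfl⟩
  have h2 : Subrepresentation.subrepresentationSubmoduleOrderIso.symm
      (⨆ i, LinearMap.range (φ i)) = ⊤ := Subrepresentation.toSubmodule_injective h
  exact (map_eq_top_iff _).1 h2

/-- A surjective change of groups does not change the invariant subspaces. -/
theorem irreducible_comp {H' : Type u} [Group H'] {ρ : Representation F H K}
    (hρ : ρ.IsIrreducible) (θ : H' →* H) (hθ : Function.Surjective θ) :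
    Representation.IsIrreducible (ρ.comp θ : Representation F H' K) := by
  refine { exists_pair_ne := ⟨⊥, ⊤, fun h => ?_⟩, eq_bot_or_eq_top := fun L => ?_ }
  · apply bot_ne_top (α := Subrepresentation ρ)
    apply Subrepresentation.toSubmodule_injective
    have h' : (⊥ : Submodule F K) = ⊤ := congrArg Subrepresentation.toSubmodule h
    exact h'
  · let L' : Subrepresentation ρ :=
      { toSubmodule := L.toSubmodule
        apply_mem_toSubmodule := fun g => by
          obtain ⟨g, rfl⟩ := hθ g
          exact L.apply_mem_toSubmodule g }
    rcases hρ.eq_bot_or_eq_top L' with h | h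
    · have h' : L.toSubmodule = ⊥ := congrArg (fun W : Subrepresentation ρ => W.toSubmodule) h
      exact Or.inl (Subrepresentation.toSubmodule_injective h')
    · have h' : L.toSubmodule = ⊤ := congrArg (fun W : Subrepresentation ρ => W.toSubmodule) h
      exact Or.inr (Subrepresentation.toSubmodule_injective h')

theorem eq_zero_of_tmul {V U : Type u} [AddCommGroup V] [Module F V] [AddCommGroup U] [Module F U]
    {v : V} (hv : v ≠ 0) {z : U} (h : v ⊗ₜ[F] z = 0) : z = 0 := by
  obtain ⟨φ, hφ⟩ : ∃ φ : Module.Dual F V, φ v ≠ 0 := by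
    by_contra hne
    push Not at hne
    exact hv ((Module.forall_dual_apply_eq_zero_iff F v).1 hne)
  have h1 := congrArg ((TensorProduct.lid F U).toLinearMap ∘ₗ φ.rTensor U) h
  simp only [LinearMap.comp_apply, LinearMap.rTensor_tmul, map_zero, LinearEquiv.coe_coe,
    TensorProduct.lid_tmul] at h1
  exact (smul_eq_zero.1 h1).resolve_left hφ

end

/-! ### The unit: homomorphisms from `V(n̂)` to `𝓖(U)` -/

namespace SimpleSystem

open scoped ModuleCat

variable {F : Type u} [Field F] [IsAlgClosed F] {G : Type u} [Group G] [Fintype G] {r n : ℕ}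
  (S : SimpleSystem F G r)

instance : Fintype (Comp r n) := Fintype.ofFinite _

section

variable {m : Comp r n} {U : Type u} [AddCommGroup U] [Module F U]
  (δ : S.APar m →ₐ[F] Module.End F U)

/-- The comparison of the induced module with the model, as an equivalence of vector spaces. -/
def modelEquiv : Ind (parHom m) (S.tenAct δ) ≃ₗ[F] S.Model m U :=
  show Ind (parHom m) (S.tenAct δ) ≃ₗ[F] S.ModelMod δ from (S.indEquiv δ).restrictScalars F

theorem modelEquiv_smul (a : WrHecke F G n) (y : Ind (parHom m) (S.tenAct δ)) :
    S.modelEquiv δ (a • y) = S.modelAct δ a (S.modelEquiv δ y) :=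
  map_smul (S.indEquiv δ) a y

theorem modelEquiv_unit (w : S.TV m ⊗[F] U) :
    S.modelEquiv δ (indUnit (parHom m) (S.tenAct δ) w) = S.modelSingle (Comp.Shuffle.base m) w :=
  S.indEquiv_unit δ w

theorem smul_modelEquiv_symm (a : WrHecke F G n) (ξ : S.Model m U) :
    a • (S.modelEquiv δ).symm ξ = (S.modelEquiv δ).symm (S.modelAct δ a ξ) := by
  rw [LinearEquiv.eq_symm_apply, modelEquiv_smul, LinearEquiv.apply_symm_apply]

theorem entry_equivariant {m' : Comp r n} {Φ : S.TV m' →ₗ[F] S.Model m U}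
    (hΦ : ∀ g v, Φ (S.tvRep m' g v) = S.modelG g (Φ v)) (σ : m.Shuffle) (g : Fin n → G)
    (v : S.TV m') :
    (LinearMap.proj (φ := fun _ : m.Shuffle => S.TV m ⊗[F] U) σ ∘ₗ Φ) (S.tvRep m' g v) =
      S.opV m (S.tvRep m (g ∘ (σ.toEquiv.trans m.pos).symm))
        ((LinearMap.proj (φ := fun _ : m.Shuffle => S.TV m ⊗[F] U) σ ∘ₗ Φ) v) :=
  congrFun (hΦ g v) σ

/-- The entry at `σ` is an equivariant map into a multiple of `V(n̂)` twisted by `σ`; by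
`hom_eq_zero` it vanishes as soon as one letter differs. -/
theorem letters_of_entry_ne_zero {m' : Comp r n} {Φ : S.TV m' →ₗ[F] S.Model m U}
    (hΦ : ∀ g v, Φ (S.tvRep m' g v) = S.modelG g (Φ v)) {σ : m.Shuffle} {v : S.TV m'}
    (h : Φ v σ ≠ 0) (i : Fin n) : (m'.pos.symm i).1 = (σ i).1 := by
  by_contra hi
  exact h (congrArg (fun T : S.TV m' →ₗ[F] S.TV m ⊗[F] U => T v)
    (S.hom_eq_zero σ.toEquiv _ (S.entry_equivariant hΦ σ) i hi))

theorem model_hom_eq_zero {m' : Comp r n} {Φ : S.TV m' →ₗ[F] S.Model m U}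
    (hΦ : ∀ g v, Φ (S.tvRep m' g v) = S.modelG g (Φ v)) (hm : m' ≠ m) (v : S.TV m') :
    Φ v = 0 := by
  funext σ
  by_contra h
  exact hm (Comp.eq_of_letters m'.pos.symm σ.toEquiv (S.letters_of_entry_ne_zero hΦ h))

/-- Only the standard arrangement has the letters of `V(n̂)` itself, so all other entries vanish.
The standard entry has the form `v ↦ v ⊗ z` by `exists_tmul_of_hom`. -/
theorem exists_modelSingle {Φ : S.TV m →ₗ[F] S.Model m U}
    (hΦ : ∀ g v, Φ (S.tvRep m g v) = S.modelG g (Φ v)) :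
    ∃ z : U, ∀ v, Φ v = S.modelSingle (Comp.Shuffle.base m) (v ⊗ₜ z) := by
  obtain ⟨z, hz⟩ := S.exists_tmul_of_hom
    (LinearMap.proj (φ := fun _ : m.Shuffle => S.TV m ⊗[F] U) (Comp.Shuffle.base m) ∘ₗ Φ) (by
      intro g v
      rw [entry_equivariant S hΦ]
      congr 3
      funext a
      exact congrArg g (m.pos.apply_symm_apply a))
  refine ⟨z, fun v => funext fun σ => ?_⟩
  by_cases hσ : σ = Comp.Shuffle.base m
  · subst hσ
    rw [← hz]
    simp
  · have : S.modelSingle (Comp.Shuffle.base m) (v ⊗ₜ z) σ = 0 := by simp [hσ]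
    rw [this]
    by_contra h
    exact hσ (Comp.Shuffle.eq_of_letters _ _ fun i => (S.letters_of_entry_ne_zero hΦ h i).symm)

end

section

variable (U : FdMod F (S.A n))

/-- The action of `A_{n,r}` on a module, as a homomorphism to the endomorphisms. -/
abbrev actA : S.A n →ₐ[F] Module.End F U.obj := Algebra.lsmul F F U.obj

/-- The inclusion of a summand of `𝓖(U)`. -/
def summandIn (m : Comp r n) : S.IndComp (S.actA U) m →ₗ[WrHecke F G n] (S.functorG n).obj U :=
  DirectSum.lof (WrHecke F G n) (Comp r n) (fun m => S.IndComp (S.actA U) m) m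

/-- The projection of `𝓖(U)` to a summand. -/
def summandOut (m : Comp r n) : (S.functorG n).obj U →ₗ[WrHecke F G n] S.IndComp (S.actA U) m :=
  DirectSum.component (WrHecke F G n) (Comp r n) (fun m => S.IndComp (S.actA U) m) m

theorem summandOut_in (m : Comp r n) (z : S.IndComp (S.actA U) m) :
    S.summandOut U m (S.summandIn U m z) = z :=
  DirectSum.component.lof_self (WrHecke F G n) (M := fun m => S.IndComp (S.actA U) m) m z

theorem summandOut_in_ne {m m' : Comp r n} (h : m' ≠ m) (z : S.IndComp (S.actA U) m') :
    S.summandOut U m (S.summandIn U m' z) = 0 := by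
  have := DirectSum.component.of (WrHecke F G n) (M := fun m => S.IndComp (S.actA U) m) m m' z
  rw [dif_neg h] at this
  exact this

theorem summandOut_ext {x y : (S.functorG n).obj U}
    (h : ∀ m, S.summandOut U m x = S.summandOut U m y) : x = y :=
  DirectSum.ext_component (WrHecke F G n) h

theorem sum_summandIn (x : (S.functorG n).obj U) :
    ∑ m, S.summandIn U m (S.summandOut U m x) = x := by
  apply S.summandOut_ext U
  intro m
  rw [map_sum, Finset.sum_eq_single m, summandOut_in]
  · intro m' _ hm
    exact S.summandOut_in_ne U hm _
  · simp

/-- The projection of an `A_{n,r}`-module to a component. -/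
def toComponent (m : Comp r n) : U.obj →ₗ[F] S.component (S.actA U) m :=
  (S.actA U (Pi.single m 1)).rangeRestrict

theorem toComponent_val (m : Comp r n) (z : U.obj) :
    (S.toComponent U m z : U.obj) = (Pi.single m 1 : S.A n) • z := rfl

theorem toComponent_act (m : Comp r n) (a : S.A n) (z : U.obj) :
    S.toComponent U m (a • z) = S.compAct (S.actA U) m (a m) (S.toComponent U m z) := by
  apply Subtype.ext
  change (Pi.single m 1 : S.A n) • a • z = (Pi.single m (a m) : S.A n) • (Pi.single m 1 : S.A n) • z
  rw [smul_smul, smul_smul]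
  congr 1
  funext m'
  by_cases h : m' = m
  · subst h; simp
  · simp [h]

theorem sum_toComponent (z : U.obj) : ∑ m, (S.toComponent U m z : U.obj) = z := by
  simp only [toComponent_val]
  rw [← Finset.sum_smul]
  have : ∑ m : Comp r n, (Pi.single m 1 : S.A n) = 1 :=
    Finset.univ_sum_single (1 : S.A n)
  rw [this, one_smul]

theorem toComponent_same (m : Comp r n) (z : S.component (S.actA U) m) :
    S.toComponent U m z = z :=
  Subtype.ext (S.one_act (S.actA U) z z.2)

theorem toComponent_ne {m m' : Comp r n} (h : m ≠ m') (z : S.component (S.actA U) m') :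
    S.toComponent U m z = 0 := by
  rw [← S.toComponent_same U m' z]
  apply Subtype.ext
  rw [toComponent_val, toComponent_val, smul_smul]
  have : (Pi.single m 1 * Pi.single m' 1 : S.A n) = 0 := by
    funext k
    by_cases hk : k = m
    · subst hk; simp [h]
    · simp [hk]
  rw [this, zero_smul]
  rfl

/-- The homomorphism `V(n̂) ⊗ U_{n̂} → 𝓖(U)` over the parabolic subalgebra. -/
def unitPart (m : Comp r n) :
    S.TV m ⊗[F] S.component (S.actA U) m →ₗ[F] (S.functorG n).obj U :=
  (S.summandIn U m).restrictScalars F ∘ₗ indUnit (parHom m) (S.tenAct (S.compAct (S.actA U) m))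

theorem modelEquiv_unitPart (m : Comp r n) (w : S.TV m ⊗[F] S.component (S.actA U) m) :
    S.modelEquiv _ (S.summandOut U m (S.unitPart U m w)) =
      S.modelSingle (Comp.Shuffle.base m) w :=
  (congrArg (S.modelEquiv _) (S.summandOut_in U m _)).trans (S.modelEquiv_unit _ w)

theorem modelEquiv_unitPart_ne {m m' : Comp r n} (hm : m ≠ m')
    (w : S.TV m ⊗[F] S.component (S.actA U) m) :
    S.modelEquiv _ (S.summandOut U m' (S.unitPart U m w)) = 0 :=
  (congrArg (S.modelEquiv _) (S.summandOut_in_ne U hm _)).trans (map_zero _)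

theorem unitPart_act (m : Comp r n) (b : ParHecke F G m)
    (w : S.TV m ⊗[F] S.component (S.actA U) m) :
    S.unitPart U m (S.tenAct (S.compAct (S.actA U) m) b w) =
      (Algebra.lsmul F F ((S.functorG n).obj U) : WrHecke F G n →ₐ[F] _) (parHom m b)
        (S.unitPart U m w) := by
  change S.summandIn U m (indUnit _ _ _) = parHom m b • S.summandIn U m (indUnit _ _ w)
  rw [indUnit_act, map_smul]

/-- The unit `U → 𝓕(𝓖(U))`. -/
def unitLin : U.obj →ₗ[S.A n] ∀ m : Comp r n, S.HomMod ((S.functorG n).obj U) m where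
  toFun z m := curryHom (S.unitPart_act U m) (S.toComponent U m z)
  map_add' y z := funext fun m => by
    rw [map_add, map_add]
    rfl
  map_smul' a z := funext fun m => by
    rw [toComponent_act, curryHom_act]
    rfl

/-- The value at a vector of an element of `Hom(V(n̂), I M)`. -/
def homVal {M : ModuleCat.{u} (WrHecke F G n)} {m : Comp r n} (φ : S.HomMod M m) :
    S.TV m →ₗ[F] M :=
  S.evalMap m (Algebra.lsmul F F M) ∘ₗ
    (TensorProduct.mk F (S.TV m) (S.HomSp (Algebra.lsmul F F M) m)).flip φ

theorem homVal_g {M : ModuleCat.{u} (WrHecke F G n)} {m : Comp r n} (φ : S.HomMod M m)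
    (c : Fin n → G) (v : S.TV m) :
    S.homVal φ (S.tvRep m c v) = (WrHecke.g c : WrHecke F G n) • S.homVal φ v :=
  homIso_equivariant (show S.HomSp (Algebra.lsmul F F M) m from φ) c v

theorem homVal_ext {M : ModuleCat.{u} (WrHecke F G n)} {m : Comp r n} {φ ψ : S.HomMod M m}
    (h : ∀ v, S.homVal φ v = S.homVal ψ v) : φ = ψ := homIso_ext h

theorem unitLin_val (z : U.obj) (m : Comp r n) (v : S.TV m) :
    S.homVal (S.unitLin U z m) v =
      S.summandIn U m (indUnit (parHom m) (S.tenAct (S.compAct (S.actA U) m))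
        (v ⊗ₜ S.toComponent U m z)) := rfl

/-- In the model `v ⊗ z` is visible as the standard entry, so nothing of `V(n̂) ⊗ U_{n̂}` is lost
under induction. -/
theorem unitLin_injective : Function.Injective (S.unitLin U) := by
  rw [← LinearMap.ker_eq_bot, LinearMap.ker_eq_bot']
  intro z hz
  rw [← S.sum_toComponent U z]
  apply Finset.sum_eq_zero
  intro m _
  obtain ⟨v, hv⟩ := @exists_ne _ S.tv_nontrivial (0 : S.TV m)
  have h1 := S.unitLin_val U z m v
  rw [hz] at h1
  have h2 := congrArg (S.summandOut U m) h1
  rw [summandOut_in, show S.homVal ((0 : ∀ m : Comp r n, S.HomMod ((S.functorG n).obj U) m) m) v = 0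
    from rfl, map_zero] at h2
  have h3 := congrArg (S.modelEquiv (S.compAct (S.actA U) m)) h2
  rw [modelEquiv_unit, map_zero] at h3
  have h4 : v ⊗ₜ[F] S.toComponent U m z = 0 :=
    Pi.single_injective (M := fun _ : m.Shuffle => S.TV m ⊗[F] S.component (S.actA U) m) _
      (h3.symm.trans (Pi.single_zero _).symm)
  rw [eq_zero_of_tmul hv h4]
  rfl

/-- Projected to the summand of another composition, the map vanishes because the letters cannot
match. In its own summand it comes from a vector of `U_{n̂}` at the standard arrangement. -/
theorem homMod_functorG (m : Comp r n) (Φ : S.HomMod ((S.functorG n).obj U) m) :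
    ∃ z : S.component (S.actA U) m, ∀ v, S.homVal Φ v = S.unitPart U m (v ⊗ₜ z) := by
  let Ψ : ∀ m' : Comp r n, S.TV m →ₗ[F] S.Model m' (S.component (S.actA U) m') := fun m' =>
    (S.modelEquiv (S.compAct (S.actA U) m')).toLinearMap ∘ₗ
      (S.summandOut U m').restrictScalars F ∘ₗ S.homVal Φ
  have hΨ : ∀ m' g v, Ψ m' (S.tvRep m g v) = S.modelG g (Ψ m' v) := by
    intro m' g v
    change S.modelEquiv _ (S.summandOut U m' (S.homVal Φ (S.tvRep m g v))) =
      S.modelG g (S.modelEquiv _ (S.summandOut U m' (S.homVal Φ v)))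
    rw [homVal_g, map_smul, modelEquiv_smul, modelAct_g]
  obtain ⟨z, hz⟩ := S.exists_modelSingle (hΨ m)
  refine ⟨z, fun v => S.summandOut_ext U fun m' => ?_⟩
  apply (S.modelEquiv (S.compAct (S.actA U) m')).injective
  by_cases hm : m = m'
  · subst hm
    exact (hz v).trans (S.modelEquiv_unitPart U m _).symm
  · exact (S.model_hom_eq_zero (hΨ m') hm v).trans (S.modelEquiv_unitPart_ne U hm _).symm

theorem unitLin_surjective : Function.Surjective (S.unitLin U) := by
  intro Φ
  choose z hz using fun m => S.homMod_functorG U m (Φ m)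
  refine ⟨∑ m, (z m : U.obj), funext fun m => S.homVal_ext fun v => ?_⟩
  rw [unitLin_val, hz]
  have : S.toComponent U m (∑ m, (z m : U.obj)) = z m := by
    rw [map_sum, Finset.sum_eq_single m, toComponent_same]
    · intro m' _ hm
      exact S.toComponent_ne U hm.symm _
    · simp
  rw [this]
  rfl

/-! ### The module `𝓖(U)` is finite-dimensional and semisimple over `FG^n` -/

/-- The map `V(n̂) → 𝓖(U)` given by an arrangement and a vector of `U_{n̂}`. -/
def arrange (m : Comp r n) (σ : m.Shuffle) :
    S.TV m ⊗[F] S.component (S.actA U) m →ₗ[F] (S.functorG n).obj U :=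
  (S.summandIn U m).restrictScalars F ∘ₗ
    (S.modelEquiv (S.compAct (S.actA U) m)).symm.toLinearMap ∘ₗ S.modelSingle σ

theorem sum_arrange (x : (S.functorG n).obj U) :
    ∑ m, ∑ σ : m.Shuffle, S.arrange U m σ
      (S.modelEquiv (S.compAct (S.actA U) m) (S.summandOut U m x) σ) = x := by
  refine Eq.trans (Finset.sum_congr rfl fun m _ => ?_) (S.sum_summandIn U x)
  set ξ : S.Model m (S.component (S.actA U) m) :=
    S.modelEquiv (S.compAct (S.actA U) m) (S.summandOut U m x) with hξ
  change ∑ σ : m.Shuffle, S.summandIn U m ((S.modelEquiv (S.compAct (S.actA U) m)).symm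
    (S.modelSingle σ (ξ σ))) = _
  rw [← map_sum, ← map_sum]
  congr 1
  rw [LinearEquiv.symm_apply_eq]
  exact LinearMap.sum_single_apply _ ξ

theorem arrange_g (m : Comp r n) (σ : m.Shuffle) (c : Fin n → G)
    (w : S.TV m ⊗[F] S.component (S.actA U) m) :
    (WrHecke.g c : WrHecke F G n) • S.arrange U m σ w =
      S.arrange U m σ (S.opV m (S.tvRep m (c ∘ σ.toPerm.symm)) w) := by
  change (WrHecke.g c : WrHecke F G n) • S.summandIn U m ((S.modelEquiv _).symm _) =
    S.summandIn U m ((S.modelEquiv _).symm _)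
  rw [← map_smul, smul_modelEquiv_symm, modelAct_g, modelG_single]

theorem finite_functorG : Module.Finite F ((S.functorG n).obj U) := by
  have hU : Module.Finite F U.obj := U.property
  let L : (∀ m : Comp r n, S.Model m (S.component (S.actA U) m)) →ₗ[F] (S.functorG n).obj U :=
    ∑ m, (∑ σ : m.Shuffle, S.arrange U m σ ∘ₗ LinearMap.proj σ) ∘ₗ LinearMap.proj m
  have : ∀ m : Comp r n, Module.Finite F (S.TV m) := fun m => inferInstance
  have : ∀ m : Comp r n, Module.Finite F (S.Model m (S.component (S.actA U) m)) :=
    fun m => inferInstanceAs (Module.Finite F (m.Shuffle → S.TV m ⊗[F] S.component (S.actA U) m))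
  refine Module.Finite.of_surjective L fun x =>
    ⟨fun m => S.modelEquiv (S.compAct (S.actA U) m) (S.summandOut U m x), ?_⟩
  refine Eq.trans ?_ (S.sum_arrange U x)
  rw [LinearMap.sum_apply]
  refine Finset.sum_congr rfl fun m _ => ?_
  rw [LinearMap.comp_apply, LinearMap.sum_apply]
  rfl

theorem isModS_functorG : IsModS F G n ((S.functorG n).obj U) := by
  refine ⟨S.finite_functorG U, ?_⟩
  -- A composition, an arrangement and a vector of the component give one map from a twisted
  -- `V(n̂)`; the images of these maps span `𝓖(U)`.
  let I : Type u := Σ m : Comp r n, m.Shuffle × S.component (S.actA U) m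
  let θ : I → ((Fin n → G) →* (Fin n → G)) := fun i =>
    { toFun := fun c => c ∘ i.2.1.toPerm.symm
      map_one' := rfl
      map_mul' := fun _ _ => rfl }
  refine semisimple_of_span (ι := I) (V := fun i => S.TV i.1)
    (fun i => (S.tvRep i.1).comp (θ i))
    (fun i => irreducible_comp S.tvRep_irreducible (θ i) fun c =>
      ⟨c ∘ i.2.1.toPerm, by funext a; simp [θ]⟩)
    (fun i => S.arrange U i.1 i.2.1 ∘ₗ (TensorProduct.mk F _ _).flip i.2.2) ?_ ?_
  · rintro ⟨m, σ, z⟩ g v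
    exact (S.arrange_g U m σ g (v ⊗ₜ z)).symm
  · intro P hP
    rw [eq_top_iff]
    intro x _
    rw [← S.sum_arrange U x]
    refine Submodule.sum_mem _ fun m _ => Submodule.sum_mem _ fun σ _ => ?_
    have : ∀ w, S.arrange U m σ w ∈ P := by
      intro w
      induction w with
      | zero => rw [map_zero]; exact Submodule.zero_mem _
      | tmul v z => exact hP ⟨m, σ, z⟩ v
      | add x y hx hy => rw [map_add]; exact Submodule.add_mem _ hx hy
    exact this _

end

end SimpleSystem

namespace SimpleSystem

open scoped ModuleCat

variable {F : Type u} [Field F] [IsAlgClosed F] {G : Type u} [Group G] [Fintype G] {r n : ℕ}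
  (S : SimpleSystem F G r)

/-! ### The counit -/

section

variable (M : ModS F G n)

/-- The action of the wreath Hecke algebra on a module. -/
abbrev actH (M : ModuleCat.{u} (WrHecke F G n)) : WrHecke F G n →ₐ[F] Module.End F M :=
  Algebra.lsmul F F M

/-- The projection from a component of `𝓕(M)` to `Hom(V(n̂), I M)`. -/
def homProj (m : Comp r n) :
    S.component (S.actA ((S.functorF n).obj M)) m →ₗ[F] S.HomSp (actH M.obj) m where
  toFun z := (show ∀ m, S.HomMod M.obj m from z.1) m
  map_add' _ _ := rfl
  map_smul' c z :=
    -- On the component the field acts through `A_{n,r}`, on the target by its own structure; the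
    -- two actions agree.
    algebraMap_smul (M := S.HomMod M.obj m) (S.APar m) c ((show ∀ m, S.HomMod M.obj m from z.1) m)

theorem homProj_act (m : Comp r n) (a : S.APar m)
    (z : S.component (S.actA ((S.functorF n).obj M)) m) :
    S.homProj M m (S.compAct (S.actA ((S.functorF n).obj M)) m a z) =
      S.homAct (actH M.obj) m a (S.homProj M m z) := by
  change (Pi.single m a : S.A n) m • (show ∀ m, S.HomMod M.obj m from z.1) m = _
  rw [Pi.single_eq_same]
  rfl

/-- The part of the counit on a component. -/
def counitPart (m : Comp r n) :
    S.TV m ⊗[F] S.component (S.actA ((S.functorF n).obj M)) m →ₗ[F] M.obj :=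
  S.evalMap m (actH M.obj) ∘ₗ (S.homProj M m).lTensor (S.TV m)

/-- This equivariance over the parabolic subalgebra is what Frobenius reciprocity needs to extend
the evaluation map to the induced module. -/
theorem counitPart_act (m : Comp r n) (b : ParHecke F G m)
    (w : S.TV m ⊗[F] S.component (S.actA ((S.functorF n).obj M)) m) :
    S.counitPart M m (S.tenAct (S.compAct (S.actA ((S.functorF n).obj M)) m) b w) =
      parHom m b • S.counitPart M m w := by
  rw [counitPart, LinearMap.comp_apply,
    S.tenAct_map _ (S.homAct (actH M.obj) m) _ (S.homProj_act M m), evalMap_act]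
  rfl

/-- The counit `𝓖(𝓕(M)) → M`. -/
def counitLin : (S.functorG n).obj ((S.functorF n).obj M) →ₗ[WrHecke F G n] M.obj :=
  DirectSum.toModule (WrHecke F G n) (Comp r n) M.obj fun m =>
    indLift (parHom m) (S.tenAct (S.compAct (S.actA ((S.functorF n).obj M)) m))
      (S.counitPart M m) (S.counitPart_act M m)

theorem counitLin_mk (m : Comp r n) (a : WrHecke F G n)
    (w : S.TV m ⊗[F] S.component (S.actA ((S.functorF n).obj M)) m) :
    S.counitLin M (S.summandIn _ m (indMk _ _ (a ⊗ₜ w))) = a • S.counitPart M m w :=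
  (DirectSum.toModule_lof (WrHecke F G n) m _).trans
    (indLift_mk _ (S.counitPart_act M m) a w)

theorem counitLin_unitPart (m : Comp r n)
    (w : S.TV m ⊗[F] S.component (S.actA ((S.functorF n).obj M)) m) :
    S.counitLin M (S.unitPart _ m w) = S.counitPart M m w :=
  (S.counitLin_mk M m 1 w).trans (one_smul _ _)

theorem counitPart_tmul (m : Comp r n) (v : S.TV m) (Φ : ∀ m, S.HomMod M.obj m) :
    S.counitPart M m (v ⊗ₜ S.toComponent ((S.functorF n).obj M) m Φ) = S.homVal (Φ m) v := by
  have : S.homProj M m (S.toComponent ((S.functorF n).obj M) m Φ) = Φ m := by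
    change (Pi.single m 1 : S.A n) m • Φ m = Φ m
    rw [Pi.single_eq_same, one_smul]
  change S.evalMap m _ (v ⊗ₜ S.homProj M m _) = _
  rw [this]
  rfl

end

/-! ### Naturality and invertibility of the unit and the counit -/

theorem functorG_hom_ext {U : FdMod F (S.A n)} {X : Type u} [AddCommGroup X]
    [Module (WrHecke F G n) X] {f g : (S.functorG n).obj U →ₗ[WrHecke F G n] X}
    (h : ∀ m a w, f (S.summandIn U m (indMk _ _ (a ⊗ₜ w))) =
      g (S.summandIn U m (indMk _ _ (a ⊗ₜ w)))) : f = g :=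
  DirectSum.linearMap_ext _ fun m => ind_ext fun a w => h m a w

theorem functorG_map_mk {U U' : FdMod F (S.A n)} (f : U ⟶ U') (m : Comp r n) (a : WrHecke F G n)
    (w : S.TV m ⊗[F] S.component (S.actA U) m) :
    ((S.functorG n).map f).hom (S.summandIn U m (indMk _ _ (a ⊗ₜ w))) =
      S.summandIn U' m (indMk _ _ (a ⊗ₜ (S.compMap (η := S.actA U) (η' := S.actA U') m
        (f.hom.hom.restrictScalars F) (fun a z => map_smul f.hom.hom a z)).lTensor (S.TV m) w)) :=
  DirectSum.lmap_lof _ _ _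

theorem homVal_map {M N : ModuleCat.{u} (WrHecke F G n)} (f : M ⟶ N) (m : Comp r n)
    (φ : S.HomMod M m) (v : S.TV m) : S.homVal (S.homModMap f m φ) v = f.hom (S.homVal φ v) := rfl

/-- The functor `𝓖`, with values in `H_n(G)-mod^s`. -/
def functorGS (n : ℕ) : FdMod F (S.A n) ⥤ ModS F G n :=
  (IsModS F G n).lift (S.functorG n) fun U => S.isModS_functorG U

/-- The unit of the equivalence, as a natural transformation. -/
def unitTrans (n : ℕ) : 𝟭 (FdMod F (S.A n)) ⟶ S.functorGS n ⋙ S.functorF n where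
  app U := ObjectProperty.homMk (ModuleCat.ofHom (S.unitLin U))
  naturality U U' f := by
    apply ObjectProperty.hom_ext
    apply ModuleCat.hom_ext
    apply LinearMap.ext
    intro z
    refine funext fun m => S.homVal_ext fun v => ?_
    change S.homVal (S.unitLin U' (f.hom.hom z) m) v =
      S.homVal (S.homModMap ((S.functorG n).map f) m (S.unitLin U z m)) v
    rw [homVal_map, unitLin_val, unitLin_val]
    refine Eq.trans ?_ (S.functorG_map_mk f m 1 _).symm
    have : S.compMap (η := S.actA U) (η' := S.actA U') m (f.hom.hom.restrictScalars F)
        (fun a z => map_smul f.hom.hom a z) (S.toComponent U m z) =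
        S.toComponent U' m (f.hom.hom z) :=
      Subtype.ext (map_smul f.hom.hom _ z)
    rw [LinearMap.lTensor_tmul, this]
    rfl

theorem counitLin_naturality {M N : ModS F G n} (f : M ⟶ N) :
    S.counitLin N ∘ₗ ((S.functorG n).map ((S.functorF n).map f)).hom =
      f.hom.hom ∘ₗ S.counitLin M := by
  apply S.functorG_hom_ext
  intro m a w
  rw [LinearMap.comp_apply, LinearMap.comp_apply, functorG_map_mk, counitLin_mk, counitLin_mk,
    map_smul]
  congr 1
  induction w with
  | zero => simp only [map_zero]
  | tmul v z => rfl
  | add x y hx hy => simp only [map_add, hx, hy]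

/-- The counit of the equivalence, as a natural transformation. -/
def counitTrans (n : ℕ) : S.functorF n ⋙ S.functorGS n ⟶ 𝟭 (ModS F G n) where
  app M := ObjectProperty.homMk (ModuleCat.ofHom (S.counitLin M))
  naturality M N f := by
    apply ObjectProperty.hom_ext
    apply ModuleCat.hom_ext
    exact S.counitLin_naturality f

theorem isIso_of_bijective {A : Type u} [Ring A] {P : ObjectProperty (ModuleCat.{u} A)}
    {X Y : P.FullSubcategory} (f : X ⟶ Y) (h : Function.Bijective f.hom.hom) : IsIso f := by
  have : IsIso (P.ι.map f) := (ConcreteCategory.isIso_iff_bijective (P.ι.map f)).2 h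
  exact isIso_of_reflects_iso f P.ι

theorem isIso_unitTrans (n : ℕ) : IsIso (S.unitTrans n) := by
  rw [NatTrans.isIso_iff_isIso_app]
  intro U
  exact isIso_of_bijective _ ⟨S.unitLin_injective U, S.unitLin_surjective U⟩

/-- The unit sends `Φ` to the maps `v ↦ 1 ⊗ (v ⊗ Φ_{n̂})`, and the counit evaluates them. -/
theorem triangle (M : ModS F G n) (Φ : ∀ m, S.HomMod M.obj m) (m : Comp r n) :
    S.homModMap (ModuleCat.ofHom (S.counitLin M)) m
      (S.unitLin ((S.functorF n).obj M) Φ m) = Φ m := by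
  apply S.homVal_ext
  intro v
  rw [homVal_map]
  exact (S.counitLin_unitPart M m _).trans (S.counitPart_tmul M m v Φ)

/-- By `triangle`, `𝓕` of the counit is a left inverse of the unit at `𝓕(M)`. The unit is bijective,
so this left inverse is bijective too. -/
theorem homModMap_counit_bijective (M : ModS F G n) (m : Comp r n) :
    Function.Bijective (S.homModMap (ModuleCat.ofHom (S.counitLin M)) m) := by
  constructor
  · intro φ ψ h
    -- Elements for a single composition are extended by zero, because the unit produces whole
    -- families.
    obtain ⟨Φ, hΦ⟩ := S.unitLin_surjective ((S.functorF n).obj M) (Pi.single m φ)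
    obtain ⟨Ψ, hΨ⟩ := S.unitLin_surjective ((S.functorF n).obj M) (Pi.single m ψ)
    have h1 : ∀ l, (show ∀ m, S.HomMod M.obj m from Φ) l = (show ∀ m, S.HomMod M.obj m from Ψ) l := by
      intro l
      rw [← S.triangle M Φ l, ← S.triangle M Ψ l, hΦ, hΨ]
      by_cases hl : l = m
      · subst hl
        rw [Pi.single_eq_same, Pi.single_eq_same, h]
      · rw [Pi.single_eq_of_ne hl, Pi.single_eq_of_ne hl]
    have h2 : Φ = Ψ := funext h1
    rw [h2, hΨ] at hΦ
    exact (Pi.single_injective m hΦ).symm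
  · intro φ
    exact ⟨_, (S.triangle M (Pi.single m φ) m).trans (Pi.single_eq_same _ _)⟩

/-- The counit is bijective after `𝓕`; source and target are finite-dimensional and the target is
semisimple over `FG^n`, so bijectivity is detected on the homomorphism spaces. -/
theorem isIso_counitTrans (n : ℕ) : IsIso (S.counitTrans n) := by
  rw [NatTrans.isIso_iff_isIso_app]
  intro M
  have hG : Module.Finite F ((S.functorG n).obj ((S.functorF n).obj M)) := S.finite_functorG _
  have hM : Module.Finite F M.obj := M.property.1
  refine isIso_of_bijective _ ⟨?_, ?_⟩
  · exact S.injective_of_homMap (α := actH _) (β := actH M.obj)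
      ((S.counitLin M).restrictScalars F) (fun a v => map_smul (S.counitLin M) a v)
      fun m => (S.homModMap_counit_bijective M m).1
  · exact S.surjective_of_homMap (α := actH _) (β := actH M.obj)
      ((S.counitLin M).restrictScalars F) (fun a v => map_smul (S.counitLin M) a v)
      M.property.2 fun m => (S.homModMap_counit_bijective M m).2

end SimpleSystem

end WreathMorita

end

/-! ### The equivalence of categories -/

theorem theorem3 {F : Type u} [Field F] [IsAlgClosed F] {G : Type u} [Group G] [Fintype G] {r : ℕ}
    (S : WreathMorita.SimpleSystem F G r) (n : ℕ) :
    ∃ hG : ∀ U, WreathMorita.IsModS F G n ((S.functorG n).obj U),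
      (S.functorF n).IsEquivalence ∧
      Nonempty (S.functorF n ⋙ (WreathMorita.IsModS F G n).lift (S.functorG n) hG ≅
        𝟭 (WreathMorita.ModS F G n)) ∧
      Nonempty ((WreathMorita.IsModS F G n).lift (S.functorG n) hG ⋙ S.functorF n ≅
        𝟭 (WreathMorita.FdMod F (S.A n))) := by
  have h1 := S.isIso_unitTrans n
  have h2 := S.isIso_counitTrans n
  let unit : 𝟭 _ ≅ S.functorGS n ⋙ S.functorF n := asIso (S.unitTrans n)
  let counit : S.functorF n ⋙ S.functorGS n ≅ 𝟭 _ := asIso (S.counitTrans n)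
  -- `S.functorGS n` is by definition the lift of `S.functorG n` along this membership proof, so
  -- both isomorphisms have the required form.
  exact ⟨S.isModS_functorG, (CategoryTheory.Equivalence.mk (S.functorF n) (S.functorGS n)
    counit.symm unit.symm).isEquivalence_functor, ⟨counit⟩, ⟨unit.symm⟩⟩
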